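/- For a matrix $B=[A,b]\in\mathbb{R}^{m\times(d+1)}$, a weight vector $w\in\mathbb{R}^m$ and $\beta\in\mathbb{R}^d$ let $f_w(B;\beta)=\sum_{i=1}^m w_i\,|(A\beta-b)_i|$. Given $X\in\mathbb{R}^{n\times d}$, $Y\in\mathbb{R}^n$ and a minimizer $\beta^*$ of $\|X\beta-Y\|_1$, a matrix $X'\in\mathbb{R}^{r\times(d+1)}$ with weights $w\in\mathbb{R}^r_{>0}$ is a weak weighted $(\mathbb{R}^d,\alpha,\varepsilon)$-sketch for $\ell_1$ regression (a lopsided embedding) if $f_w(X';\beta)\ge(1-\varepsilon)\|X\beta-Y\|_1$ for all $\beta\in\mathbb{R}^d$ and $f_w(X';\beta^*)\le\alpha\,\|X\beta^*-Y\|_1$. A distribution over pairs $(S,w)$, with $S\in\mathbb{R}^{r\times n}$ and $w\in\mathbb{R}^r$, succeeds with parameters $(\alpha,\varepsilon)$ and failure probability at most $P$ if for all $X\in\mathbb{R}^{n\times d}$, $Y\in\mathbb{R}^n$ and every minimizer $\beta^*$ of $\|X\beta-Y\|_1$, all fixed independently of $(S,w)$, the pair $(S[X,Y],w)$ is a weak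 weighted $(\mathbb{R}^d,\alpha,\varepsilon)$-sketch for $\ell_1$ regression with probability at least $1-P$. It has update time $\tau$ if, for every draw, $S[X,Y]$ can be maintained in a single pass over any turnstile stream of additive updates to the entries of $[X,Y]$, with at most $\tau L$ steps for $L$ updates; a step is the reading of one update, or the fetching of one bucket and coefficient assigned to its row (drawn in advance with $S$) together with one multiply-and-add to a counter. In particular, $S[X,Y]$ is then computed in at most $\tau\cdot\mathrm{nnz}([X,Y])$ steps if every non-zero entry is inserted once. Let $n\ge2$ and $d\ge1$. 1. For all constants $c\in(0,1]$ and $\varepsilon>0$ there are $K$ and $P<1$, depending only on $c$ and $\varepsilon$, such that for all such $n,d$ there are $r\le K\,d^{1+c}\ln(n)^{3+5c}$ and a distribution over $(S,w)$ that has update time $K\,d\ln n$ (so a total time $O(d\ln(n)\,\mathrm{nnz}([X,Y]))$) and succeeds with parameters $(1+\frac1c,\varepsilon)$ and failure probability at most $P$. 2. There is an absolute constant $K$ such that for all $\varepsilon,\delta>0$, all $a>1$ and all such $n,d$ there are $$r\le K\,\frac{d^4\ln(n)^5}{\delta\varepsilon^7}+\frac{32\,d\ln(n)^3}{\varepsilon^5}\left(\frac{64\,d\ln(n)^5}{\varepsilon^6\delta}\right)^{1+\varepsilon^{-1}}$$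 and a distribution over $(S,w)$ that has update time $K$ (so a total time $O(\mathrm{nnz}([X,Y]))$) and succeeds with parameters $(1+a\varepsilon,\varepsilon)$ and failure probability at most $\delta+\frac1a$. -/

import Mathlib

open MeasureTheory

/-- The augmented data matrix `[X, Y]`; the column indexed by `Sum.inr ()` is the target `Y`. -/
def augment {n d : ℕ} (X : Matrix (Fin n) (Fin d) ℝ) (Y : Fin n → ℝ) :
    Matrix (Fin n) (Fin d ⊕ Unit) ℝ :=
  Matrix.fromCols X (Matrix.replicateCol Unit Y)

/-- The weighted `ℓ₁` regression loss of the (possibly sketched) data matrix `B = [A, b]`: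
`∑ i, w i * |(A β - b) i|`, where the residual `A β - b` is written as `[A, b] (β, -1)`. -/
def l1Loss {m d : ℕ} (w : Fin m → ℝ) (B : Matrix (Fin m) (Fin d ⊕ Unit) ℝ)
    (β : Fin d → ℝ) : ℝ :=
  ∑ i, w i * |(B.mulVec (Sum.elim β (fun _ => (-1 : ℝ)))) i|

/-- For the original, unweighted data the loss is `‖X β - Y‖₁`. -/
theorem l1Loss_augment {n d : ℕ} (X : Matrix (Fin n) (Fin d) ℝ) (Y : Fin n → ℝ)
    (β : Fin d → ℝ) :
    l1Loss (fun _ => 1) (augment X Y) β = ∑ i, |(X.mulVec β) i - Y i| := by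
  unfold l1Loss augment
  refine Finset.sum_congr rfl fun i _ => ?_
  rw [one_mul, Matrix.fromCols_mulVec]
  congr 1
  simp [Matrix.mulVec, dotProduct, sub_eq_add_neg]

/-- `(B', w')` is a weak weighted `(V, α, ε)`-sketch of the weighted data `(B, w)` for `ℓ₁`
regression; `βs` is the minimizer over `V` of the loss on the original data. -/
structure IsWeakWeightedSketch {m r d : ℕ} (V : Set (Fin d → ℝ)) (α ε : ℝ)
    (B : Matrix (Fin m) (Fin d ⊕ Unit) ℝ) (w : Fin m → ℝ) (βs : Fin d → ℝ)
    (B' : Matrix (Fin r) (Fin d ⊕ Unit) ℝ) (w' : Fin r → ℝ) : Prop where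
  weight_pos : ∀ i, 0 < w' i
  contraction : ∀ β ∈ V, (1 - ε) * l1Loss w B β ≤ l1Loss w' B' β
  dilation : l1Loss w' B' βs ≤ α * l1Loss w B βs
  outside : ∀ β, β ∉ V → ∃ β₀ ∈ V, IsMinOn (l1Loss w' B') V β₀ ∧
    l1Loss w' B' β₀ < l1Loss w' B' β

/-- A distribution over pairs of an `r × n` sketching matrix and a weight vector, given as
random variables on a probability space. -/
structure RandomSketch (r n : ℕ) where
  Ω : Type
  mΩ : MeasurableSpace Ω
  ℙ : Measure Ω
  prob : IsProbabilityMeasure ℙ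
  S : Ω → Matrix (Fin r) (Fin n) ℝ
  w : Ω → Fin r → ℝ
  measurable_S : ∀ k i, Measurable fun ω => S ω k i
  measurable_w : ∀ k, Measurable fun ω => w ω k

/-- A turnstile update: add the (positive or negative) number `val` to one entry of `[X, Y]`. -/
structure StreamUpdate (n d : ℕ) where
  row : Fin n
  col : Fin d ⊕ Unit
  val : ℝ

/-- The matrix defined by a turnstile stream, that is, the sum of its updates. -/
def streamMatrix {n d : ℕ} (σ : List (StreamUpdate n d)) : Matrix (Fin n) (Fin d ⊕ Unit) ℝ :=
  (σ.map fun u => Matrix.single u.row u.col u.val).sum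

/-- The state of the streaming machine: an array of `r * (d + 1)` real counters that holds the
sketch, and the number of elementary steps made so far. -/
structure MachineState (r d : ℕ) where
  mem : Matrix (Fin r) (Fin d ⊕ Unit) ℝ
  steps : ℕ

/-- One elementary step: fetch a pair `(k, s)` (a bucket and a coefficient) that the random tape
assigns to the current row, and add `s * val` to the counter in row `k` and the current column. -/
def MachineState.addStep {n r d : ℕ} (u : StreamUpdate n d) (st : MachineState r d)
    (q : Fin r × ℝ) : MachineState r d where
  mem := fun k j => if k = q.1 ∧ j = u.col then st.mem k j + q.2 * u.val else st.mem k j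
  steps := st.steps + 1

/-- Processing an update: one step to read it, then one step for every pair that the random tape
assigns to its row. -/
def MachineState.process {n r d : ℕ} (tape : Fin n → List (Fin r × ℝ)) (st : MachineState r d)
    (u : StreamUpdate n d) : MachineState r d :=
  (tape u.row).foldl (MachineState.addStep u) ⟨st.mem, st.steps + 1⟩

/-- A single pass over a stream, from the all-zero array. -/
def runPass {n r d : ℕ} (tape : Fin n → List (Fin r × ℝ)) (σ : List (StreamUpdate n d)) :
    MachineState r d :=
  σ.foldl (MachineState.process tape) ⟨0, 0⟩

/-- The number of non-zero entries of a matrix. -/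
noncomputable def nnz {n d : ℕ} (A : Matrix (Fin n) (Fin d ⊕ Unit) ℝ) : ℕ :=
  Set.ncard {p : Fin n × (Fin d ⊕ Unit) | A p.1 p.2 ≠ 0}

/-- For every data matrix `A` with `d + 1` columns and every turnstile stream that defines it,
`S * A` is computed in a single pass, with at most `τ` steps per update (amortized); so in at most
`τ * nnz A` steps if the stream has one update for each non-zero entry of `A`. -/
def ComputableInOnePass {n r : ℕ} (S : Matrix (Fin r) (Fin n) ℝ) (d : ℕ) (τ : ℝ) : Prop :=
  ∃ tape : Fin n → List (Fin r × ℝ),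
    ∀ (A : Matrix (Fin n) (Fin d ⊕ Unit) ℝ) (σ : List (StreamUpdate n d)), streamMatrix σ = A →
      (runPass tape σ).mem = S * A ∧
      ((runPass tape σ).steps : ℝ) ≤ τ * (σ.length : ℝ) ∧
      (σ.length = nnz A → ((runPass tape σ).steps : ℝ) ≤ τ * (nnz A : ℝ))

/-- For every data set `X, Y` (chosen independently of the sketch) with `d` features, and every
minimizer `βs` of `‖X β - Y‖₁`, the pair `(S [X, Y], w)` is a weak weighted `(ℝ^d, α, ε)`-sketch
for `ℓ₁` regression with failure probability at most `P`. -/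
def RandomSketch.Succeeds {r n : ℕ} (D : RandomSketch r n) (d : ℕ) (α ε P : ℝ) : Prop :=
  ∀ (X : Matrix (Fin n) (Fin d) ℝ) (Y : Fin n → ℝ) (βs : Fin d → ℝ),
    IsMinOn (l1Loss (fun _ => 1) (augment X Y)) Set.univ βs →
      D.ℙ {ω | ¬ IsWeakWeightedSketch Set.univ α ε (augment X Y) (fun _ => 1) βs
        (D.S ω * augment X Y) (D.w ω)} ≤ ENNReal.ofReal P

/-! Every row of the data, possibly split into `s` equal parts, is entered twice: one copy always
goes to level `0`, the other is sampled to a level `h + 1` with probability `2 ^ -(o + h * J)` or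
dropped. On its level a copy falls into a random bucket with a random sign, and buckets are weighted
by the inverse sampling rate. The offset `o = G + 1 + a` has `a` uniform below `J`. Contraction must
be excluded for all vectors of the column space, dilation only for one fixed vector, so the two need
different arguments.

Contraction. Let the entries of a unit vector arrive in decreasing order of size. By the symmetry of
the signs no bucket shrinks in expectation, and an entry falling into an empty bucket adds its full
size. Restricted to buckets in which the entry is light (weight times size at most `γ`), the
weighted increments are bounded by `γ` and have second moment at most `2 * γ` times the size, so an
exponential moment bounds the lower tail by `exp (-a ^ 2 / (16 * γ))` (`pr_sum_abs_rows_lt_le`). A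
Chernoff bound shows that few buckets are occupied by larger entries. With `γ` of order `a ^ 2 / (d
* log n)` the tail beats the size of a net of the unit sphere, which comes from an Auerbach basis
(`exists_net`). Entries above `γ` threaten to collide on level `0`. Either the splitting removes
them, at the price of `O(d * log n)` update time, or they are controlled by leverage scores: at most
`(d + 1) / γ` indices can ever be heavy, and `2 ^ G` times more buckets isolate most of their
leverage with good probability.

Dilation. Each entry has at most one level that covers it; the covering levels contribute at most
one in expectation, with deviation `√γ`. Entries too large for a level are rarely sampled there, and
entries too small for it cancel through their signs. There remain the entries that are visible on a
level besides the covering one. As the pairs of offset and level run through distinct powers of two,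
an entry is in this position for at most `log₂ (4 * T / τ)` pairs in total, however large `J` is.
Averaging over the offset divides this by `J` (`sum_pr_lt_sketchLoss_le`), and Markov's inequality
finishes.

A larger `J` means less dilation but `2 ^ J` times more buckets: `J ≈ c * log₂ y` gives the factor
`1 + 1 / c`, and `J ≈ log₂ B / ε` gives `1 + a * ε` with failure probability near `1 / a`. The
permitted contraction is spent by scaling all weights by some `l < 1`. Data too small for the
asymptotic estimates are kept unchanged. -/

set_option linter.unusedSectionVars false

/-! ### Finite probability spaces, given by weights -/

/-- The expectation of `f` under the weights `μ`. -/
def ex {Ω : Type*} [Fintype Ω] (μ : Ω → ℝ) (f : Ω → ℝ) : ℝ := ∑ ω, μ ω * f ω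

open Classical in
/-- The probability of `A` under the weights `μ`. -/
noncomputable def pr {Ω : Type*} [Fintype Ω] (μ : Ω → ℝ) (A : Ω → Prop) : ℝ :=
  ex μ fun ω => if A ω then 1 else 0

/-- The weights `μ` form a probability distribution. -/
structure IsProb {Ω : Type*} [Fintype Ω] (μ : Ω → ℝ) : Prop where
  nonneg : ∀ ω, 0 ≤ μ ω
  sum_one : ∑ ω, μ ω = 1

/-- The product of the distributions `ν j`. -/
def piW {ι Ξ : Type*} [Fintype ι] (ν : ι → Ξ → ℝ) (ξ : ι → Ξ) : ℝ := ∏ j, ν j (ξ j)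

section Basic

variable {Ω : Type*} [Fintype Ω] {μ : Ω → ℝ}

theorem ex_add (f g : Ω → ℝ) : ex μ (fun ω => f ω + g ω) = ex μ f + ex μ g := by
  simp [ex, mul_add, Finset.sum_add_distrib]

theorem ex_sub (f g : Ω → ℝ) : ex μ (fun ω => f ω - g ω) = ex μ f - ex μ g := by
  simp [ex, mul_sub, Finset.sum_sub_distrib]

theorem ex_const_mul (c : ℝ) (f : Ω → ℝ) : ex μ (fun ω => c * f ω) = c * ex μ f := by
  simp only [ex, Finset.mul_sum]
  exact Finset.sum_congr rfl fun _ _ => by ring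

theorem ex_sum {κ : Type*} (s : Finset κ) (f : κ → Ω → ℝ) :
    ex μ (fun ω => ∑ i ∈ s, f i ω) = ∑ i ∈ s, ex μ (f i) := by
  simp only [ex, Finset.mul_sum]
  exact Finset.sum_comm

theorem IsProb.ex_const (h : IsProb μ) (c : ℝ) : ex μ (fun _ => c) = c := by
  simp [ex, ← Finset.sum_mul, h.sum_one]

theorem IsProb.ex_mono (h : IsProb μ) {f g : Ω → ℝ} (hfg : ∀ ω, f ω ≤ g ω) :
    ex μ f ≤ ex μ g :=
  Finset.sum_le_sum fun ω _ => mul_le_mul_of_nonneg_left (hfg ω) (h.nonneg ω)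

theorem IsProb.ex_nonneg (h : IsProb μ) {f : Ω → ℝ} (hf : ∀ ω, 0 ≤ f ω) : 0 ≤ ex μ f :=
  Finset.sum_nonneg fun ω _ => mul_nonneg (h.nonneg ω) (hf ω)

theorem IsProb.pr_mono (h : IsProb μ) {A B : Ω → Prop} (hAB : ∀ ω, A ω → B ω) :
    pr μ A ≤ pr μ B := by
  classical
  refine h.ex_mono fun ω => ?_
  by_cases hA : A ω
  · simp [hA, hAB ω hA]
  · simp only [hA, if_false]
    split_ifs <;> norm_num

theorem IsProb.pr_or_le (h : IsProb μ) (A B : Ω → Prop) :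
    pr μ (fun ω => A ω ∨ B ω) ≤ pr μ A + pr μ B := by
  classical
  unfold pr
  rw [← ex_add]
  refine h.ex_mono fun ω => ?_
  by_cases hA : A ω <;> by_cases hB : B ω <;> simp [hA, hB]

theorem IsProb.pr_exists_le (h : IsProb μ) {κ : Type*} (s : Finset κ) (A : κ → Ω → Prop) :
    pr μ (fun ω => ∃ i ∈ s, A i ω) ≤ ∑ i ∈ s, pr μ (A i) := by
  classical
  unfold pr
  rw [← ex_sum]
  refine h.ex_mono fun ω => ?_
  split_ifs with hA
  · obtain ⟨i, hi, hAi⟩ := hA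
    have := Finset.single_le_sum (f := fun i => if A i ω then (1 : ℝ) else 0)
      (fun j _ => by split_ifs <;> norm_num) hi
    simpa [hAi] using this
  · exact Finset.sum_nonneg fun j _ => by split_ifs <;> norm_num

/-- Markov's inequality. -/
theorem IsProb.pr_le_ex_div (h : IsProb μ) {f : Ω → ℝ} (hf : ∀ ω, 0 ≤ f ω) {t : ℝ} (ht : 0 < t)
    {A : Ω → Prop} (hA : ∀ ω, A ω → t ≤ f ω) : pr μ A ≤ ex μ f / t := by
  classical
  have : ex μ f / t = ex μ fun ω => t⁻¹ * f ω := by rw [ex_const_mul]; ring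
  rw [this]
  refine h.ex_mono fun ω => ?_
  split_ifs with hAω
  · rw [← inv_mul_cancel₀ ht.ne']
    exact mul_le_mul_of_nonneg_left (hA ω hAω) (inv_nonneg.2 ht.le)
  · exact mul_nonneg (inv_nonneg.2 ht.le) (hf ω)

/-- Cauchy–Schwarz for `√μ` and `√μ * |f|`, the former having norm one. -/
theorem IsProb.sq_ex_abs_le (h : IsProb μ) (f : Ω → ℝ) :
    (ex μ fun ω => |f ω|) ^ 2 ≤ ex μ fun ω => f ω ^ 2 := by
  have := Finset.sum_mul_sq_le_sq_mul_sq Finset.univ (fun ω => √(μ ω)) (fun ω => √(μ ω) * |f ω|)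
  have e1 : ∀ ω, √(μ ω) * (√(μ ω) * |f ω|) = μ ω * |f ω| := fun ω => by
    rw [← mul_assoc, Real.mul_self_sqrt (h.nonneg ω)]
  have e2 : ∀ ω, (√(μ ω) * |f ω|) ^ 2 = μ ω * f ω ^ 2 := fun ω => by
    rw [mul_pow, Real.sq_sqrt (h.nonneg ω), sq_abs]
  simp only [e1, e2, Real.sq_sqrt (h.nonneg _), h.sum_one, one_mul] at this
  exact this

theorem IsProb.ex_abs_le_sqrt (h : IsProb μ) (f : Ω → ℝ) :
    (ex μ fun ω => |f ω|) ≤ √(ex μ fun ω => f ω ^ 2) :=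
  Real.le_sqrt_of_sq_le (h.sq_ex_abs_le f)

end Basic

/-! ### Product distributions: resampling and independence -/

section Product

variable {ι Ξ : Type*} [Fintype ι] [DecidableEq ι] [Fintype Ξ] {ν : ι → Ξ → ℝ}

theorem ex_piW_prod (f : ι → Ξ → ℝ) :
    ex (piW ν) (fun ξ => ∏ j, f j (ξ j)) = ∏ j, ex (ν j) (f j) := by
  simp only [ex, piW, ← Finset.prod_mul_distrib]
  rw [Finset.prod_univ_sum, Fintype.piFinset_univ]

theorem piW_isProb (hν : ∀ j, IsProb (ν j)) : IsProb (piW ν) where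
  nonneg ξ := Finset.prod_nonneg fun j _ => (hν j).nonneg _
  sum_one := by
    have := ex_piW_prod (ν := ν) fun _ _ => 1
    simpa [ex, (hν _).sum_one] using this

/-- Resampling one coordinate does not change an expectation. -/
theorem ex_piW_resample (hν : ∀ j, IsProb (ν j)) (j : ι) (f : (ι → Ξ) → ℝ) :
    ex (piW ν) f = ex (piW ν) fun ξ => ex (ν j) fun x => f (Function.update ξ j x) := by
  -- Exchanging coordinate `j` with an independent copy preserves the weight `piW ν ξ * ν j x`;
  -- summing out the spare coordinate gives the claim.
  have swap : Function.Involutive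
      (fun p : (ι → Ξ) × Ξ => (Function.update p.1 j p.2, p.1 j)) := by
    rintro ⟨ξ, x⟩
    simp
  have key : ∀ (ξ : ι → Ξ) (x : Ξ),
      piW ν ξ * ν j x = piW ν (Function.update ξ j x) * ν j (ξ j) := by
    intro ξ x
    unfold piW
    rw [← Finset.mul_prod_erase _ _ (Finset.mem_univ j),
      ← Finset.mul_prod_erase Finset.univ (fun i => ν i (Function.update ξ j x i))
        (Finset.mem_univ j)]
    have : ∏ i ∈ Finset.univ.erase j, ν i (Function.update ξ j x i) =
        ∏ i ∈ Finset.univ.erase j, ν i (ξ i) :=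
      Finset.prod_congr rfl fun i hi => by
        rw [Function.update_of_ne (Finset.ne_of_mem_erase hi)]
    rw [this, Function.update_self]
    ring
  calc ex (piW ν) f = ∑ p : (ι → Ξ) × Ξ, piW ν p.1 * ν j p.2 * f p.1 := by
        rw [Fintype.sum_prod_type]
        refine Finset.sum_congr rfl fun ξ _ => ?_
        simp only [← Finset.sum_mul, ← Finset.mul_sum, (hν j).sum_one, mul_one]
    _ = ∑ p : (ι → Ξ) × Ξ, piW ν p.1 * ν j p.2 * f (Function.update p.1 j p.2) := by
        rw [← Equiv.sum_comp swap.toPerm]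
        refine Finset.sum_congr rfl fun p _ => ?_
        simp only [Function.Involutive.coe_toPerm]
        rw [key p.1 p.2]
    _ = _ := by
        rw [Fintype.sum_prod_type]
        refine Finset.sum_congr rfl fun ξ _ => ?_
        simp only [ex, Finset.mul_sum, mul_assoc]

theorem ex_piW_coord (hν : ∀ j, IsProb (ν j)) (j : ι) (f : Ξ → ℝ) :
    ex (piW ν) (fun ξ => f (ξ j)) = ex (ν j) f := by
  rw [ex_piW_resample hν j]
  simp only [Function.update_self]
  exact (piW_isProb hν).ex_const _

theorem ex_piW_coord_mul (hν : ∀ j, IsProb (ν j)) {i j : ι} (hij : i ≠ j) (f g : Ξ → ℝ) :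
    ex (piW ν) (fun ξ => f (ξ i) * g (ξ j)) = ex (ν i) f * ex (ν j) g := by
  rw [ex_piW_resample hν j]
  simp only [Function.update_self, Function.update_of_ne hij, ex_const_mul]
  simp only [mul_comm _ (ex (ν j) g), ex_const_mul, ex_piW_coord hν]

/-- Distinct coordinates are independent and the summands centred, so the cross terms vanish. -/
theorem ex_piW_sum_sq (hν : ∀ j, IsProb (ν j)) (s : Finset ι) (f : ι → Ξ → ℝ)
    (hf : ∀ j ∈ s, ex (ν j) (f j) = 0) :
    ex (piW ν) (fun ξ => (∑ j ∈ s, f j (ξ j)) ^ 2) = ∑ j ∈ s, ex (ν j) fun x => f j x ^ 2 := by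
  simp only [sq, Finset.sum_mul_sum, ex_sum]
  refine Finset.sum_congr rfl fun i hi => ?_
  rw [Finset.sum_eq_single i]
  · exact ex_piW_coord hν i fun x => f i x * f i x
  · intro j _ hji
    rw [ex_piW_coord_mul hν hji.symm, hf i hi, zero_mul]
  · intro h; exact absurd hi h

/-- A product of functions adapted to a linear order is integrated one coordinate at a time. -/
theorem ex_piW_prod_le_of_adapted [LinearOrder ι] (hν : ∀ j, IsProb (ν j))
    (F : ι → (ι → Ξ) → ℝ) (c : ι → ℝ) (hF0 : ∀ j ξ, 0 ≤ F j ξ)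
    (hF : ∀ j (ξ ξ' : ι → Ξ), (∀ i ≤ j, ξ i = ξ' i) → F j ξ = F j ξ')
    (hc : ∀ j ξ, (ex (ν j) fun x => F j (Function.update ξ j x)) ≤ c j) (s : Finset ι) :
    ex (piW ν) (fun ξ => ∏ j ∈ s, F j ξ) ≤ ∏ j ∈ s, c j := by
  have hc0 : ∀ j, 0 ≤ c j := fun j => by
    obtain ⟨ξ⟩ : Nonempty (ι → Ξ) := by
      by_contra hne
      rw [not_nonempty_iff] at hne
      simpa using (piW_isProb hν).sum_one
    exact ((hν j).ex_nonneg fun x => hF0 _ _).trans (hc j ξ)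
  -- The largest index `a` is integrated first: no other factor depends on coordinate `a`, so
  -- resampling it costs only `c a`.
  induction s using Finset.induction_on_max with
  | empty => simp [(piW_isProb hν).ex_const]
  | insert a s ha ih =>
    have has : a ∉ s := fun h => lt_irrefl _ (ha a h)
    simp only [Finset.prod_insert has]
    rw [ex_piW_resample hν a]
    calc _ ≤ ex (piW ν) (fun ξ => c a * ∏ j ∈ s, F j ξ) := by
          refine (piW_isProb hν).ex_mono fun ξ => ?_
          have : ∀ x, ∏ j ∈ s, F j (Function.update ξ a x) = ∏ j ∈ s, F j ξ := fun x =>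
            Finset.prod_congr rfl fun j hj => hF j _ _ fun i hi =>
              Function.update_of_ne (hi.trans_lt (ha j hj)).ne _ _
          simp only [this, mul_comm _ (∏ j ∈ s, F j ξ), ex_const_mul]
          exact mul_le_mul_of_nonneg_left (hc a ξ) (Finset.prod_nonneg fun j _ => hF0 _ _)
      _ ≤ _ := by
          rw [ex_const_mul]
          exact mul_le_mul_of_nonneg_left ih (hc0 a)

end Product

/-! ### Random placement of items into rows -/

section Placement

variable {R : Type*} [Fintype R] [DecidableEq R]

/-- The distribution of a row with a uniform random sign; row `k` has probability `π k`. -/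
noncomputable def plW (π : R → ℝ) : Option (R × Bool) → ℝ
  | none => 1 - ∑ k, π k
  | some p => π p.1 / 2

/-- The signed indicator of row `k`. -/
def coef (k : R) : Option (R × Bool) → ℝ
  | none => 0
  | some p => if p.1 = k then (if p.2 then 1 else -1) else 0

@[simp] theorem coef_none (k : R) : coef k none = 0 := rfl

@[simp] theorem coef_some (k k' : R) (b : Bool) :
    coef k (some (k', b)) = if k' = k then (if b then 1 else -1) else 0 := rfl

theorem ex_plW (π : R → ℝ) (f : Option (R × Bool) → ℝ) :
    ex (plW π) f = (1 - ∑ k, π k) * f none +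
      ∑ k, π k * ((f (some (k, true)) + f (some (k, false))) / 2) := by
  unfold ex
  rw [Fintype.sum_option, Fintype.sum_prod_type]
  simp only [plW, Fintype.sum_bool]
  congr 1
  exact Finset.sum_congr rfl fun k _ => by ring

theorem plW_isProb {π : R → ℝ} (h0 : ∀ k, 0 ≤ π k) (h1 : ∑ k, π k ≤ 1) : IsProb (plW π) where
  nonneg x := by
    cases x with
    | none => exact sub_nonneg.2 h1
    | some p => exact div_nonneg (h0 _) zero_le_two
  sum_one := by
    have := ex_plW π fun _ => 1
    simp only [ex, mul_one] at this
    rw [this]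
    norm_num

theorem ex_plW_coef (π : R → ℝ) (k : R) (c : ℝ) : ex (plW π) (fun x => coef k x * c) = 0 := by
  rw [ex_plW]
  have : ∀ k', π k' * ((coef k (some (k', true)) * c + coef k (some (k', false)) * c) / 2) = 0 := by
    intro k'
    simp only [coef_some]
    split_ifs <;> simp_all
  simp only [this]
  simp

theorem ex_plW_coef_sq (π : R → ℝ) (k : R) (c : ℝ) :
    ex (plW π) (fun x => (coef k x * c) ^ 2) = π k * c ^ 2 := by
  rw [ex_plW, coef_none, zero_mul, zero_pow two_ne_zero, mul_zero, zero_add,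
    Finset.sum_eq_single k]
  · simp
  · intro k' _ hk
    simp [hk]
  · simp

theorem ex_plW_abs_coef (π : R → ℝ) (k : R) : ex (plW π) (fun x => |coef k x|) = π k := by
  rw [ex_plW, coef_none, abs_zero, mul_zero, zero_add, Finset.sum_eq_single k]
  · simp
  · intro k' _ hk
    simp [hk]
  · simp

theorem sum_abs_coef_le_one (x : Option (R × Bool)) (s : Finset R) : ∑ k ∈ s, |coef k x| ≤ 1 := by
  rcases x with _ | ⟨k', b⟩
  · simp
  · have h : ∀ k, |coef k (some (k', b))| = if k' = k then (1 : ℝ) else 0 := by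
      intro k
      simp only [coef_some]
      split_ifs <;> simp
    simp only [h, Finset.sum_ite_eq]
    split_ifs <;> norm_num

end Placement

/-- `exp u ≤ 1 + u + u ^ 2` for `|u| ≤ 1`, followed by `1 + v ≤ exp v`. -/
theorem IsProb.ex_exp_neg_le {Ω : Type*} [Fintype Ω] {μ : Ω → ℝ} (h : IsProb μ) {X : Ω → ℝ}
    {θ : ℝ} (hX : ∀ ω, |θ * X ω| ≤ 1) :
    (ex μ fun ω => Real.exp (-(θ * X ω))) ≤
      Real.exp (-(θ * ex μ X) + θ ^ 2 * ex μ fun ω => X ω ^ 2) := by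
  have h1 : (ex μ fun ω => Real.exp (-(θ * X ω))) ≤
      ex μ fun ω => (1 - θ * X ω) + θ ^ 2 * X ω ^ 2 := by
    refine h.ex_mono fun ω => ?_
    have := Real.abs_exp_sub_one_sub_id_le (x := -(θ * X ω)) (by rw [abs_neg]; exact hX ω)
    have := (abs_le.1 this).2
    nlinarith
  rw [ex_add, ex_sub, h.ex_const, ex_const_mul, ex_const_mul] at h1
  refine h1.trans ?_
  have := Real.add_one_le_exp (-(θ * ex μ X) + θ ^ 2 * ex μ fun ω => X ω ^ 2)
  linarith

/-- The absolute value of a sum telescopes into increments, beyond an initial segment. -/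
theorem sum_abs_increments {ι : Type*} [LinearOrder ι] (a : ι → ℝ) (P : ι → Prop)
    [DecidablePred P] (hP : ∀ i j, i ≤ j → P i → P j) (s : Finset ι) :
    ∑ j ∈ s, (if P j then |(∑ i ∈ s with i < j, a i) + a j| - |∑ i ∈ s with i < j, a i| else 0) =
      |∑ j ∈ s, a j| - |∑ j ∈ s with ¬ P j, a j| := by
  induction s using Finset.induction_on_max with
  | empty => simp
  | insert m s hm ih =>
    have hms : m ∉ s := fun h => lt_irrefl _ (hm m h)
    have hlt : ∀ j ∈ s, (insert m s).filter (· < j) = s.filter (· < j) := fun j hj => by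
      rw [Finset.filter_insert, if_neg (not_lt.2 (hm j hj).le)]
    have hlm : (insert m s).filter (· < m) = s := by
      rw [Finset.filter_insert, if_neg (lt_irrefl m)]
      exact Finset.filter_true_of_mem hm
    have hsum : ∑ j ∈ s, (if P j then |(∑ i ∈ insert m s with i < j, a i) + a j| -
        |∑ i ∈ insert m s with i < j, a i| else 0) =
        ∑ j ∈ s, (if P j then |(∑ i ∈ s with i < j, a i) + a j| - |∑ i ∈ s with i < j, a i| else 0) :=
      Finset.sum_congr rfl fun j hj => by rw [hlt j hj]
    rw [Finset.sum_insert hms, hlm, hsum, ih, Finset.sum_insert hms]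
    by_cases hPm : P m
    · rw [if_pos hPm, Finset.filter_insert, if_neg (not_not.2 hPm), add_comm (a m)]
      ring
    -- `P` is upward closed, so its failure at the maximum `m` means that it fails on all of `s`.
    · have h1 : s.filter (fun j => ¬ P j) = s :=
        Finset.filter_true_of_mem fun j hj hPj => hPm (hP j m (hm j hj).le hPj)
      rw [if_neg hPm, Finset.filter_insert, if_pos hPm, h1, Finset.sum_insert hms]
      ring

/-! ### Lower tail of the weighted norm of the rows -/

section Contraction

variable {R : Type*} [Fintype R] [DecidableEq R] {ι : Type*} [Fintype ι] [LinearOrder ι]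

/-- The content of row `k` before item `j` arrives. -/
noncomputable def partialRow (z : ι → ℝ) (ξ : ι → Option (R × Bool)) (j : ι) (k : R) : ℝ :=
  ∑ i with i < j, coef k (ξ i) * z i

open Classical in
/-- The weighted increment of the row absolute values caused by placing item `j` at `x`, restricted
to rows in which the item is light. -/
noncomputable def increment (w : R → ℝ) (γ : ℝ) (z : ι → ℝ) (ξ : ι → Option (R × Bool)) (j : ι)
    (x : Option (R × Bool)) : ℝ :=
  ∑ k, if w k * |z j| ≤ γ then
    w k * (|partialRow z ξ j k + coef k x * z j| - |partialRow z ξ j k|) else 0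

variable {w : R → ℝ} {γ : ℝ} {z : ι → ℝ}

theorem partialRow_congr {ξ ξ' : ι → Option (R × Bool)} {j : ι} (h : ∀ i < j, ξ i = ξ' i) (k : R) :
    partialRow z ξ j k = partialRow z ξ' j k :=
  Finset.sum_congr rfl fun i hi => by rw [h i (Finset.mem_filter.1 hi).2]

theorem increment_congr {ξ ξ' : ι → Option (R × Bool)} {j : ι} (h : ∀ i < j, ξ i = ξ' i)
    (x : Option (R × Bool)) : increment w γ z ξ j x = increment w γ z ξ' j x := by
  unfold increment
  simp only [partialRow_congr h]

theorem increment_none (ξ : ι → Option (R × Bool)) (j : ι) : increment w γ z ξ j none = 0 := by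
  simp [increment]

open Classical in
theorem increment_some (ξ : ι → Option (R × Bool)) (j : ι) (k : R) (b : Bool) :
    increment w γ z ξ j (some (k, b)) = if w k * |z j| ≤ γ then
      w k * (|partialRow z ξ j k + (if b then 1 else -1) * z j| - |partialRow z ξ j k|) else 0 := by
  unfold increment
  rw [Finset.sum_eq_single k]
  · simp
  · intro k' _ hk
    simp [hk.symm]
  · simp

theorem abs_increment_some_le (hw : ∀ k, 0 ≤ w k) (ξ : ι → Option (R × Bool)) (j : ι) (k : R)
    (b : Bool) : |increment w γ z ξ j (some (k, b))| ≤ w k * |z j| := by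
  rw [increment_some]
  by_cases h : w k * |z j| ≤ γ
  · rw [if_pos h, abs_mul, abs_of_nonneg (hw k)]
    refine mul_le_mul_of_nonneg_left ?_ (hw k)
    refine (abs_abs_sub_abs_le _ _).trans ?_
    rw [add_sub_cancel_left, abs_mul]
    cases b <;> simp
  · rw [if_neg h]
    rw [abs_zero]; exact mul_nonneg (hw k) (abs_nonneg _)

theorem abs_increment_le (hw : ∀ k, 0 ≤ w k) (hγ : 0 ≤ γ) (ξ : ι → Option (R × Bool)) (j : ι)
    (x : Option (R × Bool)) : |increment w γ z ξ j x| ≤ γ := by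
  rcases x with _ | ⟨k, b⟩
  · rw [increment_none, abs_zero]; exact hγ
  · by_cases h : w k * |z j| ≤ γ
    · exact (abs_increment_some_le hw ξ j k b).trans h
    · rw [increment_some, if_neg h, abs_zero]; exact hγ

/-- In each row the light items come last in the decreasing order, so the increments telescope down
to the part formed by the heavy items. -/
theorem sum_increment (hz : ∀ i j, i ≤ j → |z j| ≤ |z i|) (hw : ∀ k, 0 ≤ w k)
    (ξ : ι → Option (R × Bool)) : ∑ j, increment w γ z ξ j (ξ j) =
      ∑ k, w k * |∑ j, coef k (ξ j) * z j| -
        ∑ k, w k * |∑ j with ¬ (w k * |z j| ≤ γ), coef k (ξ j) * z j| := by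
  classical
  unfold increment
  rw [Finset.sum_comm, ← Finset.sum_sub_distrib]
  refine Finset.sum_congr rfl fun k _ => ?_
  rw [← mul_sub, ← sum_abs_increments (fun j => coef k (ξ j) * z j) (fun j => w k * |z j| ≤ γ)
    (fun i j hij hi => (mul_le_mul_of_nonneg_left (hz i j hij) (hw k)).trans hi), Finset.mul_sum]
  refine Finset.sum_congr rfl fun j _ => ?_
  unfold partialRow
  split_ifs <;> simp

/-- Averaged over the sign, `|p + z| + |p - z| ≥ 2 * |p|`, so no row loses in expectation and the
rows outside `s` may be discarded; a row with content `p = 0` gains exactly `|z|`. -/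
theorem ex_increment_ge {π : R → ℝ} (hπ : ∀ k, 0 ≤ π k) (hw : ∀ k, 0 ≤ w k)
    (ξ : ι → Option (R × Bool)) (j : ι) (s : Finset R)
    (hs : ∀ k ∈ s, w k * |z j| ≤ γ ∧ partialRow z ξ j k = 0) :
    (∑ k ∈ s, π k * w k) * |z j| ≤ ex (plW π) (increment w γ z ξ j) := by
  classical
  rw [ex_plW, increment_none, mul_zero, zero_add, Finset.sum_mul]
  have h0 : ∀ k, 0 ≤ π k * ((increment w γ z ξ j (some (k, true)) +
      increment w γ z ξ j (some (k, false))) / 2) := by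
    intro k
    refine mul_nonneg (hπ k) (div_nonneg ?_ zero_le_two)
    simp only [increment_some]
    by_cases h : w k * |z j| ≤ γ
    · rw [if_pos h, if_pos h]
      have h1 := abs_add_le (partialRow z ξ j k + z j) (partialRow z ξ j k + -z j)
      have h2 : |partialRow z ξ j k + z j + (partialRow z ξ j k + -z j)| =
          2 * |partialRow z ξ j k| := by
        rw [show partialRow z ξ j k + z j + (partialRow z ξ j k + -z j) =
          2 * partialRow z ξ j k by ring, abs_mul, abs_two]
      rw [h2] at h1
      rw [← mul_add]
      refine mul_nonneg (hw k) ?_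
      simp only [if_true, Bool.false_eq_true, if_false, one_mul, neg_one_mul]
      linarith
    · rw [if_neg h, if_neg h, add_zero]
  refine (Finset.sum_le_sum fun k hk => ?_).trans
    (Finset.sum_le_sum_of_subset_of_nonneg (Finset.subset_univ s) fun k _ _ => h0 k)
  simp only [increment_some, if_pos (hs k hk).1, (hs k hk).2]
  simp
  nlinarith

/-- The absolute value is 1-Lipschitz, so an increment in row `k` is at most `w k * |z j|`. -/
theorem ex_increment_sq_le {π : R → ℝ} (hπ : ∀ k, 0 ≤ π k) (hw : ∀ k, 0 ≤ w k)
    (ξ : ι → Option (R × Bool)) (j : ι) {v : ℝ}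
    (hv : ∑ k with w k * |z j| ≤ γ, π k * w k * (w k * |z j|) ≤ v) :
    ex (plW π) (fun x => increment w γ z ξ j x ^ 2) ≤ v * |z j| := by
  classical
  refine le_trans ?_ (mul_le_mul_of_nonneg_right hv (abs_nonneg _))
  rw [ex_plW, increment_none, zero_pow two_ne_zero, mul_zero, zero_add, Finset.sum_mul,
    Finset.sum_filter]
  refine Finset.sum_le_sum fun k _ => ?_
  split_ifs with h
  · have h1 : ∀ b, increment w γ z ξ j (some (k, b)) ^ 2 ≤ (w k * |z j|) ^ 2 := fun b =>
      sq_le_sq' (by linarith [(abs_le.1 (abs_increment_some_le (γ := γ) (z := z) hw ξ j k b)).1])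
        (abs_le.1 (abs_increment_some_le hw ξ j k b)).2
    calc _ ≤ π k * (w k * |z j|) ^ 2 :=
          mul_le_mul_of_nonneg_left (by linarith [h1 true, h1 false]) (hπ k)
      _ = _ := by ring
  · simp [increment_some, h]

/-- The number of items before `j` that are placed into a row of `s`. -/
noncomputable def occupancy (ξ : ι → Option (R × Bool)) (s : Finset R) (j : ι) : ℝ :=
  ∑ i with i < j, ∑ k ∈ s, |coef k (ξ i)|

theorem card_partialRow_ne_zero_le (ξ : ι → Option (R × Bool)) (s : Finset R) (j : ι) :
    ((s.filter fun k => partialRow z ξ j k ≠ 0).card : ℝ) ≤ occupancy ξ s j := by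
  unfold occupancy
  rw [Finset.sum_comm, Finset.card_filter, Nat.cast_sum]
  refine Finset.sum_le_sum fun k _ => ?_
  split_ifs with h
  · obtain ⟨i, hi, hne⟩ := Finset.exists_ne_zero_of_sum_ne_zero h
    have h1 : |coef k (ξ i)| = 1 := by
      have : coef k (ξ i) ≠ 0 := left_ne_zero_of_mul hne
      rcases hx : ξ i with _ | ⟨k', b⟩
      · simp [hx] at this
      · rw [hx] at this
        simp only [coef_some] at this ⊢
        split_ifs at this ⊢ <;> simp_all
    rw [Nat.cast_one, ← h1]
    exact Finset.single_le_sum (f := fun i => |coef k (ξ i)|) (fun i _ => abs_nonneg _) hi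
  · simpa using Finset.sum_nonneg fun i _ => abs_nonneg (coef k (ξ i))

/-- Lower tail of the weighted `ℓ₁` norm of the rows; `M` is a set of items `j`, each light in a set
`C j` of rows in which it is spread evenly, as long as these rows are not occupied. -/
theorem pr_sum_abs_rows_lt_le {π : ι → R → ℝ} (hπ0 : ∀ j k, 0 ≤ π j k)
    (hπ1 : ∀ j, ∑ k, π j k ≤ 1) (hw : ∀ k, 0 ≤ w k) (hγ : 0 < γ)
    (hz : ∀ i j, i ≤ j → |z j| ≤ |z i|) (hz2 : ∑ j, |z j| ≤ 2)
    (hv : ∀ j, ∑ k with w k * |z j| ≤ γ, π j k * w k * (w k * |z j|) ≤ 2 * γ)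
    (M : Finset ι) (C : ι → Finset R) (N : ι → ℝ) (hN : ∀ j, 0 < N j)
    (hlight : ∀ j ∈ M, ∀ k ∈ C j, w k * |z j| ≤ γ)
    (hsum : ∀ j ∈ M, ∑ k ∈ C j, π j k * w k = 1)
    (hmax : ∀ j ∈ M, ∀ k ∈ C j, π j k * w k ≤ 1 / N j)
    {a b : ℝ} (ha : 0 < a) (ha8 : a ≤ 8) :
    pr (piW fun j => plW (π j)) (fun ξ => (∀ j ∈ M, occupancy ξ (C j) j ≤ b * N j) ∧
      ∑ k, w k * |∑ j, coef k (ξ j) * z j| <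
        ∑ k, w k * |∑ j with ¬ (w k * |z j| ≤ γ), coef k (ξ j) * z j| +
          (1 - b) * ∑ j ∈ M, |z j| - a) ≤ Real.exp (-(a ^ 2 / (16 * γ))) := by
  classical
  -- `θ` minimizes `4 * γ * θ ^ 2 - a * θ`, the exponent that results from `∑ |z j| ≤ 2`; the bound
  -- `a ≤ 8` ensures `θ * γ ≤ 1`.
  set θ : ℝ := a / (8 * γ) with hθ
  have hθ0 : 0 < θ := by positivity
  have hθγ : θ * γ ≤ 1 := by
    rw [hθ, div_mul_eq_mul_div, div_le_one (by positivity)]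
    nlinarith
  have hprob : ∀ j, IsProb (plW (π j)) := fun j => plW_isProb (hπ0 j) (hπ1 j)
  -- When too many rows of `C j` are occupied, the factor is replaced by a constant, so that the
  -- conditional bound `c j` holds for every history; on the event in question this never happens.
  let F : ι → (ι → Option (R × Bool)) → ℝ := fun j ξ =>
    if j ∈ M ∧ ¬ occupancy ξ (C j) j ≤ b * N j then Real.exp (-(θ * ((1 - b) * |z j|)))
    else Real.exp (-(θ * increment w γ z ξ j (ξ j)))
  let c : ι → ℝ := fun j =>
    Real.exp (-(θ * if j ∈ M then (1 - b) * |z j| else 0) + θ ^ 2 * (2 * γ * |z j|))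
  have hocc : ∀ (j : ι) (ξ ξ' : ι → Option (R × Bool)) (s : Finset R),
      (∀ i < j, ξ i = ξ' i) → occupancy ξ s j = occupancy ξ' s j := fun j ξ ξ' s h =>
    Finset.sum_congr rfl fun i hi => by rw [h i (Finset.mem_filter.1 hi).2]
  have hbound := ex_piW_prod_le_of_adapted hprob F c
    (fun j ξ => by simp only [F]; split_ifs <;> positivity)
    (fun j ξ ξ' h => by
      simp only [F]
      rw [hocc j ξ ξ' (C j) fun i hi => h i hi.le, increment_congr (fun i hi => h i hi.le),
        h j le_rfl])
    (fun j ξ => by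
      have hupd : ∀ x, ∀ i < j, Function.update ξ j x i = ξ i := fun x i hi =>
        Function.update_of_ne hi.ne _ _
      simp only [F, c, hocc j _ ξ (C j) (hupd _), increment_congr (hupd _), Function.update_self]
      have hsq := ex_increment_sq_le (hπ0 j) hw ξ j (hv j)
      by_cases hj : j ∈ M ∧ ¬ occupancy ξ (C j) j ≤ b * N j
      · simp only [if_pos hj, if_pos hj.1, (hprob j).ex_const]
        refine Real.exp_le_exp.2 ?_
        have : 0 ≤ θ ^ 2 * (2 * γ * |z j|) := by positivity
        linarith
      · simp only [if_neg hj]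
        refine ((hprob j).ex_exp_neg_le fun x => ?_).trans (Real.exp_le_exp.2 ?_)
        · rw [abs_mul, abs_of_pos hθ0]
          exact (mul_le_mul_of_nonneg_left (abs_increment_le hw hγ.le ξ j x) hθ0.le).trans hθγ
        · refine add_le_add (neg_le_neg (mul_le_mul_of_nonneg_left ?_ hθ0.le))
            (mul_le_mul_of_nonneg_left hsq (sq_nonneg θ))
          split_ifs with hjM
          · have hgood : occupancy ξ (C j) j ≤ b * N j := by
              by_contra hcon; exact hj ⟨hjM, hcon⟩
            have h1 := ex_increment_ge (z := z) (γ := γ) (hπ0 j) hw ξ j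
              ((C j).filter fun k => ¬ partialRow z ξ j k ≠ 0) (fun k hk => by
                rw [Finset.mem_filter, not_not] at hk
                exact ⟨hlight j hjM k hk.1, hk.2⟩)
            refine le_trans (mul_le_mul_of_nonneg_right ?_ (abs_nonneg _)) h1
            have h2 := Finset.sum_filter_add_sum_filter_not (C j)
              (fun k => partialRow z ξ j k ≠ 0) (fun k => π j k * w k)
            -- An occupied row carries at most `1 / N j` of the unit mass on `C j`, and at most `b *
            -- N j` rows are occupied.
            have h3 : ∑ k ∈ C j with partialRow z ξ j k ≠ 0, π j k * w k ≤ b := by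
              calc _ ≤ ∑ k ∈ C j with partialRow z ξ j k ≠ 0, 1 / N j :=
                    Finset.sum_le_sum fun k hk => hmax j hjM k (Finset.mem_filter.1 hk).1
                _ = ((C j).filter fun k => partialRow z ξ j k ≠ 0).card / N j := by
                    rw [Finset.sum_const, nsmul_eq_mul]; ring
                _ ≤ b * N j / N j := by
                    have := hN j
                    gcongr
                    exact (card_partialRow_ne_zero_le ξ (C j) j).trans hgood
                _ = b := mul_div_cancel_right₀ _ (hN j).ne'
            rw [hsum j hjM] at h2
            linarith
          · simpa using ex_increment_ge (z := z) (γ := γ) (hπ0 j) hw ξ j ∅ (by simp)) Finset.univ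
  have hprodc : ∏ j, c j = Real.exp (-(θ * ((1 - b) * ∑ j ∈ M, |z j|)) +
      θ ^ 2 * (2 * γ * ∑ j, |z j|)) := by
    simp only [c]
    rw [← Real.exp_sum, Finset.sum_add_distrib, Finset.sum_neg_distrib, ← Finset.mul_sum,
      ← Finset.mul_sum, ← Finset.mul_sum, Finset.mul_sum M, Finset.sum_ite_mem, Finset.univ_inter]
  rw [hprodc] at hbound
  refine ((piW_isProb hprob).pr_le_ex_div (t := Real.exp (-(θ * ((1 - b) * ∑ j ∈ M, |z j| - a))))
    (f := fun ξ => ∏ j, F j ξ) (fun ξ => Finset.prod_nonneg fun j _ => ?_) (Real.exp_pos _)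
    (fun ξ hξ => ?_)).trans ?_
  · simp only [F]; split_ifs <;> positivity
  · have : ∏ j, F j ξ = Real.exp (-(θ * ∑ j, increment w γ z ξ j (ξ j))) := by
      rw [Finset.mul_sum, ← Finset.sum_neg_distrib, Real.exp_sum]
      refine Finset.prod_congr rfl fun j _ => ?_
      simp only [F]
      rw [if_neg]
      exact fun h => h.2 (hξ.1 j h.1)
    rw [this, sum_increment hz hw]
    refine Real.exp_le_exp.2 (neg_le_neg (mul_le_mul_of_nonneg_left ?_ hθ0.le))
    linarith [hξ.2]
  · rw [div_le_iff₀ (Real.exp_pos _), ← Real.exp_add]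
    refine hbound.trans (Real.exp_le_exp.2 ?_)
    have h1 : θ ^ 2 * (2 * γ * ∑ j, |z j|) ≤ θ ^ 2 * (2 * γ * 2) := by gcongr
    have h2 : θ ^ 2 * (2 * γ * 2) - θ * a = -(a ^ 2 / (16 * γ)) := by
      rw [hθ]; field_simp; ring
    nlinarith

end Contraction

/-! ### Items in arbitrary order, and occupancy -/

section Unordered

variable {R : Type*} [Fintype R] [DecidableEq R] {ι : Type*} [Fintype ι] [DecidableEq ι]

open Classical in
/-- Lower tail of the weighted `ℓ₁` norm of the rows, for items in no particular order. -/
theorem pr_sum_abs_rows_lt_le_of_unordered {π : ι → R → ℝ} {w : R → ℝ} {γ : ℝ} {z : ι → ℝ}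
    (hπ0 : ∀ j k, 0 ≤ π j k)
    (hπ1 : ∀ j, ∑ k, π j k ≤ 1) (hw : ∀ k, 0 ≤ w k) (hγ : 0 < γ) (hz2 : ∑ j, |z j| ≤ 2)
    (hv : ∀ j, ∑ k with w k * |z j| ≤ γ, π j k * w k * (w k * |z j|) ≤ 2 * γ)
    (M : Finset ι) (C : ι → Finset R) (N : ι → ℝ) (hN : ∀ j, 0 < N j)
    (hlight : ∀ j ∈ M, ∀ k ∈ C j, w k * |z j| ≤ γ)
    (hsum : ∀ j ∈ M, ∑ k ∈ C j, π j k * w k = 1)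
    (hmax : ∀ j ∈ M, ∀ k ∈ C j, π j k * w k ≤ 1 / N j)
    {a b : ℝ} (ha : 0 < a) (ha8 : a ≤ 8) :
    pr (piW fun j => plW (π j)) (fun ξ =>
      (∀ j ∈ M, ∑ i with |z j| ≤ |z i|, ∑ k ∈ C j, |coef k (ξ i)| ≤ b * N j) ∧
      ∑ k, w k * |∑ j, coef k (ξ j) * z j| <
        ∑ k, w k * |∑ j with ¬ (w k * |z j| ≤ γ), coef k (ξ j) * z j| +
          (1 - b) * ∑ j ∈ M, |z j| - a) ≤ Real.exp (-(a ^ 2 / (16 * γ))) := by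
  -- Decreasing absolute value, with ties broken by an enumeration of the items.
  obtain ⟨_, hz⟩ : ∃ _ : LinearOrder ι, ∀ i j : ι, i ≤ j → |z j| ≤ |z i| := by
    have hinj : Function.Injective fun i : ι => toLex (-|z i|, Fintype.equivFin ι i) := by
      intro i j hij
      simpa using congrArg (fun p => (ofLex p).2) hij
    refine ⟨LinearOrder.lift' _ hinj, fun i j hij => ?_⟩
    have h : toLex (-|z i|, Fintype.equivFin ι i) ≤ toLex (-|z j|, Fintype.equivFin ι j) := hij
    rw [Prod.Lex.toLex_le_toLex] at h
    rcases h with h | h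
    · simp only at h; linarith
    · simp only at h; linarith [h.1]
  have key := pr_sum_abs_rows_lt_le hπ0 hπ1 hw hγ hz hz2 hv M C N hN hlight hsum hmax ha ha8 (b := b)
  refine le_trans ((piW_isProb fun j => plW_isProb (hπ0 j) (hπ1 j)).pr_mono (B := fun ξ =>
    (∀ j ∈ M, occupancy ξ (C j) j ≤ b * N j) ∧
      ∑ k, w k * |∑ j, coef k (ξ j) * z j| <
        ∑ k, w k * |∑ j with ¬ (w k * |z j| ≤ γ), coef k (ξ j) * z j| +
          (1 - b) * ∑ j ∈ M, |z j| - a) fun ξ hξ => ?_) (le_of_eq_of_le (by congr!) key)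
  refine ⟨fun j hj => le_trans ?_ (hξ.1 j hj), hξ.2⟩
  unfold occupancy
  refine Finset.sum_le_sum_of_subset_of_nonneg (fun i hi => ?_) fun i _ _ =>
    Finset.sum_nonneg fun k _ => abs_nonneg _
  simp only [Finset.mem_filter, Finset.mem_univ, true_and] at hi ⊢
  exact hz i j hi.le

/-- Chernoff bound for the number of items of `A` that are placed into a row of `s`. -/
theorem pr_lt_sum_abs_coef_le {π : ι → R → ℝ} (hπ0 : ∀ j k, 0 ≤ π j k)
    (hπ1 : ∀ j, ∑ k, π j k ≤ 1) (A : Finset ι) (s : Finset R) {m t : ℝ}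
    (hm : ∑ i ∈ A, ∑ k ∈ s, π i k ≤ m) (ht : 4 * m ≤ t) :
    pr (piW fun j => plW (π j)) (fun ξ => t < ∑ i ∈ A, ∑ k ∈ s, |coef k (ξ i)|) ≤
      Real.exp (-(2 * m)) := by
  classical
  have hprob : ∀ j, IsProb (plW (π j)) := fun j => plW_isProb (hπ0 j) (hπ1 j)
  -- Here `u = ∑ |coef k x|` lies in `[0, 1]`, so `exp u ≤ 1 + u + u ^ 2 ≤ 1 + 2 * u`. The resulting
  -- bound `exp (2 * m - t)` is at most `exp (-2 * m)` because `4 * m ≤ t`.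
  have key : ∀ i, ex (plW (π i)) (fun x => Real.exp (∑ k ∈ s, |coef k x|)) ≤
      Real.exp (2 * ∑ k ∈ s, π i k) := by
    intro i
    calc _ ≤ ex (plW (π i)) (fun x => 1 + 2 * ∑ k ∈ s, |coef k x|) := by
          refine (hprob i).ex_mono fun x => ?_
          have h0 : 0 ≤ ∑ k ∈ s, |coef k x| := Finset.sum_nonneg fun k _ => abs_nonneg _
          have h1 := sum_abs_coef_le_one x s
          have h2 := (abs_le.1 (Real.abs_exp_sub_one_sub_id_le
            (x := ∑ k ∈ s, |coef k x|) (by rw [abs_of_nonneg h0]; exact h1))).2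
          nlinarith
      _ = 1 + 2 * ∑ k ∈ s, π i k := by
          rw [ex_add, (hprob i).ex_const, ex_const_mul, ex_sum]
          simp only [ex_plW_abs_coef]
      _ ≤ _ := by
          have := Real.add_one_le_exp (2 * ∑ k ∈ s, π i k)
          linarith
  refine ((piW_isProb hprob).pr_le_ex_div (t := Real.exp t)
    (f := fun ξ => ∏ i, if i ∈ A then Real.exp (∑ k ∈ s, |coef k (ξ i)|) else 1)
    (fun ξ => Finset.prod_nonneg fun i _ => by split_ifs <;> positivity) (Real.exp_pos _)
    fun ξ hξ => ?_).trans ?_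
  · rw [Finset.prod_ite_mem, Finset.univ_inter, ← Real.exp_sum]
    exact Real.exp_le_exp.2 hξ.le
  · rw [ex_piW_prod (fun i x => if i ∈ A then Real.exp (∑ k ∈ s, |coef k x|) else 1),
      div_le_iff₀ (Real.exp_pos _), ← Real.exp_add]
    have : ∏ i, ex (plW (π i)) (fun x => if i ∈ A then Real.exp (∑ k ∈ s, |coef k x|) else 1) ≤
        ∏ i, Real.exp (if i ∈ A then 2 * ∑ k ∈ s, π i k else 0) := by
      refine Finset.prod_le_prod (fun i _ => (hprob i).ex_nonneg fun x => ?_) fun i _ => ?_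
      · split_ifs <;> positivity
      · split_ifs
        · exact key i
        · rw [(hprob i).ex_const, Real.exp_zero]
    refine this.trans ?_
    rw [← Real.exp_sum, Finset.sum_ite_mem, Finset.univ_inter, ← Finset.mul_sum]
    exact Real.exp_le_exp.2 (by linarith)

end Unordered

/-! ### Sums of powers of two -/

/-- Distinct powers of two are part of a geometric series, which is at most twice its largest term.
Sums over levels are thus bounded independently of their number. -/
theorem sum_inv_two_pow_le (E : Finset ℕ) {v : ℝ} (hv : 0 < v) (hE : ∀ e ∈ E, v ≤ 2 ^ e) :
    ∑ e ∈ E, ((2 : ℝ) ^ e)⁻¹ ≤ 2 / v := by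
  rcases E.eq_empty_or_nonempty with rfl | hne
  · simp; positivity
  set m := E.min' hne
  set M := E.max' hne
  calc ∑ e ∈ E, ((2 : ℝ) ^ e)⁻¹ ≤ ∑ e ∈ Finset.Ico m (M + 1), ((2 : ℝ) ^ e)⁻¹ :=
        Finset.sum_le_sum_of_subset_of_nonneg
          (fun e he => Finset.mem_Ico.2 ⟨E.min'_le e he, Nat.lt_succ_of_le (E.le_max' e he)⟩)
          fun _ _ _ => by positivity
    _ = ((2 : ℝ) ^ m)⁻¹ * ∑ i ∈ Finset.range (M + 1 - m), (1 / (2 : ℝ)) ^ i := by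
        rw [Finset.sum_Ico_eq_sum_range, Finset.mul_sum]
        refine Finset.sum_congr rfl fun i _ => ?_
        rw [pow_add, mul_inv, one_div, inv_pow]
    _ ≤ v⁻¹ * 2 := by
        refine mul_le_mul (inv_anti₀ hv (hE m (E.min'_mem hne))) (sum_geometric_two_le _)
          (Finset.sum_nonneg fun _ _ => by positivity) (by positivity)
    _ = 2 / v := by ring

theorem sum_two_pow_le (E : Finset ℕ) {v : ℝ} (hv : 0 ≤ v) (hE : ∀ e ∈ E, (2 : ℝ) ^ e ≤ v) :
    ∑ e ∈ E, (2 : ℝ) ^ e ≤ 2 * v := by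
  rcases E.eq_empty_or_nonempty with rfl | hne
  · simpa using hv
  set M := E.max' hne
  calc ∑ e ∈ E, (2 : ℝ) ^ e ≤ ∑ e ∈ Finset.range (M + 1), (2 : ℝ) ^ e :=
        Finset.sum_le_sum_of_subset_of_nonneg
          (fun e he => Finset.mem_range.2 (Nat.lt_succ_of_le (E.le_max' e he)))
          fun _ _ _ => by positivity
    _ = 2 ^ (M + 1) - 1 := by rw [geom_sum_eq (by norm_num)]; norm_num
    _ ≤ 2 * 2 ^ M := by rw [pow_succ]; linarith
    _ ≤ 2 * v := by linarith [hE M (E.max'_mem hne)]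

theorem card_le_logb_of_two_pow_mem (E : Finset ℕ) {a b : ℝ} (ha : 0 < a) (hab : a ≤ b)
    (hE : ∀ e ∈ E, a ≤ 2 ^ e ∧ (2 : ℝ) ^ e ≤ b) : (E.card : ℝ) ≤ Real.logb 2 (b / a) + 1 := by
  rcases E.eq_empty_or_nonempty with rfl | hne
  · have : 0 ≤ Real.logb 2 (b / a) := Real.logb_nonneg (by norm_num) ((one_le_div ha).2 hab)
    simp; linarith
  set m := E.min' hne
  set M := E.max' hne
  have hmM : m ≤ M := E.min'_le_max' hne
  have h1 : E.card ≤ M - m + 1 := by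
    have : E.card ≤ (Finset.Icc m M).card :=
      Finset.card_le_card fun e he => Finset.mem_Icc.2 ⟨E.min'_le e he, E.le_max' e he⟩
    rw [Nat.card_Icc] at this
    omega
  have h2 : ((M - m : ℕ) : ℝ) ≤ Real.logb 2 (b / a) := by
    rw [Real.le_logb_iff_rpow_le (by norm_num) (div_pos (ha.trans_le hab) ha), Real.rpow_natCast, le_div_iff₀ ha]
    calc (2 : ℝ) ^ (M - m) * a ≤ 2 ^ (M - m) * 2 ^ m := by
          gcongr; exact (hE m (E.min'_mem hne)).1
      _ = 2 ^ M := by rw [← pow_add, Nat.sub_add_cancel hmM]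
      _ ≤ b := (hE M (E.max'_mem hne)).2
  calc (E.card : ℝ) ≤ ((M - m + 1 : ℕ) : ℝ) := by exact_mod_cast h1
    _ ≤ _ := by push_cast; linarith

/-! ### Levels of subsampling -/

/-- The weight (inverse sampling rate) of a level. -/
def levelWeight (o J : ℕ) : ℕ → ℝ
  | 0 => 1
  | h + 1 => 2 ^ (o + h * J)

/-- The number of buckets in use on a level. -/
def levelSize (N o J : ℕ) : ℕ → ℕ
  | 0 => N * 2 ^ o
  | _ + 1 => N * 2 ^ J

/-- Conditional probability of a row, given its level. -/
noncomputable def spread (N o J : ℕ) {H B : ℕ} (k : Fin (H + 1) × Fin B) : ℝ :=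
  if k.2.1 < levelSize N o J k.1 then 1 / (levelSize N o J k.1 : ℝ) else 0

/-- Probability of a row for an item that is always on level `0` (`c = false`), respectively
sampled to one of the other levels (`c = true`). -/
noncomputable def rowProb (N o J : ℕ) {H B : ℕ} (c : Bool) (k : Fin (H + 1) × Fin B) : ℝ :=
  if c = decide (k.1.1 ≠ 0) then spread N o J k / levelWeight o J k.1 else 0

theorem levelWeight_pos (o J h : ℕ) : 0 < levelWeight o J h := by
  cases h <;> simp [levelWeight]

/-- Level `0` and the other levels differ in size and weight, but the product follows one formula,
which lets later estimates treat them alike. -/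
theorem levelSize_mul_levelWeight (N o J h : ℕ) :
    (levelSize N o J h : ℝ) * levelWeight o J h = N * 2 ^ (o + h * J) := by
  cases h with
  | zero => simp [levelSize, levelWeight]
  | succ h => simp only [levelSize, levelWeight]; push_cast; ring

theorem le_levelSize (N o J h : ℕ) : N ≤ levelSize N o J h := by
  cases h <;> exact Nat.le_mul_of_pos_right _ (by positivity)

theorem levelWeight_succ_mul (o J h : ℕ) (t : ℝ) :
    levelWeight o J (h + 1) * t * 2 ^ J = t * 2 ^ (o + (h + 1) * J) := by
  simp only [levelWeight]; ring

section Levels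

variable {N o J H B : ℕ}

theorem spread_nonneg (k : Fin (H + 1) × Fin B) : 0 ≤ spread N o J k := by
  unfold spread; split_ifs <;> positivity

theorem spread_le (k : Fin (H + 1) × Fin B) : spread N o J k ≤ 1 / (levelSize N o J k.1 : ℝ) := by
  unfold spread; split_ifs
  · exact le_rfl
  · positivity

theorem sum_spread (hN : 0 < N) (hB0 : N * 2 ^ o ≤ B) (hBJ : N * 2 ^ J ≤ B) (h : Fin (H + 1)) :
    ∑ q : Fin B, spread N o J (h, q) = 1 := by
  have hle : levelSize N o J h ≤ B := by
    rcases h with ⟨_ | h, hh⟩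
    · exact hB0
    · exact hBJ
  have hpos : (0 : ℝ) < levelSize N o J h := by
    exact_mod_cast hN.trans_le (le_levelSize N o J h)
  have hcard : (Finset.univ.filter fun q : Fin B => q.1 < levelSize N o J h).card =
      levelSize N o J h := by
    rw [Fin.card_filter_val_lt, min_eq_right hle]
  simp only [spread, ← Finset.sum_filter, Finset.sum_const, nsmul_eq_mul, hcard]
  exact mul_one_div_cancel hpos.ne'

theorem rowProb_nonneg (c : Bool) (k : Fin (H + 1) × Fin B) : 0 ≤ rowProb N o J c k := by
  unfold rowProb
  split_ifs
  · exact div_nonneg (spread_nonneg k) (levelWeight_pos _ _ _).le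
  · exact le_rfl

theorem rowProb_mul_weight (c : Bool) (k : Fin (H + 1) × Fin B) :
    rowProb N o J c k * levelWeight o J k.1 =
      if c = decide (k.1.1 ≠ 0) then spread N o J k else 0 := by
  unfold rowProb
  split_ifs
  · exact div_mul_cancel₀ _ (levelWeight_pos _ _ _).ne'
  · exact zero_mul _

theorem sum_rowProb_mul (hN : 0 < N) (hB0 : N * 2 ^ o ≤ B) (hBJ : N * 2 ^ J ≤ B) (c : Bool)
    (f : Fin (H + 1) → ℝ) : ∑ k : Fin (H + 1) × Fin B, rowProb N o J c k * f k.1 =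
      ∑ h : Fin (H + 1), if c = decide (h.1 ≠ 0) then (levelWeight o J h)⁻¹ * f h else 0 := by
  rw [Fintype.sum_prod_type]
  refine Finset.sum_congr rfl fun h _ => ?_
  have : ∀ q : Fin B, rowProb N o J c (h, q) * f h = spread N o J (h, q) *
      if c = decide (h.1 ≠ 0) then (levelWeight o J h)⁻¹ * f h else 0 := fun q => by
    unfold rowProb
    split_ifs
    · ring
    · ring
  simp only [this, ← Finset.sum_mul, sum_spread hN hB0 hBJ, one_mul]

theorem sum_levels_succ (f : ℕ → ℝ) :
    ∑ h : Fin (H + 1), (if true = decide (h.1 ≠ 0) then f h else 0) =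
      ∑ h ∈ Finset.range H, f (h + 1) := by
  rw [Fin.sum_univ_succ]
  simp [Finset.sum_range]

theorem sum_levels_zero (f : ℕ → ℝ) :
    ∑ h : Fin (H + 1), (if false = decide (h.1 ≠ 0) then f h else 0) = f 0 := by
  rw [Fin.sum_univ_succ]
  simp

/-- Sums over levels are sums over distinct powers of two. -/
theorem sum_range_image (hJ : 1 ≤ J) (s : Finset ℕ) (f : ℕ → ℝ) :
    ∑ h ∈ s, f (o + h * J) = ∑ e ∈ s.image fun h => o + h * J, f e := by
  rw [Finset.sum_image]
  intro a _ b _ hab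
  exact Nat.eq_of_mul_eq_mul_right hJ (Nat.add_left_cancel hab)

theorem sum_rowProb_le_one (hN : 0 < N) (ho : 1 ≤ o) (hJ : 1 ≤ J) (hB0 : N * 2 ^ o ≤ B)
    (hBJ : N * 2 ^ J ≤ B) (c : Bool) :
    ∑ k : Fin (H + 1) × Fin B, rowProb N o J c k ≤ 1 := by
  have := sum_rowProb_mul (H := H) hN hB0 hBJ c fun _ => 1
  simp only [mul_one] at this
  rw [this]
  cases c with
  | false => rw [sum_levels_zero fun h => (levelWeight o J h)⁻¹]; simp [levelWeight]
  | true =>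
    rw [sum_levels_succ fun h => (levelWeight o J h)⁻¹]
    simp only [levelWeight]
    rw [sum_range_image hJ (Finset.range H) fun e => ((2 : ℝ) ^ e)⁻¹]
    refine (sum_inv_two_pow_le _ two_pos fun e he => ?_).trans (by norm_num)
    obtain ⟨h, -, rfl⟩ := Finset.mem_image.1 he
    exact le_self_pow₀ (by norm_num) (by omega)

theorem isProb_plW_rowProb (hN : 0 < N) (ho : 1 ≤ o) (hJ : 1 ≤ J) (hB0 : N * 2 ^ o ≤ B)
    (hBJ : N * 2 ^ J ≤ B) (c : Bool) :
    IsProb (plW (rowProb N o J c : Fin (H + 1) × Fin B → ℝ)) :=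
  plW_isProb (rowProb_nonneg c) (sum_rowProb_le_one hN ho hJ hB0 hBJ c)

/-- Probability times weight sums to one on each level, so a level contributes `levelWeight * t`.
These are distinct powers of two times `t`, all at most `γ`. -/
theorem sum_light_rowProb_le (hN : 0 < N) (hJ : 1 ≤ J) (hB0 : N * 2 ^ o ≤ B)
    (hBJ : N * 2 ^ J ≤ B) (c : Bool) {γ t : ℝ} (hγ : 0 < γ) (ht : 0 ≤ t) :
    ∑ k : Fin (H + 1) × Fin B with levelWeight o J k.1 * t ≤ γ,
      rowProb N o J c k * levelWeight o J k.1 * (levelWeight o J k.1 * t) ≤ 2 * γ := by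
  classical
  rw [Finset.sum_filter]
  have e : ∀ k : Fin (H + 1) × Fin B, (if levelWeight o J k.1 * t ≤ γ then
      rowProb N o J c k * levelWeight o J k.1 * (levelWeight o J k.1 * t) else 0) =
      rowProb N o J c k * (if levelWeight o J k.1 * t ≤ γ then
        levelWeight o J k.1 * (levelWeight o J k.1 * t) else 0) := fun k => by
    split_ifs <;> ring
  simp only [e]
  rw [sum_rowProb_mul hN hB0 hBJ c fun h => if levelWeight o J h * t ≤ γ then
    levelWeight o J h * (levelWeight o J h * t) else 0]
  have e2 : ∀ h, (levelWeight o J h)⁻¹ * (if levelWeight o J h * t ≤ γ then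
      levelWeight o J h * (levelWeight o J h * t) else 0) =
      if levelWeight o J h * t ≤ γ then levelWeight o J h * t else 0 := fun h => by
    have := (levelWeight_pos o J h).ne'
    split_ifs
    · field_simp
    · ring
  simp only [e2]
  cases c with
  | false =>
    rw [sum_levels_zero fun h => if levelWeight o J h * t ≤ γ then levelWeight o J h * t else 0]
    split_ifs <;> linarith
  | true =>
    rw [sum_levels_succ fun h => if levelWeight o J h * t ≤ γ then levelWeight o J h * t else 0,
      ← Finset.sum_filter]
    simp only [levelWeight]
    rcases ht.eq_or_lt with rfl | ht
    · simp; positivity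
    rw [← Finset.sum_mul, sum_range_image hJ _ fun e => (2 : ℝ) ^ e]
    have := sum_two_pow_le (((Finset.range H).filter fun h => 2 ^ (o + h * J) * t ≤ γ).image
      fun h => o + h * J) (v := γ / t) (by positivity) (fun e he => by
        obtain ⟨h, hh, rfl⟩ := Finset.mem_image.1 he
        rw [le_div_iff₀ ht]
        exact (Finset.mem_filter.1 hh).2)
    calc _ ≤ 2 * (γ / t) * t := mul_le_mul_of_nonneg_right this ht.le
      _ = _ := by field_simp

/-- Every entry that is neither tiny nor heavy is covered by a level in which it is light. -/
theorem exists_level {γ t : ℝ} (h1 : γ ≤ t * 2 ^ (o + H * J)) (h2 : t ≤ γ) :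
    ∃ h : Fin (H + 1), γ ≤ t * 2 ^ (o + h.1 * J) ∧ levelWeight o J h * t ≤ γ := by
  classical
  -- The least such `h` works: by minimality `t * 2 ^ (o + (h - 1) * J) < γ`, and this power is the
  -- weight of level `h`. For `h = 0` the weight is one and `t ≤ γ` is used.
  have hex : ∃ h, γ ≤ t * 2 ^ (o + h * J) := ⟨H, h1⟩
  have hle : Nat.find hex ≤ H := Nat.find_le h1
  refine ⟨⟨Nat.find hex, Nat.lt_succ_of_le hle⟩, Nat.find_spec hex, ?_⟩
  change levelWeight o J (Nat.find hex) * t ≤ γ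
  rcases hfind : Nat.find hex with _ | h
  · simpa [levelWeight, hfind] using h2
  · have hmin := Nat.find_min hex (m := h) (by omega)
    simp only [levelWeight]
    linarith [not_le.1 hmin]

end Levels

/-- The value of the (unscaled) sketch: the weighted `ℓ₁` norm of its rows. -/
noncomputable def sketchLoss {I : Type*} [Fintype I] (o J : ℕ) {H B : ℕ} (x : I → ℝ)
    (ξ : I × Bool → Option ((Fin (H + 1) × Fin B) × Bool)) : ℝ :=
  ∑ k : Fin (H + 1) × Fin B, levelWeight o J k.1 * |∑ j, coef k (ξ j) * x j.1|

/-- On level `0`, the item `i` is alone in its bucket among the items of `S`. -/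
def Isolated {I : Type*} {H B : ℕ} (S : Finset I)
    (ξ : I × Bool → Option ((Fin (H + 1) × Fin B) × Bool)) (i : I) : Prop :=
  ∃ q : Fin B, coef (0, q) (ξ (i, false)) ≠ 0 ∧
    ∀ j : I × Bool, j.1 ∈ S → j ≠ (i, false) → coef (0, q) (ξ j) = 0

theorem coef_ne_zero_unique {R : Type*} [DecidableEq R] {k k' : R} {x : Option (R × Bool)}
    (h : coef k x ≠ 0) (h' : coef k' x ≠ 0) : k = k' := by
  rcases x with _ | ⟨r, b⟩
  · simp at h
  · simp only [coef_some] at h h'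
    split_ifs at h h' <;> simp_all

theorem abs_coef_eq_one {R : Type*} [DecidableEq R] {k : R} {x : Option (R × Bool)}
    (h : coef k x ≠ 0) : |coef k x| = 1 := by
  rcases x with _ | ⟨r, b⟩
  · simp at h
  · simp only [coef_some] at h ⊢
    split_ifs at h ⊢ <;> simp_all

-- Level `0` alone suffices. All entries heavy there lie in `S`, so in the bucket of an isolated
-- heavy entry the heavy part is this entry alone.
open Classical in
theorem sum_isolated_le_sum_heavy {I : Type*} [Fintype I] {o J H B : ℕ} {x : I → ℝ} {γ : ℝ}
    (ξ : I × Bool → Option ((Fin (H + 1) × Fin B) × Bool)) (S : Finset I)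
    (hS : ∀ i, γ < |x i| → i ∈ S) :
    ∑ i with γ < |x i| ∧ Isolated S ξ i, |x i| ≤
      ∑ k : Fin (H + 1) × Fin B, levelWeight o J k.1 *
        |∑ j with ¬ (levelWeight o J k.1 * |x j.1| ≤ γ), coef k (ξ j) * x j.1| := by
  rw [Fintype.sum_prod_type]
  refine le_trans ?_ (Finset.single_le_sum (fun h _ => Finset.sum_nonneg fun q _ =>
    mul_nonneg (levelWeight_pos _ _ _).le (abs_nonneg _)) (Finset.mem_univ (0 : Fin (H + 1))))
  simp only [Fin.val_zero, levelWeight, one_mul, not_le]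
  calc ∑ i with γ < |x i| ∧ Isolated S ξ i, |x i|
      ≤ ∑ i with γ < |x i| ∧ Isolated S ξ i, ∑ q : Fin B,
          |coef ((0 : Fin (H + 1)), q) (ξ (i, false))| * |x i| := by
        refine Finset.sum_le_sum fun i hi => ?_
        obtain ⟨-, -, q, hq, -⟩ := Finset.mem_filter.1 hi
        have := Finset.single_le_sum
          (f := fun q => |coef ((0 : Fin (H + 1)), q) (ξ (i, false))| * |x i|)
          (fun q _ => mul_nonneg (abs_nonneg _) (abs_nonneg _)) (Finset.mem_univ q)
        simpa [abs_coef_eq_one hq] using this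
    _ ≤ _ := by
        rw [Finset.sum_comm]
        refine Finset.sum_le_sum fun q _ => ?_
        by_cases hex : ∃ i, (γ < |x i| ∧ Isolated S ξ i) ∧
            coef ((0 : Fin (H + 1)), q) (ξ (i, false)) ≠ 0
        · obtain ⟨i, ⟨hi, q', hq', hiso⟩, hq⟩ := hex
          obtain rfl : q = q' := congrArg Prod.snd (coef_ne_zero_unique hq hq')
          rw [Finset.sum_eq_single_of_mem i (Finset.mem_filter.2
              ⟨Finset.mem_univ _, hi, q, hq', hiso⟩) fun i' hi' hne => ?_,
            Finset.sum_eq_single_of_mem (i, false) (Finset.mem_filter.2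
              ⟨Finset.mem_univ _, hi⟩) fun j hj hne => ?_, abs_mul]
          · rw [hiso j (hS _ (Finset.mem_filter.1 hj).2) hne, zero_mul]
          · rw [hiso (i', false) (hS _ (Finset.mem_filter.1 hi').2.1) (by simpa using hne),
              abs_zero, zero_mul]
        · refine le_trans (le_of_eq (Finset.sum_eq_zero fun i hi => ?_)) (abs_nonneg _)
          have : coef ((0 : Fin (H + 1)), q) (ξ (i, false)) = 0 := by
            by_contra hne
            exact hex ⟨i, (Finset.mem_filter.1 hi).2, hne⟩
          rw [this, abs_zero, zero_mul]

/-! ### Contraction for a fixed vector -/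

section LevelContraction

variable {I : Type*} [Fintype I] [DecidableEq I] {N o J H B : ℕ}

/-- The distribution of the placements of all items. -/
noncomputable def placementW (I : Type*) [Fintype I] (N o J H B : ℕ) :
    (I × Bool → Option ((Fin (H + 1) × Fin B) × Bool)) → ℝ :=
  piW fun j : I × Bool => plW (rowProb N o J j.2)

theorem placementW_isProb (hN : 0 < N) (ho : 1 ≤ o) (hJ : 1 ≤ J) (hB0 : N * 2 ^ o ≤ B)
    (hBJ : N * 2 ^ J ≤ B) : IsProb (placementW I N o J H B) :=
  piW_isProb fun j => isProb_plW_rowProb hN ho hJ hB0 hBJ j.2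

theorem card_mul_le_of_sum_abs {x : I → ℝ} (hx : ∑ i, |x i| = 1) {γ c : ℝ} (hc : 0 < c)
    (s : Finset I) (hs : ∀ i ∈ s, γ ≤ |x i| * c) : (s.card : ℝ) * γ ≤ c := by
  calc (s.card : ℝ) * γ = ∑ i ∈ s, γ := by rw [Finset.sum_const, nsmul_eq_mul]
    _ ≤ ∑ i ∈ s, |x i| * c := Finset.sum_le_sum hs
    _ ≤ ∑ i, |x i| * c := Finset.sum_le_sum_of_subset_of_nonneg (Finset.subset_univ s)
        fun i _ _ => mul_nonneg (abs_nonneg _) hc.le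
    _ = c := by rw [← Finset.sum_mul, hx, one_mul]

/-- At most `2 ^ (o + h * J) / γ` entries are that large, and each reaches level `h` with
probability `1 / levelWeight`, so the mean is at most `levelSize / (N * γ)`. The bound on `N` makes
four times this at most a fraction `a` of the buckets. -/
theorem pr_occupied_le (hN : 0 < N) (ho : 1 ≤ o) (hJ : 1 ≤ J) (hB0 : N * 2 ^ o ≤ B)
    (hBJ : N * 2 ^ J ≤ B) {x : I → ℝ} (hx : ∑ i, |x i| = 1) {γ a : ℝ} (hγ : 0 < γ) (ha : 0 < a)
    (hNγ : 4 / (γ * a) ≤ N) (h : Fin (H + 1)) (A : Finset (I × Bool))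
    (hA : ∀ j ∈ A, γ ≤ |x j.1| * 2 ^ (o + h.1 * J)) :
    pr (placementW I N o J H B) (fun ξ => a * levelSize N o J h <
      ∑ j ∈ A, ∑ k with k.1 = h, |coef k (ξ j)|) ≤ Real.exp (-(2 / γ)) := by
  classical
  have hN' : (0 : ℝ) < N := by exact_mod_cast hN
  set L : ℝ := ((levelSize N o J h : ℕ) : ℝ) with hL
  have hLN : (N : ℝ) ≤ L := by
    rw [hL]; exact_mod_cast le_levelSize N o J h.1
  have hL0 : 0 < L := hN'.trans_le hLN
  have hw := levelWeight_pos o J h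
  have hLw : L * levelWeight o J h = N * 2 ^ (o + h.1 * J) := levelSize_mul_levelWeight N o J h
  refine (pr_lt_sum_abs_coef_le (fun j => rowProb_nonneg j.2)
    (fun j => sum_rowProb_le_one hN ho hJ hB0 hBJ j.2) A (Finset.univ.filter fun k => k.1 = h)
    (m := L / (N * γ)) ?_ ?_).trans ?_
  · have hrow : ∀ j ∈ A, ∑ k : Fin (H + 1) × Fin B with k.1 = h, rowProb N o J j.2 k =
        if j.2 = decide (h.1 ≠ 0) then (levelWeight o J h)⁻¹ else 0 := by
      intro j _
      have := sum_rowProb_mul hN hB0 hBJ j.2 fun h' : Fin (H + 1) => if h' = h then (1 : ℝ) else 0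
      simp only [mul_ite, mul_one, mul_zero, ← Finset.sum_filter] at this
      rw [this]
      simp [Finset.sum_filter, Finset.sum_ite_eq', Finset.mem_filter]
    rw [Finset.sum_congr rfl hrow, ← Finset.sum_filter, Finset.sum_const, nsmul_eq_mul]
    have hcard : ((A.filter fun j => j.2 = decide (h.1 ≠ 0)).card : ℝ) * γ ≤
        2 ^ (o + h.1 * J) := by
      have hinj : Set.InjOn Prod.fst
          (A.filter fun j => j.2 = decide (h.1 ≠ 0) : Set (I × Bool)) := by
        rintro ⟨i, c⟩ hi ⟨i', c'⟩ hi' hii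
        simp only [Finset.coe_filter, Set.mem_ofPred_eq] at hi hi' hii
        rw [Prod.mk.injEq]
        exact ⟨hii, hi.2.trans hi'.2.symm⟩
      rw [← Finset.card_image_of_injOn hinj]
      refine card_mul_le_of_sum_abs hx (by positivity) _ fun i hi => ?_
      obtain ⟨j, hj, rfl⟩ := Finset.mem_image.1 hi
      exact hA j (Finset.mem_filter.1 hj).1
    rw [← div_eq_mul_inv, div_le_div_iff₀ hw (by positivity), hLw]
    nlinarith
  · have h4 : 4 / (N * γ) ≤ a := by
      rw [div_le_iff₀ (by positivity)] at hNγ ⊢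
      linarith
    calc 4 * (L / (N * γ)) = 4 / (N * γ) * L := by ring
      _ ≤ a * L := mul_le_mul_of_nonneg_right h4 hL0.le
  · refine Real.exp_le_exp.2 (neg_le_neg ?_)
    rw [← mul_div_assoc, div_le_div_iff₀ hγ (by positivity)]
    nlinarith [mul_le_mul_of_nonneg_right hLN hγ.le]

open Classical in
/-- For a fixed vector, the sketch hardly contracts, up to collisions of heavy entries. -/
theorem pr_sketchLoss_lt_le (hN : 0 < N) (ho : 1 ≤ o) (hJ : 1 ≤ J) (hB0 : N * 2 ^ o ≤ B)
    (hBJ : N * 2 ^ J ≤ B) {x : I → ℝ} (hx : ∑ i, |x i| = 1) {γ a : ℝ} (hγ : 0 < γ) (ha : 0 < a)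
    (ha1 : a ≤ 1) (hNγ : 4 / (γ * a) ≤ N) (S : Finset I) (hS : ∀ i, γ < |x i| → i ∈ S) :
    pr (placementW I N o J H B) (fun ξ => sketchLoss o J x ξ <
      1 - 2 * a - Fintype.card I * (γ / 2 ^ (H * J)) -
        ∑ i with γ < |x i| ∧ ¬ Isolated S ξ i, |x i|) ≤
      Real.exp (-(a ^ 2 / (16 * γ))) + (H + 1) * Real.exp (-(2 / γ)) := by
  -- The copies that own a level on which their entry is light but not too small; `lv` picks such a
  -- level, whose buckets form the set `C j` of the tail bound.
  set M : Finset (I × Bool) := Finset.univ.filter fun j => ∃ h : Fin (H + 1),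
    j.2 = decide (h.1 ≠ 0) ∧ γ ≤ |x j.1| * 2 ^ (o + h.1 * J) ∧
      levelWeight o J h * |x j.1| ≤ γ with hM
  have hex : ∀ j : I × Bool, ∃ h : Fin (H + 1), j ∈ M → j.2 = decide (h.1 ≠ 0) ∧
      γ ≤ |x j.1| * 2 ^ (o + h.1 * J) ∧ levelWeight o J h * |x j.1| ≤ γ := by
    intro j
    by_cases hj : j ∈ M
    · obtain ⟨h, hh⟩ := (Finset.mem_filter.1 hj).2
      exact ⟨h, fun _ => hh⟩
    · exact ⟨0, fun h => absurd h hj⟩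
  choose lv hlv using hex
  have hsize : ∀ h, (0 : ℝ) < levelSize N o J h := fun h => by
    exact_mod_cast hN.trans_le (le_levelSize N o J h)
  have hπ : IsProb (placementW I N o J H B) := placementW_isProb hN ho hJ hB0 hBJ
  have key := pr_sum_abs_rows_lt_le_of_unordered (ι := I × Bool) (z := fun j => x j.1) (a := a)
    (b := a) (w := fun k : Fin (H + 1) × Fin B => levelWeight o J k.1)
    (fun j => rowProb_nonneg j.2)
    (fun j => sum_rowProb_le_one hN ho hJ hB0 hBJ j.2) (fun k => (levelWeight_pos o J k.1).le) hγ
    (by rw [Fintype.sum_prod_type]; simp [← Finset.mul_sum, hx])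
    (fun j => sum_light_rowProb_le hN hJ hB0 hBJ j.2 hγ (abs_nonneg _))
    M (fun j => Finset.univ.filter fun k => k.1 = lv j) (fun j => levelSize N o J (lv j))
    (fun j => hsize _)
    (fun j hj k hk => by rw [(Finset.mem_filter.1 hk).2]; exact (hlv j hj).2.2)
    (fun j hj => by
      simp only [rowProb_mul_weight]
      rw [Finset.sum_filter, Fintype.sum_prod_type, Finset.sum_eq_single (lv j)]
      · simp only [if_true, if_pos (hlv j hj).1]
        exact sum_spread hN hB0 hBJ (lv j)
      · intro h _ hne
        simp [hne]
      · simp)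
    (fun j hj k hk => by
      rw [rowProb_mul_weight, ← (Finset.mem_filter.1 hk).2]
      split_ifs
      · exact spread_le k
      · positivity) ha (by linarith)
  -- Items larger than `j` also exceed the threshold of level `lv j`, so one occupancy event per
  -- level serves all items of `M`.
  have hocc := hπ.pr_exists_le (Finset.univ : Finset (Fin (H + 1))) fun h ξ =>
    a * levelSize N o J h < ∑ j : I × Bool with γ ≤ |x j.1| * 2 ^ (o + h.1 * J),
      ∑ k with k.1 = h, |coef k (ξ j)|
  have hocc2 := hocc.trans (Finset.sum_le_sum fun h _ => pr_occupied_le hN ho hJ hB0 hBJ hx hγ ha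
    hNγ h (Finset.univ.filter fun j : I × Bool => γ ≤ |x j.1| * 2 ^ (o + h.1 * J))
    fun j hj => (Finset.mem_filter.1 hj).2)
  rw [Finset.sum_const, Finset.card_univ, Fintype.card_fin, nsmul_eq_mul] at hocc2
  push_cast at hocc2
  refine le_trans (hπ.pr_mono fun ξ hξ => ?_) ((hπ.pr_or_le _ _).trans (add_le_add key hocc2))
  by_cases hgood : ∃ h ∈ (Finset.univ : Finset (Fin (H + 1))), a * levelSize N o J h <
      ∑ j : I × Bool with γ ≤ |x j.1| * 2 ^ (o + h.1 * J), ∑ k with k.1 = h, |coef k (ξ j)|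
  · exact Or.inr hgood
  refine Or.inl ⟨fun j hj => ?_, ?_⟩
  · push Not at hgood
    refine le_trans ?_ (hgood (lv j) (Finset.mem_univ _))
    refine Finset.sum_le_sum_of_subset_of_nonneg (fun i hi => ?_) fun i _ _ =>
      Finset.sum_nonneg fun k _ => abs_nonneg _
    rw [Finset.mem_filter] at hi ⊢
    exact ⟨hi.1, (hlv j hj).2.1.trans (mul_le_mul_of_nonneg_right hi.2 (by positivity))⟩
  · refine hξ.trans_le ?_
    have hheavy := sum_isolated_le_sum_heavy (o := o) (J := J) ξ S hS
    have hmid : ∑ i with |x i| ≤ γ ∧ γ ≤ |x i| * 2 ^ (o + H * J), |x i| ≤ ∑ j ∈ M, |x j.1| := by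
      have hc : ∀ i : I, ∃ c : Bool, (|x i| ≤ γ ∧ γ ≤ |x i| * 2 ^ (o + H * J)) → (i, c) ∈ M := by
        intro i
        by_cases hi : |x i| ≤ γ ∧ γ ≤ |x i| * 2 ^ (o + H * J)
        · obtain ⟨h, h1, h2⟩ := exists_level (H := H) hi.2 hi.1
          exact ⟨decide (h.1 ≠ 0), fun _ => Finset.mem_filter.2 ⟨Finset.mem_univ _, h, rfl, h1, h2⟩⟩
        · exact ⟨true, fun h => absurd h hi⟩
      choose c hc using hc
      rw [← Finset.sum_image (s := Finset.univ.filter fun i =>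
        |x i| ≤ γ ∧ γ ≤ |x i| * 2 ^ (o + H * J)) (g := fun i => (i, c i))
        (f := fun j : I × Bool => |x j.1|) (fun i _ i' _ h => congrArg Prod.fst h)]
      refine Finset.sum_le_sum_of_subset_of_nonneg (fun j hj => ?_) fun _ _ _ => abs_nonneg _
      obtain ⟨i, hi, rfl⟩ := Finset.mem_image.1 hj
      exact hc i (Finset.mem_filter.1 hi).2
    have htiny : ∑ i with |x i| ≤ γ ∧ ¬ γ ≤ |x i| * 2 ^ (o + H * J), |x i| ≤
        Fintype.card I * (γ / 2 ^ (H * J)) := by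
      calc _ ≤ ∑ i with |x i| ≤ γ ∧ ¬ γ ≤ |x i| * 2 ^ (o + H * J), γ / 2 ^ (H * J) := by
            refine Finset.sum_le_sum fun i hi => ?_
            have h1 := (not_le.1 (Finset.mem_filter.1 hi).2.2).le
            rw [le_div_iff₀ (by positivity)]
            refine le_trans ?_ h1
            gcongr
            · norm_num
            · omega
        _ ≤ ∑ i : I, γ / 2 ^ (H * J) := Finset.sum_le_sum_of_subset_of_nonneg
            (Finset.subset_univ _) fun _ _ _ => by positivity
        _ = _ := by rw [Finset.sum_const, nsmul_eq_mul, Finset.card_univ]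
    have hsplit : ∑ i, |x i| = ∑ i with γ < |x i| ∧ Isolated S ξ i, |x i| +
        ∑ i with γ < |x i| ∧ ¬ Isolated S ξ i, |x i| +
        (∑ i with |x i| ≤ γ ∧ γ ≤ |x i| * 2 ^ (o + H * J), |x i| +
        ∑ i with |x i| ≤ γ ∧ ¬ γ ≤ |x i| * 2 ^ (o + H * J), |x i|) := by
      simp only [Finset.sum_filter, ← Finset.sum_add_distrib]
      refine Finset.sum_congr rfl fun i _ => ?_
      by_cases h1 : γ < |x i|
      · have h1' : ¬ |x i| ≤ γ := not_le.2 h1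
        by_cases h2 : Isolated S ξ i <;> simp [h1, h1', h2]
      · have h1' : |x i| ≤ γ := not_lt.1 h1
        by_cases h2 : γ ≤ |x i| * 2 ^ (o + H * J) <;> simp [h1, h1', h2]
    -- Since the middle entries have total at most one, the factor `1 - a` for occupied rows costs
    -- at most `a`; the tail bound costs the other `a`.
    have hmid1 : ∑ i with |x i| ≤ γ ∧ γ ≤ |x i| * 2 ^ (o + H * J), |x i| ≤ 1 := by
      rw [← hx]
      exact Finset.sum_le_sum_of_subset_of_nonneg (Finset.subset_univ _) fun _ _ _ => abs_nonneg _
    have h1a : (1 - a) * ∑ i with |x i| ≤ γ ∧ γ ≤ |x i| * 2 ^ (o + H * J), |x i| ≤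
        (1 - a) * ∑ j ∈ M, |x j.1| := mul_le_mul_of_nonneg_left hmid (by linarith)
    rw [hx] at hsplit
    nlinarith

/-- Probability that an item of `S` is not isolated among the items of `S`. -/
theorem pr_not_isolated_le (hN : 0 < N) (ho : 1 ≤ o) (hJ : 1 ≤ J) (hB0 : N * 2 ^ o ≤ B)
    (hBJ : N * 2 ^ J ≤ B) (S : Finset I) (i : I) :
    pr (placementW I N o J H B) (fun ξ => ¬ Isolated S ξ i) ≤ S.card / (N * 2 ^ o) := by
  classical
  have hprob : ∀ j : I × Bool, IsProb (plW (rowProb N o J j.2 : Fin (H + 1) × Fin B → ℝ)) :=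
    fun j => isProb_plW_rowProb hN ho hJ hB0 hBJ j.2
  have hπ : IsProb (placementW I N o J H B) := placementW_isProb hN ho hJ hB0 hBJ
  set T : Finset (I × Bool) := (S ×ˢ Finset.univ).erase (i, false)
  -- The copy on level `0` is always placed, so the first bracket has expectation zero; once placed,
  -- a copy that is not isolated shows up as a pair in one bucket.
  have hpoint : ∀ ξ : I × Bool → Option ((Fin (H + 1) × Fin B) × Bool),
      (if ¬ Isolated S ξ i then (1 : ℝ) else 0) ≤
      (1 - ∑ q : Fin B, |coef ((0 : Fin (H + 1)), q) (ξ (i, false))|) +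
        ∑ j ∈ T, ∑ q : Fin B, |coef ((0 : Fin (H + 1)), q) (ξ (i, false))| *
          |coef ((0 : Fin (H + 1)), q) (ξ j)| := by
    intro ξ
    have hle : ∑ q : Fin B, |coef ((0 : Fin (H + 1)), q) (ξ (i, false))| ≤ 1 := by
      have := sum_abs_coef_le_one (ξ (i, false))
        ((Finset.univ : Finset (Fin B)).image fun q => ((0 : Fin (H + 1)), q))
      rwa [Finset.sum_image (fun a _ b _ h => congrArg Prod.snd h)] at this
    have hnn : ∀ j ∈ T, 0 ≤ ∑ q : Fin B, |coef ((0 : Fin (H + 1)), q) (ξ (i, false))| *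
          |coef ((0 : Fin (H + 1)), q) (ξ j)| := fun j _ =>
      Finset.sum_nonneg fun q _ => mul_nonneg (abs_nonneg _) (abs_nonneg _)
    by_cases hiso : Isolated S ξ i
    · rw [if_neg (not_not.2 hiso)]
      exact add_nonneg (by linarith) (Finset.sum_nonneg hnn)
    · rw [if_pos hiso]
      by_cases hq : ∃ q : Fin B, coef ((0 : Fin (H + 1)), q) (ξ (i, false)) ≠ 0
      · obtain ⟨q, hq⟩ := hq
        have : ∃ j ∈ T, coef ((0 : Fin (H + 1)), q) (ξ j) ≠ 0 := by
          by_contra hcon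
          push Not at hcon
          exact hiso ⟨q, hq, fun j hjS hj => hcon j (Finset.mem_erase.2
            ⟨hj, Finset.mem_product.2 ⟨hjS, Finset.mem_univ _⟩⟩)⟩
        obtain ⟨j, hjT, hj⟩ := this
        have h1 := Finset.single_le_sum hnn hjT
        have h2 := Finset.single_le_sum (f := fun q =>
          |coef ((0 : Fin (H + 1)), q) (ξ (i, false))| * |coef ((0 : Fin (H + 1)), q) (ξ j)|)
          (fun q _ => mul_nonneg (abs_nonneg _) (abs_nonneg _)) (Finset.mem_univ q)
        simp only [abs_coef_eq_one hq, abs_coef_eq_one hj, mul_one] at h2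
        linarith
      · push Not at hq
        simp [hq]
  refine (hπ.ex_mono (g := fun ξ => _) fun ξ => le_trans (le_of_eq (by congr)) (hpoint ξ)).trans ?_
  rw [ex_add, ex_sub, hπ.ex_const, ex_sum, ex_sum]
  have h1 : ∀ q : Fin B, ex (placementW I N o J H B)
      (fun ξ => |coef ((0 : Fin (H + 1)), q) (ξ (i, false))|) = spread N o J ((0 : Fin (H + 1)), q) := by
    intro q
    unfold placementW
    rw [ex_piW_coord hprob (i, false) fun x => |coef ((0 : Fin (H + 1)), q) x|, ex_plW_abs_coef]
    simp [rowProb, levelWeight]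
  have h2 : ∀ j ∈ T, ex (placementW I N o J H B) (fun ξ => ∑ q : Fin B,
      |coef ((0 : Fin (H + 1)), q) (ξ (i, false))| * |coef ((0 : Fin (H + 1)), q) (ξ j)|) ≤
      if j.2 = false then 1 / ((N : ℝ) * 2 ^ o) else 0 := by
    intro j hj
    rw [ex_sum]
    have h3 : ∀ q : Fin B, ex (placementW I N o J H B) (fun ξ =>
        |coef ((0 : Fin (H + 1)), q) (ξ (i, false))| * |coef ((0 : Fin (H + 1)), q) (ξ j)|) =
        spread N o J ((0 : Fin (H + 1)), q) *
          if j.2 = false then spread N o J ((0 : Fin (H + 1)), q) else 0 := by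
      intro q
      unfold placementW
      rw [ex_piW_coord_mul hprob (Finset.ne_of_mem_erase hj).symm
        (fun x => |coef ((0 : Fin (H + 1)), q) x|) (fun x => |coef ((0 : Fin (H + 1)), q) x|),
        ex_plW_abs_coef, ex_plW_abs_coef]
      simp [rowProb, levelWeight]
    simp only [h3]
    split_ifs
    · calc _ ≤ ∑ q : Fin B, spread N o J ((0 : Fin (H + 1)), q) * (1 / ((N : ℝ) * 2 ^ o)) := by
            refine Finset.sum_le_sum fun q _ => mul_le_mul_of_nonneg_left ?_ (spread_nonneg _)
            have := spread_le (N := N) (o := o) (J := J) ((0 : Fin (H + 1)), q)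
            simpa [levelSize] using this
        _ = _ := by rw [← Finset.sum_mul, sum_spread hN hB0 hBJ, one_mul]
    · simp
  simp only [h1, sum_spread hN hB0 hBJ, sub_self, zero_add]
  refine (Finset.sum_le_sum h2).trans ?_
  have hT : ∑ j ∈ T, (if j.2 = false then 1 / ((N : ℝ) * 2 ^ o) else 0) ≤
      ∑ j ∈ S ×ˢ (Finset.univ : Finset Bool), (if j.2 = false then 1 / ((N : ℝ) * 2 ^ o) else 0) :=
    Finset.sum_le_sum_of_subset_of_nonneg (Finset.erase_subset _ _) fun j _ _ => by
      split_ifs <;> positivity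
  refine hT.trans (le_of_eq ?_)
  rw [Finset.sum_product]
  simp
  ring

end LevelContraction

/-! ### Dilation for a fixed vector and a fixed offset -/

section Dilation

variable {I : Type*} [Fintype I] [DecidableEq I] {N o J H B : ℕ}

/-- Level `h` is the one that represents an entry of absolute value `t`. -/
def Covers (o J : ℕ) (γ : ℝ) (h : ℕ) (t : ℝ) : Prop :=
  γ ≤ t * 2 ^ (o + h * J) ∧ (h ≠ 0 → t * 2 ^ (o + h * J) < γ * 2 ^ J)

-- Once `t` reaches the lower end `γ` on one level, it is at or beyond the upper end `γ * 2 ^ J` on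
-- all later ones, since the scale grows by `2 ^ J` per level.
open Classical in
theorem sum_covers_le_one {γ t : ℝ} (ht : 0 ≤ t) (s : Finset ℕ) :
    ∑ h ∈ s, (if Covers o J γ h t then (1 : ℝ) else 0) ≤ 1 := by
  rw [Finset.sum_boole]
  have hlt : ∀ h h', h < h' → Covers o J γ h t → Covers o J γ h' t → False := by
    rintro h h' hh ⟨h1, -⟩ ⟨-, h2⟩
    have h3 := h2 (by omega)
    have h4 : o + h * J + J ≤ o + h' * J := by nlinarith
    have h5 : t * 2 ^ (o + h * J) * 2 ^ J ≤ t * 2 ^ (o + h' * J) := by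
      rw [mul_assoc, ← pow_add]
      exact mul_le_mul_of_nonneg_left (pow_le_pow_right₀ (by norm_num) h4) ht
    have h6 : γ * 2 ^ J ≤ t * 2 ^ (o + h * J) * 2 ^ J := by gcongr
    linarith
  have : (s.filter fun h => Covers o J γ h t).card ≤ 1 := by
    refine Finset.card_le_one.2 fun a ha b hb => ?_
    rw [Finset.mem_filter] at ha hb
    rcases lt_trichotomy a b with h | h | h
    · exact (hlt a b h ha.2 hb.2).elim
    · exact h
    · exact (hlt b a h hb.2 ha.2).elim
  exact_mod_cast this

/-- The weight of level `h + 1` is `2 ^ J` times smaller than the scale in `Covers`, so the upper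
end of the window amounts to lightness. -/
theorem Covers.weight_mul_le {γ t : ℝ} {h : ℕ} (hc : Covers o J γ (h + 1) t) :
    levelWeight o J (h + 1) * t ≤ γ := by
  have h1 := hc.2 (by omega)
  rw [← levelWeight_succ_mul] at h1
  exact (lt_of_mul_lt_mul_right h1 (by positivity)).le

theorem ex_sq_sub_le {Ω : Type*} [Fintype Ω] {μ : Ω → ℝ} (h : IsProb μ) (f : Ω → ℝ) :
    ex μ (fun ω => (f ω - ex μ f) ^ 2) ≤ ex μ fun ω => f ω ^ 2 := by
  have : ∀ ω, (f ω - ex μ f) ^ 2 = (f ω ^ 2 - 2 * ex μ f * f ω) + ex μ f ^ 2 := fun ω => by ring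
  simp only [this]
  rw [ex_add, ex_sub, ex_const_mul, h.ex_const]
  nlinarith [sq_nonneg (ex μ f)]

-- An entry of size `t` is on a level of weight `w` with probability `1 / w`; only `w > T / t`
-- matters, and these reciprocals of powers of two sum to at most `2 * t / T`. Level `0` is harmless
-- because no entry exceeds one.
open Classical in
theorem pr_big_le (hN : 0 < N) (ho : 1 ≤ o) (hJ : 1 ≤ J) (hB0 : N * 2 ^ o ≤ B)
    (hBJ : N * 2 ^ J ≤ B) {x : I → ℝ} (hx : ∑ i, |x i| = 1) {T : ℝ} (hT : 1 ≤ T) :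
    pr (placementW I N o J H B) (fun ξ => ∃ j : I × Bool, ∃ k,
      T < levelWeight o J k.1 * |x j.1| ∧ coef k (ξ j) ≠ 0) ≤ 2 / T := by
  have hprob : ∀ j : I × Bool, IsProb (plW (rowProb N o J j.2 : Fin (H + 1) × Fin B → ℝ)) :=
    fun j => isProb_plW_rowProb hN ho hJ hB0 hBJ j.2
  have hπ : IsProb (placementW I N o J H B) := placementW_isProb hN ho hJ hB0 hBJ
  have h1 := hπ.pr_le_ex_div (t := 1) (f := fun ξ => ∑ j : I × Bool, ∑ k,
      if T < levelWeight o J k.1 * |x j.1| then |coef k (ξ j)| else 0)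
    (fun ξ => Finset.sum_nonneg fun j _ => Finset.sum_nonneg fun k _ => by
      split_ifs <;> positivity) one_pos
    (A := fun ξ => ∃ j : I × Bool, ∃ k, T < levelWeight o J k.1 * |x j.1| ∧ coef k (ξ j) ≠ 0)
    (by
      rintro ξ ⟨j, k, hk, hne⟩
      have h2 := Finset.single_le_sum (f := fun k =>
        if T < levelWeight o J k.1 * |x j.1| then |coef k (ξ j)| else 0)
        (fun k _ => by split_ifs <;> positivity) (Finset.mem_univ k)
      have h3 := Finset.single_le_sum (f := fun j : I × Bool => ∑ k,
        if T < levelWeight o J k.1 * |x j.1| then |coef k (ξ j)| else 0)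
        (fun j _ => Finset.sum_nonneg fun k _ => by split_ifs <;> positivity) (Finset.mem_univ j)
      simp only [if_pos hk, abs_coef_eq_one hne] at h2
      exact h2.trans h3)
  refine h1.trans ?_
  rw [div_one, ex_sum]
  have hj : ∀ j : I × Bool, ex (placementW I N o J H B) (fun ξ => ∑ k,
      if T < levelWeight o J k.1 * |x j.1| then |coef k (ξ j)| else 0) =
      ∑ h : Fin (H + 1), if j.2 = decide (h.1 ≠ 0) then (levelWeight o J h)⁻¹ *
        (if T < levelWeight o J h * |x j.1| then 1 else 0) else 0 := by
    intro j
    unfold placementW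
    rw [ex_piW_coord hprob j fun y => ∑ k, if T < levelWeight o J k.1 * |x j.1| then
      |coef k y| else 0, ex_sum, ← sum_rowProb_mul hN hB0 hBJ]
    refine Finset.sum_congr rfl fun k _ => ?_
    split_ifs
    · rw [ex_plW_abs_coef, mul_one]
    · rw [(hprob j).ex_const, mul_zero]
  simp only [hj]
  rw [Fintype.sum_prod_type]
  simp only [Fintype.sum_bool]
  calc _ ≤ ∑ i, 2 / T * |x i| := by
        refine Finset.sum_le_sum fun i _ => ?_
        have hi1 : |x i| ≤ 1 := by
          rw [← hx]
          exact Finset.single_le_sum (f := fun i => |x i|) (fun i _ => abs_nonneg _)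
            (Finset.mem_univ i)
        rw [sum_levels_succ fun h => (levelWeight o J h)⁻¹ *
            (if T < levelWeight o J h * |x i| then 1 else 0),
          sum_levels_zero fun h => (levelWeight o J h)⁻¹ *
            (if T < levelWeight o J h * |x i| then 1 else 0)]
        have h0 : ¬ T < levelWeight o J 0 * |x i| := by simp only [levelWeight]; linarith
        rw [if_neg h0, mul_zero, add_zero]
        have e : ∀ h, (levelWeight o J (h + 1))⁻¹ *
            (if T < levelWeight o J (h + 1) * |x i| then 1 else 0) =
            if T < 2 ^ (o + h * J) * |x i| then ((2 : ℝ) ^ (o + h * J))⁻¹ else 0 := fun h => by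
          by_cases hc : T < 2 ^ (o + h * J) * |x i|
          · rw [if_pos (show T < levelWeight o J (h + 1) * |x i| from hc), if_pos hc, mul_one]
            rfl
          · rw [if_neg (show ¬ T < levelWeight o J (h + 1) * |x i| from hc), if_neg hc, mul_zero]
        simp only [e, ← Finset.sum_filter]
        rcases (abs_nonneg (x i)).eq_or_lt with h | h
        · rw [← h]; simp [(zero_le_one.trans hT).not_gt]
        rw [sum_range_image hJ _ fun e => ((2 : ℝ) ^ e)⁻¹]
        refine (sum_inv_two_pow_le _ (v := T / |x i|) (by positivity) fun e he => ?_).trans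
          (le_of_eq (by field_simp))
        obtain ⟨h', hh, rfl⟩ := Finset.mem_image.1 he
        rw [div_le_iff₀ h]
        exact (Finset.mem_filter.1 hh).2.le
    _ = 2 / T := by rw [← Finset.mul_sum, hx, mul_one]

open Classical in
/-- Expected contribution of the levels that represent an entry in addition to the covering one. -/
noncomputable def excessMass (o J H : ℕ) (γ T τ : ℝ) (x : I → ℝ) : ℝ :=
  ∑ i, |x i| * ∑ h ∈ Finset.range (H + 1), if τ ≤ |x i| * 2 ^ (o + h * J) ∧
    ¬ Covers o J γ h |x i| ∧ levelWeight o J h * |x i| ≤ T then 1 else 0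

open Classical in
/-- Bound for the expected contribution of the entries that are small on a level. -/
noncomputable def smallMass (N o J H : ℕ) (τ : ℝ) (x : I → ℝ) : ℝ :=
  ∑ h ∈ Finset.range (H + 1),
    √(N * 2 ^ (o + h * J) * ∑ i with |x i| * 2 ^ (o + h * J) < τ, x i ^ 2)

/-- With `n` buckets of weight `w` the sum is `n * w * √(V / (n * w)) = √(n * w * V)`; it arises
when each bucket is bounded by its second moment. -/
theorem sum_sqrt_spread (hN : 0 < N) (hB0 : N * 2 ^ o ≤ B) (hBJ : N * 2 ^ J ≤ B)
    (h : Fin (H + 1)) {V : ℝ} (hV : 0 ≤ V) :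
    ∑ q : Fin B, levelWeight o J h * √(spread N o J (h, q) / levelWeight o J h * V) =
      √(N * 2 ^ (o + h.1 * J) * V) := by
  have hw := levelWeight_pos o J h
  have hn : (0 : ℝ) < levelSize N o J h := by exact_mod_cast hN.trans_le (le_levelSize N o J h)
  have key : ∀ q : Fin B, levelWeight o J h * √(spread N o J (h, q) / levelWeight o J h * V) =
      spread N o J (h, q) * √(N * 2 ^ (o + h.1 * J) * V) := by
    intro q
    rw [← levelSize_mul_levelWeight N o J h]
    unfold spread
    split_ifs
    · set n : ℝ := ((levelSize N o J h : ℕ) : ℝ)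
      have e : 1 / n / levelWeight o J h * V = (n * levelWeight o J h * V) /
          (n * levelWeight o J h) ^ 2 := by field_simp
      simp only [e]
      rw [Real.sqrt_div (by positivity), Real.sqrt_sq (by positivity)]
      field_simp
    · simp
  simp only [key, ← Finset.sum_mul, sum_spread hN hB0 hBJ, one_mul]

-- The entries of each bucket are split by their size relative to the level: small ones, whose signs
-- cancel; covered ones, of expected total at most one; too large ones, absent except with
-- probability `2 / T`; and the rest, bounded in expectation. Markov's inequality is applied once,
-- to the sum of the three errors.
open Classical in
theorem pr_lt_sketchLoss_le (hN : 0 < N) (ho : 1 ≤ o) (hJ : 1 ≤ J) (hB0 : N * 2 ^ o ≤ B)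
    (hBJ : N * 2 ^ J ≤ B) {x : I → ℝ} (hx : ∑ i, |x i| = 1) {γ T τ s : ℝ} (hγ : 0 < γ)
    (hT : 1 ≤ T) (hs : 0 < s) :
    pr (placementW I N o J H B) (fun ξ => 1 + s < sketchLoss o J x ξ) ≤
      2 / T + (√γ + excessMass o J H γ T τ x + smallMass N o J H τ x) / s := by
  have hprob : ∀ j : I × Bool, IsProb (plW (rowProb N o J j.2 : Fin (H + 1) × Fin B → ℝ)) :=
    fun j => isProb_plW_rowProb hN ho hJ hB0 hBJ j.2
  have hπ : IsProb (placementW I N o J H B) := placementW_isProb hN ho hJ hB0 hBJ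
  let small : I × Bool → Fin (H + 1) × Fin B → Prop := fun j k =>
    |x j.1| * 2 ^ (o + k.1.1 * J) < τ
  let cov : I × Bool → Fin (H + 1) × Fin B → Prop := fun j k =>
    j.2 = decide (k.1.1 ≠ 0) ∧ Covers o J γ k.1 |x j.1|
  let act : I × Bool → Fin (H + 1) × Fin B → Prop := fun j k =>
    ¬ small j k ∧ ¬ cov j k ∧ levelWeight o J k.1 * |x j.1| ≤ T
  let f : I × Bool → Option ((Fin (H + 1) × Fin B) × Bool) → ℝ := fun j y =>
    ∑ k, if cov j k then levelWeight o J k.1 * |x j.1| * |coef k y| else 0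
  let g : I → ℝ := fun i => ex (plW (rowProb N o J true)) (f (i, true))
  -- Only the sampled copies fluctuate; the covered contribution on level `0` has a deterministic
  -- bound.
  let A : (I × Bool → Option ((Fin (H + 1) × Fin B) × Bool)) → ℝ := fun ξ =>
    ∑ i, (f (i, true) (ξ (i, true)) - g i)
  let Bact : (I × Bool → Option ((Fin (H + 1) × Fin B) × Bool)) → ℝ := fun ξ =>
    ∑ j, ∑ k, if act j k then levelWeight o J k.1 * |x j.1| * |coef k (ξ j)| else 0
  let Sm : (I × Bool → Option ((Fin (H + 1) × Fin B) × Bool)) → ℝ := fun ξ =>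
    ∑ k, levelWeight o J k.1 * |∑ j with small j k, coef k (ξ j) * x j.1|
  have hf0 : ∀ j y, 0 ≤ f j y := fun j y => Finset.sum_nonneg fun k _ => by
    have := (levelWeight_pos o J k.1).le
    split_ifs <;> positivity
  have hBact0 : ∀ ξ, 0 ≤ Bact ξ := fun ξ => Finset.sum_nonneg fun j _ =>
    Finset.sum_nonneg fun k _ => by
      have := (levelWeight_pos o J k.1).le
      split_ifs <;> positivity
  have hSm0 : ∀ ξ, 0 ≤ Sm ξ := fun ξ => Finset.sum_nonneg fun k _ =>
    mul_nonneg (levelWeight_pos o J k.1).le (abs_nonneg _)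
  -- the covering levels
  have hg : ∀ i, g i = ∑ h ∈ Finset.range H, if Covers o J γ (h + 1) |x i| then |x i| else 0 := by
    intro i
    simp only [g, f]
    rw [ex_sum]
    have e : ∀ k : Fin (H + 1) × Fin B, ex (plW (rowProb N o J true))
        (fun y => if cov (i, true) k then levelWeight o J k.1 * |x i| * |coef k y| else 0) =
        rowProb N o J true k * (if Covers o J γ k.1 |x i| then
          levelWeight o J k.1 * |x i| else 0) := by
      intro k
      by_cases hcls : true = decide (k.1.1 ≠ 0)
      · by_cases hcov : Covers o J γ k.1 |x i|
        · simp only [cov, hcls, hcov, and_self, if_true]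
          rw [ex_const_mul, ← hcls, ex_plW_abs_coef, mul_comm]
        · simp only [cov, hcov, and_false, if_false]
          rw [(hprob (i, true)).ex_const, mul_zero]
      · simp only [cov, hcls, false_and, if_false]
        rw [(hprob (i, true)).ex_const, rowProb, if_neg hcls, zero_mul]
    rw [Finset.sum_congr rfl fun k _ => e k, sum_rowProb_mul hN hB0 hBJ true fun h =>
      if Covers o J γ h |x i| then levelWeight o J h * |x i| else 0,
      sum_levels_succ fun h => (levelWeight o J h)⁻¹ *
        (if Covers o J γ h |x i| then levelWeight o J h * |x i| else 0)]
    refine Finset.sum_congr rfl fun h _ => ?_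
    split_ifs
    · exact inv_mul_cancel_left₀ (levelWeight_pos _ _ _).ne' _
    · exact mul_zero _
  have hfalse : ∀ i y, f (i, false) y ≤ if Covers o J γ 0 |x i| then |x i| else 0 := by
    intro i y
    simp only [f]
    have e : ∀ k : Fin (H + 1) × Fin B, (if cov (i, false) k then
        levelWeight o J k.1 * |x i| * |coef k y| else 0) ≤
        (if Covers o J γ 0 |x i| then |x i| else 0) * |coef k y| := by
      intro k
      by_cases hk : k.1.1 = 0
      · by_cases hcov : Covers o J γ 0 |x i|
        · simp only [cov, hk, hcov, levelWeight]
          simp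
        · simp [cov, hk, hcov]
      · simp only [cov, hk, ne_eq, not_false_eq_true, decide_true, Bool.false_eq_true, false_and,
          if_false]
        refine mul_nonneg ?_ (abs_nonneg _)
        split_ifs <;> positivity
    refine (Finset.sum_le_sum fun k _ => e k).trans ?_
    rw [← Finset.mul_sum]
    refine mul_le_of_le_one_right ?_ (sum_abs_coef_le_one y _)
    split_ifs <;> positivity
  have hcovsum : ∀ i, (if Covers o J γ 0 |x i| then |x i| else 0) + g i ≤ |x i| := by
    intro i
    have := mul_le_mul_of_nonneg_left (sum_covers_le_one (o := o) (J := J) (γ := γ)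
      (abs_nonneg (x i)) (Finset.range (H + 1))) (abs_nonneg (x i))
    rw [Finset.sum_range_succ', mul_add, Finset.mul_sum, mul_one] at this
    simp only [mul_ite, mul_one, mul_zero] at this
    rw [hg]
    linarith
  -- A sampled copy is light on its covering level, so `f ≤ γ` and its second moment is at most `γ *
  -- g i ≤ γ * |x i|`; by independence these add up to at most `γ`.
  have hA : ex (placementW I N o J H B) (fun ξ => |A ξ|) ≤ √γ := by
    refine (hπ.ex_abs_le_sqrt A).trans (Real.sqrt_le_sqrt ?_)
    have hsq := ex_piW_sum_sq hprob ((Finset.univ : Finset I).image fun i => (i, true))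
      (fun j y => f j y - ex (plW (rowProb N o J j.2)) (f j)) (fun j _ => by
        rw [ex_sub, (hprob j).ex_const, sub_self])
    have himg : ∀ φ : I × Bool → ℝ, ∑ j ∈ (Finset.univ : Finset I).image (fun i => (i, true)), φ j =
        ∑ i, φ (i, true) := fun φ =>
      Finset.sum_image fun a _ b _ h => congrArg Prod.fst h
    simp only [himg] at hsq
    change ex (piW fun j : I × Bool => plW (rowProb N o J j.2))
      (fun ξ => (∑ i, (f (i, true) (ξ (i, true)) - g i)) ^ 2) ≤ γ
    rw [hsq]
    calc _ ≤ ∑ i, γ * |x i| := by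
          refine Finset.sum_le_sum fun i _ => ?_
          refine (ex_sq_sub_le (hprob (i, true)) _).trans ?_
          have hfγ : ∀ y, f (i, true) y ≤ γ := by
            intro y
            calc f (i, true) y ≤ ∑ k, γ * |coef k y| := by
                  refine Finset.sum_le_sum fun k _ => ?_
                  by_cases hc : cov (i, true) k
                  · rw [if_pos hc]
                    refine mul_le_mul_of_nonneg_right ?_ (abs_nonneg _)
                    obtain ⟨h, hh⟩ : ∃ h, k.1.1 = h + 1 := Nat.exists_eq_succ_of_ne_zero (by
                      simpa using hc.1)
                    have h2 := hc.2
                    rw [hh] at h2 ⊢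
                    exact h2.weight_mul_le
                  · rw [if_neg hc]
                    exact mul_nonneg hγ.le (abs_nonneg _)
              _ ≤ γ := by
                  rw [← Finset.mul_sum]
                  exact mul_le_of_le_one_right hγ.le (sum_abs_coef_le_one y _)
          calc _ ≤ ex (plW (rowProb N o J true)) (fun y => γ * f (i, true) y) := by
                refine (hprob (i, true)).ex_mono fun y => ?_
                rw [sq]
                exact mul_le_mul_of_nonneg_right (hfγ y) (hf0 _ _)
            _ = γ * g i := ex_const_mul _ _
            _ ≤ γ * |x i| := by
                refine mul_le_mul_of_nonneg_left ?_ hγ.le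
                have := hcovsum i
                have h0 : (0 : ℝ) ≤ if Covers o J γ 0 |x i| then |x i| else 0 := by
                  split_ifs <;> positivity
                linarith
      _ = γ := by rw [← Finset.mul_sum, hx, mul_one]
  have hBact : ex (placementW I N o J H B) Bact ≤ excessMass o J H γ T τ x := by
    simp only [Bact]
    rw [ex_sum]
    have e : ∀ j : I × Bool, ex (placementW I N o J H B) (fun ξ => ∑ k,
        if act j k then levelWeight o J k.1 * |x j.1| * |coef k (ξ j)| else 0) ≤
        ∑ h : Fin (H + 1), if j.2 = decide (h.1 ≠ 0) then
          (if τ ≤ |x j.1| * 2 ^ (o + h.1 * J) ∧ ¬ Covers o J γ h |x j.1| ∧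
            levelWeight o J h * |x j.1| ≤ T then |x j.1| else 0) else 0 := by
      intro j
      unfold placementW
      rw [ex_piW_coord hprob j fun y => ∑ k, if act j k then
        levelWeight o J k.1 * |x j.1| * |coef k y| else 0, ex_sum]
      have e2 := sum_rowProb_mul (H := H) hN hB0 hBJ j.2 fun h =>
        if τ ≤ |x j.1| * 2 ^ (o + h.1 * J) ∧ ¬ Covers o J γ h |x j.1| ∧
            levelWeight o J h * |x j.1| ≤ T then levelWeight o J h * |x j.1| else 0
      refine le_trans (Finset.sum_le_sum fun k _ => ?_) (e2.le.trans (le_of_eq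
        (Finset.sum_congr rfl fun h _ => ?_)))
      · by_cases hcls : j.2 = decide (k.1.1 ≠ 0)
        · have hiff : act j k ↔ (τ ≤ |x j.1| * 2 ^ (o + k.1.1 * J) ∧ ¬ Covers o J γ k.1 |x j.1| ∧
              levelWeight o J k.1 * |x j.1| ≤ T) := by
            simp only [act, small, cov, hcls, true_and, not_lt]
          by_cases hact : act j k
          · rw [if_pos (hiff.1 hact)]
            simp only [if_pos hact]
            rw [ex_const_mul, ex_plW_abs_coef, mul_comm]
          · rw [if_neg (fun h => hact (hiff.2 h))]
            simp only [if_neg hact]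
            rw [(hprob j).ex_const, mul_zero]
        · have h0 : rowProb N o J j.2 k = 0 := if_neg hcls
          rw [h0, zero_mul]
          split_ifs
          · rw [ex_const_mul, ex_plW_abs_coef, h0, mul_zero]
          · rw [(hprob j).ex_const]
      · congr 1
        split_ifs
        · exact inv_mul_cancel_left₀ (levelWeight_pos _ _ _).ne' _
        · exact mul_zero _
    refine (Finset.sum_le_sum fun j _ => e j).trans (le_of_eq ?_)
    unfold excessMass
    rw [Fintype.sum_prod_type]
    refine Finset.sum_congr rfl fun i _ => ?_
    rw [Fintype.sum_bool, ← Finset.sum_add_distrib, Finset.mul_sum, Finset.sum_range]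
    refine Finset.sum_congr rfl fun h _ => ?_
    by_cases hh : h.1 = 0 <;> simp [hh]
  have hSm : ex (placementW I N o J H B) Sm ≤ smallMass N o J H τ x := by
    simp only [Sm]
    rw [ex_sum]
    calc _ ≤ ∑ k : Fin (H + 1) × Fin B, levelWeight o J k.1 * √(spread N o J k / levelWeight o J k.1 *
          ∑ i with |x i| * 2 ^ (o + k.1.1 * J) < τ, x i ^ 2) := by
          refine Finset.sum_le_sum fun k _ => ?_
          rw [ex_const_mul]
          refine mul_le_mul_of_nonneg_left ?_ (levelWeight_pos _ _ _).le
          refine (hπ.ex_abs_le_sqrt _).trans (Real.sqrt_le_sqrt ?_)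
          unfold placementW
          rw [ex_piW_sum_sq hprob _ (fun j y => coef k y * x j.1) fun j _ => ex_plW_coef _ _ _]
          simp only [ex_plW_coef_sq]
          rw [Finset.sum_filter, Fintype.sum_prod_type, Finset.sum_filter, Finset.mul_sum]
          refine Finset.sum_le_sum fun i _ => ?_
          rw [Fintype.sum_bool]
          simp only [small]
          by_cases hh : k.1.1 = 0 <;> by_cases hsm : |x i| * 2 ^ (o + k.1.1 * J) < τ <;>
            simp [rowProb, hh, hsm] at hsm ⊢
      _ = smallMass N o J H τ x := by
          unfold smallMass
          rw [Fintype.sum_prod_type, Finset.sum_range]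
          refine Finset.sum_congr rfl fun h _ => ?_
          exact sum_sqrt_spread hN hB0 hBJ h
            (V := ∑ i with |x i| * 2 ^ (o + h.1 * J) < τ, x i ^ 2)
            (Finset.sum_nonneg fun i _ => sq_nonneg _)
  have hmain : pr (placementW I N o J H B) (fun ξ => s < |A ξ| + Bact ξ + Sm ξ) ≤
      (√γ + excessMass o J H γ T τ x + smallMass N o J H τ x) / s := by
    refine (hπ.pr_le_ex_div (f := fun ξ => |A ξ| + Bact ξ + Sm ξ) (fun ξ =>
      add_nonneg (add_nonneg (abs_nonneg _) (hBact0 ξ)) (hSm0 ξ)) hs fun ξ h => h.le).trans ?_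
    rw [ex_add, ex_add]
    gcongr
  refine le_trans (hπ.pr_mono fun ξ hξ => ?_) ((hπ.pr_or_le _ _).trans
    (add_le_add (pr_big_le hN ho hJ hB0 hBJ hx hT) hmain))
  by_cases hbig : ∃ j : I × Bool, ∃ k, T < levelWeight o J k.1 * |x j.1| ∧ coef k (ξ j) ≠ 0
  · exact Or.inl hbig
  right
  push Not at hbig
  have hZ : sketchLoss o J x ξ ≤ Sm ξ + (∑ j, f j (ξ j) + Bact ξ) := by
    unfold sketchLoss
    simp only [Sm, f, Bact]
    rw [← Finset.sum_add_distrib]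
    simp only [← Finset.sum_add_distrib]
    rw [Finset.sum_comm (s := (Finset.univ : Finset (I × Bool))), ← Finset.sum_add_distrib]
    refine Finset.sum_le_sum fun k _ => ?_
    rw [← Finset.sum_filter_add_sum_filter_not Finset.univ (fun j => small j k)
      (fun j => coef k (ξ j) * x j.1)]
    have hw := (levelWeight_pos o J k.1).le
    have h1 : levelWeight o J k.1 * |∑ j with ¬ small j k, coef k (ξ j) * x j.1| ≤
        ∑ j, ((if cov j k then levelWeight o J k.1 * |x j.1| * |coef k (ξ j)| else 0) +
          if act j k then levelWeight o J k.1 * |x j.1| * |coef k (ξ j)| else 0) := by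
      refine (mul_le_mul_of_nonneg_left (Finset.abs_sum_le_sum_abs _ _) hw).trans ?_
      rw [Finset.mul_sum, Finset.sum_filter]
      refine Finset.sum_le_sum fun j _ => ?_
      have h2 : levelWeight o J k.1 * |coef k (ξ j) * x j.1| =
          levelWeight o J k.1 * |x j.1| * |coef k (ξ j)| := by rw [abs_mul]; ring
      have h3 : 0 ≤ levelWeight o J k.1 * |x j.1| * |coef k (ξ j)| := by positivity
      rw [h2]
      by_cases hsm : small j k
      · rw [if_neg (not_not.2 hsm)]
        split_ifs <;> linarith
      · rw [if_pos hsm]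
        by_cases hc : cov j k
        · rw [if_pos hc]
          split_ifs <;> linarith
        · by_cases hT' : levelWeight o J k.1 * |x j.1| ≤ T
          · rw [if_neg hc, if_pos (show act j k from ⟨hsm, hc, hT'⟩), zero_add]
          · rw [hbig j k (not_le.1 hT'), abs_zero, mul_zero]
            simp
    calc _ ≤ levelWeight o J k.1 * (|∑ j with small j k, coef k (ξ j) * x j.1| +
          |∑ j with ¬ small j k, coef k (ξ j) * x j.1|) :=
          mul_le_mul_of_nonneg_left (abs_add_le _ _) hw
      _ ≤ _ := by rw [mul_add]; linarith
  have hfsum : ∑ j, f j (ξ j) ≤ 1 + A ξ := by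
    rw [Fintype.sum_prod_type]
    simp only [Fintype.sum_bool, A, Finset.sum_sub_distrib, Finset.sum_add_distrib]
    have h1 : ∑ i, f (i, false) (ξ (i, false)) + ∑ i, g i ≤ 1 := by
      rw [← Finset.sum_add_distrib, ← hx]
      exact Finset.sum_le_sum fun i _ => (add_le_add_left (hfalse i _) _).trans (hcovsum i)
    linarith
  have := le_abs_self (A ξ)
  linarith

end Dilation

/-! ### Averaging the dilation over the offset -/

section Offset

variable {I : Type*} [Fintype I] [DecidableEq I] {N J G H : ℕ}

/-- Division with remainder by `J`: the exponent `G + 1 + a + h * J` with `a < J` determines `a` and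
`h`. Summing over all offsets therefore meets each scale at most once. -/
theorem injOn_level_index (G : ℕ) (s : Finset ℕ) :
    Set.InjOn (fun p : ℕ × ℕ => G + 1 + p.1 + p.2 * J) (Finset.range J ×ˢ s : Finset (ℕ × ℕ)) := by
  rintro ⟨a, h⟩ hp ⟨a', h'⟩ hp' heq
  simp only [Finset.coe_product, Set.mem_prod, Finset.mem_coe, Finset.mem_range] at hp hp'
  have heq' : a + h * J = a' + h' * J := by
    have : G + 1 + a + h * J = G + 1 + a' + h' * J := heq
    omega
  have h1 : a = a' := by
    have := congrArg (· % J) heq'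
    simpa [Nat.mod_eq_of_lt hp.1, Nat.mod_eq_of_lt hp'.1] using this
  subst h1
  have hJ : 0 < J := (Nat.zero_le a).trans_lt hp.1
  rw [Prod.mk.injEq]
  exact ⟨rfl, Nat.eq_of_mul_eq_mul_right hJ (Nat.add_left_cancel heq')⟩

open Classical in
theorem card_level_index_le {a b t : ℝ} (ha : 0 < a) (hab : a ≤ b) (ht : 0 < t) (s : Finset ℕ) :
    (((Finset.range J ×ˢ s).filter fun p : ℕ × ℕ =>
      a ≤ t * 2 ^ (G + 1 + p.1 + p.2 * J) ∧ t * 2 ^ (G + 1 + p.1 + p.2 * J) ≤ b).card : ℝ) ≤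
      Real.logb 2 (b / a) + 1 := by
  rw [← Finset.card_image_of_injOn ((injOn_level_index (J := J) G s).mono fun p hp =>
    (Finset.mem_filter.1 hp).1)]
  have := card_le_logb_of_two_pow_mem (((Finset.range J ×ˢ s).filter fun p : ℕ × ℕ =>
      a ≤ t * 2 ^ (G + 1 + p.1 + p.2 * J) ∧ t * 2 ^ (G + 1 + p.1 + p.2 * J) ≤ b).image
      fun p => G + 1 + p.1 + p.2 * J) (a := a / t) (b := b / t) (by positivity) (by gcongr)
    (fun e he => by
      obtain ⟨p, hp, rfl⟩ := Finset.mem_image.1 he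
      rw [div_le_iff₀' ht, le_div_iff₀' ht]
      exact (Finset.mem_filter.1 hp).2)
  rwa [div_div_div_cancel_right₀ ht.ne'] at this

/-- Averaged over the offset, few levels represent an entry in addition to the covering one. -/
theorem sum_excessMass_le {x : I → ℝ} (hx : ∑ i, |x i| = 1) {γ T τ : ℝ} (hτ : 0 < τ)
    (hτγ : τ ≤ γ) (hγT : γ ≤ T) :
    ∑ a ∈ Finset.range J, excessMass (G + 1 + a) J H γ T τ x ≤ Real.logb 2 (4 * T / τ) := by
  classical
  unfold excessMass
  rw [Finset.sum_comm]
  have hγ : 0 < γ := hτ.trans_le hτγ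
  have hT : 0 < T := hγ.trans_le hγT
  -- Two windows of scales, one below the covering range, `[τ, γ]`, and one above it, `[γ * 2 ^ J, T
  -- * 2 ^ J]`; neither logarithmic length depends on `J`.
  have hlog : Real.logb 2 (4 * T / τ) = (Real.logb 2 (γ / τ) + 1) +
      (Real.logb 2 (T * 2 ^ J / (γ * 2 ^ J)) + 1) := by
    rw [mul_div_mul_right _ _ (by positivity : (2 : ℝ) ^ J ≠ 0),
      show 4 * T / τ = (γ / τ) * (T / γ) * (2 * 2) by field_simp; norm_num,
      Real.logb_mul (by positivity) (by norm_num), Real.logb_mul (by positivity) (by positivity),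
      Real.logb_mul (by norm_num) (by norm_num), Real.logb_self_eq_one (by norm_num)]
    ring
  calc _ ≤ ∑ i, |x i| * Real.logb 2 (4 * T / τ) := by
        refine Finset.sum_le_sum fun i _ => ?_
        rw [← Finset.mul_sum]
        rcases (abs_nonneg (x i)).eq_or_lt with h | ht
        · rw [← h]; simp
        refine mul_le_mul_of_nonneg_left ?_ ht.le
        rw [← Finset.sum_product', hlog]
        refine le_trans ?_ (add_le_add
          (card_level_index_le (J := J) (G := G) hτ hτγ ht (Finset.range (H + 1)))
          (card_level_index_le (J := J) (G := G) (by positivity : 0 < γ * 2 ^ J)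
            (by gcongr : γ * 2 ^ J ≤ T * 2 ^ J) ht (Finset.range (H + 1))))
        rw [Finset.card_filter, Finset.card_filter, Nat.cast_sum, Nat.cast_sum,
          ← Finset.sum_add_distrib]
        refine Finset.sum_le_sum fun p _ => ?_
        rcases p with ⟨a, h⟩
        simp only
        set E : ℝ := |x i| * 2 ^ (G + 1 + a + h * J) with hE
        by_cases hact : τ ≤ E ∧ ¬ Covers (G + 1 + a) J γ h |x i| ∧
            levelWeight (G + 1 + a) J h * |x i| ≤ T
        · rw [if_pos hact]
          obtain ⟨h1, h2, h3⟩ := hact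
          by_cases hlow : E ≤ γ
          · rw [if_pos ⟨h1, hlow⟩]
            split_ifs <;> simp
          · have h4 : h ≠ 0 ∧ γ * 2 ^ J ≤ E := by
              by_contra hcon
              refine h2 ⟨(not_le.1 hlow).le, fun hh => ?_⟩
              by_contra hcon'
              exact hcon ⟨hh, not_lt.1 hcon'⟩
            obtain ⟨h', rfl⟩ := Nat.exists_eq_succ_of_ne_zero h4.1
            have h5 : E ≤ T * 2 ^ J := by
              have h6 := levelWeight_succ_mul (G + 1 + a) J h' |x i|
              rw [hE, Nat.succ_eq_add_one, ← h6]
              gcongr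
            rw [if_pos (show γ * 2 ^ J ≤ E ∧ E ≤ T * 2 ^ J from ⟨h4.2, h5⟩)]
            split_ifs <;> simp
        · rw [if_neg hact]
          positivity
    _ = _ := by rw [← Finset.sum_mul, hx, one_mul]

/-- Cauchy–Schwarz over the pairs of offset and level moves the root outside. Each entry then meets
distinct powers of two below `τ / |x i|`, so `x i ^ 2` turns into at most `2 * τ * |x i|`. -/
theorem sum_smallMass_le {x : I → ℝ} (hx : ∑ i, |x i| = 1) {τ : ℝ} (hτ : 0 < τ) :
    ∑ a ∈ Finset.range J, smallMass N (G + 1 + a) J H τ x ≤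
      √(J * (H + 1) * (N * (2 * τ))) := by
  classical
  unfold smallMass
  rw [← Finset.sum_product']
  set P := Finset.range J ×ˢ Finset.range (H + 1) with hP
  have hcard : ((P.card : ℕ) : ℝ) = J * (H + 1) := by
    rw [hP, Finset.card_product, Finset.card_range, Finset.card_range]
    push_cast; ring
  set V : ℕ × ℕ → ℝ := fun p => N * 2 ^ (G + 1 + p.1 + p.2 * J) *
    ∑ i with |x i| * 2 ^ (G + 1 + p.1 + p.2 * J) < τ, x i ^ 2 with hV
  have hV0 : ∀ p, 0 ≤ V p := fun p =>
    mul_nonneg (by positivity) (Finset.sum_nonneg fun i _ => sq_nonneg _)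
  have hcs := Finset.sum_mul_sq_le_sq_mul_sq P (fun _ => (1 : ℝ)) fun p => √(V p)
  simp only [one_mul, one_pow, Finset.sum_const, nsmul_eq_mul, mul_one, Real.sq_sqrt (hV0 _),
    hcard] at hcs
  refine Real.le_sqrt_of_sq_le (hcs.trans (mul_le_mul_of_nonneg_left ?_ (by positivity)))
  calc ∑ p ∈ P, V p = N * ∑ i, x i ^ 2 * ∑ p ∈ P with
        |x i| * 2 ^ (G + 1 + p.1 + p.2 * J) < τ, (2 : ℝ) ^ (G + 1 + p.1 + p.2 * J) := by
        simp only [hV, Finset.sum_filter, Finset.mul_sum]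
        rw [Finset.sum_comm]
        refine Finset.sum_congr rfl fun i _ => Finset.sum_congr rfl fun p _ => ?_
        split_ifs
        · ring
        · ring
    _ ≤ N * ∑ i, |x i| * (2 * τ) := by
        refine mul_le_mul_of_nonneg_left (Finset.sum_le_sum fun i _ => ?_) (by positivity)
        rcases (abs_nonneg (x i)).eq_or_lt with h | ht
        · rw [← h, abs_eq_zero.1 h.symm]; simp
        rw [← sq_abs, sq, mul_assoc]
        refine mul_le_mul_of_nonneg_left ?_ ht.le
        rw [← Finset.sum_image (f := fun e => (2 : ℝ) ^ e)
          ((injOn_level_index (J := J) G (Finset.range (H + 1))).mono fun p hp =>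
            (Finset.mem_filter.1 hp).1)]
        have := sum_two_pow_le ((P.filter fun p => |x i| * 2 ^ (G + 1 + p.1 + p.2 * J) < τ).image
          fun p => G + 1 + p.1 + p.2 * J) (v := τ / |x i|) (by positivity) (fun e he => by
            obtain ⟨p, hp, rfl⟩ := Finset.mem_image.1 he
            rw [le_div_iff₀' ht]
            exact (Finset.mem_filter.1 hp).2.le)
        calc _ ≤ |x i| * (2 * (τ / |x i|)) := mul_le_mul_of_nonneg_left this ht.le
          _ = _ := by field_simp
    _ = N * (2 * τ) := by rw [← Finset.sum_mul, hx, one_mul]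

/-- The sketch of a fixed vector is hardly longer than the vector, averaged over the offset. -/
theorem sum_pr_lt_sketchLoss_le {B : ℕ} (hN : 0 < N) (hJ : 1 ≤ J) (hB : N * 2 ^ (G + J) ≤ B)
    {x : I → ℝ} (hx : ∑ i, |x i| = 1) {γ T s : ℝ} (hγ : 0 < γ) (hγJ : γ * J ^ 2 ≤ 1)
    (hNγ : 1 / (2 * γ) ≤ N) (hT : 1 ≤ T) (hs : 0 < s) :
    ∑ a ∈ Finset.range J, pr (placementW I N (G + 1 + a) J H B)
        (fun ξ => 1 + s < sketchLoss (G + 1 + a) J x ξ) ≤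
      J * (2 / T) + Real.logb 2 (32 * T * (N * ((H + 1) * J))) / s := by
  have hN' : (0 : ℝ) < N := by exact_mod_cast hN
  have hJ' : (1 : ℝ) ≤ J := by exact_mod_cast hJ
  -- This `τ` makes the bound of `sum_smallMass_le` equal to one.
  set τ : ℝ := 1 / (2 * N * ((H + 1) * J)) with hτ
  have hτ0 : 0 < τ := by positivity
  have hτγ : τ ≤ γ := by
    rw [div_le_iff₀ (by positivity)] at hNγ
    rw [hτ, div_le_iff₀ (by positivity)]
    have h1 : (1 : ℝ) ≤ (H + 1) * J := by
      have : (1 : ℝ) ≤ H + 1 := by linarith [(Nat.cast_nonneg H : (0 : ℝ) ≤ H)]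
      nlinarith
    have h2 : 0 ≤ γ * (2 * N) := by positivity
    nlinarith
  have hγ1 : γ ≤ 1 := by
    have : (1 : ℝ) ≤ (J : ℝ) ^ 2 := one_le_pow₀ hJ'
    nlinarith
  have hsqrt : J * √γ ≤ 1 := by
    have : √(γ * J ^ 2) ≤ 1 := Real.sqrt_le_one.2 hγJ
    rwa [Real.sqrt_mul hγ.le, Real.sqrt_sq (by positivity), mul_comm] at this
  have hpow : ∀ a ∈ Finset.range J, N * 2 ^ (G + 1 + a) ≤ B := fun a ha =>
    le_trans (Nat.mul_le_mul_left N (Nat.pow_le_pow_right two_pos (by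
      have := Finset.mem_range.1 ha; omega))) hB
  have hBJ : N * 2 ^ J ≤ B :=
    le_trans (Nat.mul_le_mul_left N (Nat.pow_le_pow_right two_pos (by omega))) hB
  have h1 := sum_excessMass_le (J := J) (G := G) (H := H) hx hτ0 hτγ (hγ1.trans hT)
  have h2 := sum_smallMass_le (N := N) (J := J) (G := G) (H := H) hx hτ0
  have h3 : √((J : ℝ) * (H + 1) * (N * (2 * τ))) = 1 := by
    rw [Real.sqrt_eq_one, hτ]
    field_simp
  rw [h3] at h2
  -- The additional `2` pays for `J * √γ ≤ 1` and for the small entries.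
  have h4 : Real.logb 2 (32 * T * (N * ((H + 1) * J))) = Real.logb 2 (4 * T / τ) + 2 := by
    rw [show 32 * T * (N * (((H : ℝ) + 1) * J)) = 4 * T / τ * (2 * 2) by rw [hτ]; field_simp; norm_num,
      Real.logb_mul (by positivity) (by norm_num),
      Real.logb_mul (by norm_num) (by norm_num), Real.logb_self_eq_one (by norm_num)]
    ring
  calc _ ≤ ∑ a ∈ Finset.range J, (2 / T + (√γ + excessMass (G + 1 + a) J H γ T τ x +
        smallMass N (G + 1 + a) J H τ x) / s) :=
        Finset.sum_le_sum fun a ha => pr_lt_sketchLoss_le hN (by omega) hJ (hpow a ha) hBJ hx hγ hT hs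
    _ = J * (2 / T) + (J * √γ + ∑ a ∈ Finset.range J, excessMass (G + 1 + a) J H γ T τ x +
        ∑ a ∈ Finset.range J, smallMass N (G + 1 + a) J H τ x) / s := by
        rw [Finset.sum_add_distrib, Finset.sum_const, ← Finset.sum_div, Finset.sum_add_distrib,
          Finset.sum_add_distrib, Finset.sum_const, Finset.card_range, nsmul_eq_mul, nsmul_eq_mul]
    _ ≤ _ := by
        rw [h4]
        exact add_le_add le_rfl (div_le_div_of_nonneg_right (by linarith) hs.le)

end Offset

/-! ### Auerbach bases, leverage scores and nets -/

section Auerbach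

variable {ι : Type*} [Fintype ι]

theorem abs_le_sum_abs (z : ι → ℝ) (i : ι) : |z i| ≤ ∑ i, |z i| :=
  Finset.single_le_sum (f := fun i => |z i|) (fun _ _ => abs_nonneg _) (Finset.mem_univ i)

theorem isCompact_sum_abs_le_one (V : Submodule ℝ (ι → ℝ)) :
    IsCompact {z : V | ∑ i, |(z : ι → ℝ) i| ≤ 1} := by
  refine Metric.isCompact_of_isClosed_isBounded (isClosed_le
    (continuous_finsetSum _ fun i _ => continuous_abs.comp
      ((continuous_apply i).comp continuous_subtype_val)) continuous_const) ?_
  refine (Metric.isBounded_closedBall (x := (0 : V)) (r := 1)).subset fun z hz => ?_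
  rw [mem_closedBall_zero_iff, ← Submodule.norm_coe, pi_norm_le_iff_of_nonneg zero_le_one]
  exact fun i => (abs_le_sum_abs (z : ι → ℝ) i).trans hz

/-- An Auerbach basis for the `ℓ₁` norm. -/
theorem exists_auerbach_basis (V : Submodule ℝ (ι → ℝ)) :
    ∃ b : Module.Basis (Fin (Module.finrank ℝ V)) ℝ V,
      (∀ j, ∑ i, |(b j : ι → ℝ) i| ≤ 1) ∧
        ∀ (z : V) (j), |b.repr z j| ≤ ∑ i, |(z : ι → ℝ) i| := by
  set b₀ := Module.finBasis ℝ V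
  set K : Set V := {z : V | ∑ i, |(z : ι → ℝ) i| ≤ 1} with hK
  have hKc : IsCompact (Set.univ.pi fun _ : Fin (Module.finrank ℝ V) => K) :=
    isCompact_univ_pi fun _ => isCompact_sum_abs_le_one V
  have hcont : Continuous fun v : Fin (Module.finrank ℝ V) → V => |b₀.det v| := by
    simp only [Module.Basis.det_apply]
    refine continuous_abs.comp (Continuous.matrix_det ?_)
    refine continuous_matrix fun i j => ?_
    simp only [Module.Basis.toMatrix_apply]
    exact (LinearMap.continuous_of_finiteDimensional (b₀.coord i)).comp (continuous_apply j)
  have hsc : ∀ (c : ℝ) (z : V), ∑ i, |((c • z : V) : ι → ℝ) i| =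
      |c| * ∑ i, |(z : ι → ℝ) i| := fun c z => by
    simp [abs_mul, Finset.mul_sum]
  have hn0 : ∀ z : V, 0 ≤ ∑ i, |(z : ι → ℝ) i| := fun z =>
    Finset.sum_nonneg fun _ _ => abs_nonneg _
  have hpos : ∀ z : V, z ≠ 0 → 0 < ∑ i, |(z : ι → ℝ) i| := fun z hz => by
    refine lt_of_le_of_ne (hn0 z) fun h => hz ?_
    ext i
    have := (Finset.sum_eq_zero_iff_of_nonneg fun _ _ => abs_nonneg _).1 h.symm i
      (Finset.mem_univ i)
    simpa using this
  -- The basis maximizes the determinant over tuples in the unit ball. By Cramer's rule a coordinate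
  -- is the ratio of two determinants, hence at most one in absolute value on the ball.
  obtain ⟨u, hu, hmax⟩ := hKc.exists_isMaxOn ⟨0, by intro j _; simp [hK]⟩ hcont.continuousOn
  have hu0 : 0 < |b₀.det u| := by
    set v : Fin (Module.finrank ℝ V) → V := fun j =>
      (∑ i, |(b₀ j : ι → ℝ) i|)⁻¹ • b₀ j with hv
    have hc : ∀ j, 0 < ∑ i, |(b₀ j : ι → ℝ) i| := fun j => hpos _ (b₀.ne_zero j)
    have hvK : v ∈ Set.univ.pi fun _ : Fin (Module.finrank ℝ V) => K := fun j _ => by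
      show ∑ i, |((v j : V) : ι → ℝ) i| ≤ 1
      rw [hv, hsc, abs_of_pos (inv_pos.2 (hc j)), inv_mul_cancel₀ (hc j).ne']
    refine lt_of_lt_of_le ?_ (hmax hvK)
    show 0 < |b₀.det v|
    have : b₀.det v = ∏ j, (∑ i, |(b₀ j : ι → ℝ) i|)⁻¹ := by
      have := b₀.det.map_smul_univ (fun j => (∑ i, |(b₀ j : ι → ℝ) i|)⁻¹) b₀
      rw [Module.Basis.det_self, smul_eq_mul, mul_one] at this
      exact this
    rw [this, abs_pos]
    exact (Finset.prod_pos fun j _ => inv_pos.2 (hc j)).ne'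
  obtain ⟨hli, hsp⟩ := (Module.Basis.is_basis_iff_det b₀).2 (abs_pos.1 hu0).isUnit
  set b := Module.Basis.mk hli hsp.ge with hb
  have hbu : ∀ j, b j = u j := fun j => Module.Basis.mk_apply _ _ j
  have hcramer : ∀ (z : V) (j), b₀.det (Function.update u j z) = b.repr z j * b₀.det u := by
    intro z j
    conv_lhs => rw [← b.sum_repr z]
    rw [AlternatingMap.map_update_sum, Finset.sum_eq_single j]
    · rw [AlternatingMap.map_update_smul, hbu, Function.update_eq_self, smul_eq_mul]
    · intro k _ hk
      rw [AlternatingMap.map_update_smul, hbu, AlternatingMap.map_update_self _ _ hk.symm,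
        smul_zero]
    · simp
  refine ⟨b, fun j => by rw [hbu]; exact hu j trivial, fun z j => ?_⟩
  rcases eq_or_ne z 0 with rfl | hz
  · simp
  have hzp := hpos z hz
  have h1 : |b₀.det (Function.update u j ((∑ i, |(z : ι → ℝ) i|)⁻¹ • z))| ≤ |b₀.det u| := by
    refine hmax (fun k _ => ?_)
    rcases eq_or_ne k j with rfl | hk
    · rw [Function.update_self]
      show ∑ i, |(((∑ i, |(z : ι → ℝ) i|)⁻¹ • z : V) : ι → ℝ) i| ≤ 1
      rw [hsc, abs_of_pos (inv_pos.2 hzp), inv_mul_cancel₀ hzp.ne']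
    · rw [Function.update_of_ne hk]
      exact hu k trivial
  rw [hcramer, abs_mul] at h1
  have h2 := le_of_mul_le_mul_right (h1.trans (one_mul _).ge) hu0
  rw [map_smul, Finsupp.smul_apply, smul_eq_mul, abs_mul, abs_of_pos (inv_pos.2 hzp),
    inv_mul_le_iff₀ hzp, mul_one] at h2
  exact h2

/-- Entrywise bounds (leverage scores) for the `ℓ₁` unit sphere of a subspace. -/
theorem exists_leverage (V : Submodule ℝ (ι → ℝ)) :
    ∃ lev : ι → ℝ, (∀ i, 0 ≤ lev i) ∧ ∑ i, lev i ≤ Module.finrank ℝ V ∧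
      ∀ z ∈ V, ∑ i, |z i| = 1 → ∀ i, |z i| ≤ lev i := by
  obtain ⟨b, hb1, hb2⟩ := exists_auerbach_basis V
  refine ⟨fun i => ∑ j, |(b j : ι → ℝ) i|, fun i => Finset.sum_nonneg fun _ _ => abs_nonneg _,
    ?_, fun z hz hz1 i => ?_⟩
  · rw [Finset.sum_comm]
    refine (Finset.sum_le_sum fun j _ => hb1 j).trans ?_
    simp
  · have h := congrArg (fun v : V => (v : ι → ℝ) i) (b.sum_repr ⟨z, hz⟩)
    simp only [Submodule.coe_sum, Finset.sum_apply, Submodule.coe_smul, Pi.smul_apply,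
      smul_eq_mul] at h
    rw [← h]
    refine (Finset.abs_sum_le_sum_abs _ _).trans (Finset.sum_le_sum fun j _ => ?_)
    rw [abs_mul]
    refine mul_le_of_le_one_left (abs_nonneg _) ?_
    rw [← hz1]
    exact hb2 ⟨z, hz⟩ j

/-- A net of the `ℓ₁` unit sphere of a subspace. -/
theorem exists_net (V : Submodule ℝ (ι → ℝ)) {M : ℕ} (hM : 0 < M) :
    ∃ F : Finset (ι → ℝ), F.card ≤ (2 * M + 1) ^ Module.finrank ℝ V ∧
      (∀ p ∈ F, p ∈ V ∧ ∑ i, |p i| = 1) ∧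
      ∀ z ∈ V, ∑ i, |z i| = 1 → ∃ p ∈ F, ∑ i, |z i - p i| ≤ Module.finrank ℝ V / M := by
  classical
  obtain ⟨b, hb1, hb2⟩ := exists_auerbach_basis V
  have hM' : (0 : ℝ) < M := by exact_mod_cast hM
  -- Auerbach coordinates rounded down to multiples of `1 / M`.
  set cell : V → Fin (Module.finrank ℝ V) → ℤ := fun z j => ⌊b.repr z j * M⌋ with hcell
  set C : Finset (Fin (Module.finrank ℝ V) → ℤ) :=
    Fintype.piFinset fun _ => Finset.Icc (-(M : ℤ)) M with hC
  have hmem : ∀ z : V, ∑ i, |(z : ι → ℝ) i| = 1 → cell z ∈ C := by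
    intro z hz
    refine Fintype.mem_piFinset.2 fun j => Finset.mem_Icc.2 ?_
    have h := abs_le.1 ((hb2 z j).trans hz.le)
    constructor
    · refine Int.le_floor.2 ?_
      push_cast
      nlinarith
    · have : (⌊b.repr z j * M⌋ : ℝ) ≤ M := (Int.floor_le _).trans (by nlinarith)
      exact_mod_cast this
  have hclose : ∀ z p : V, cell z = cell p →
      ∑ i, |(z : ι → ℝ) i - (p : ι → ℝ) i| ≤ Module.finrank ℝ V / M := by
    intro z p h
    have hd : ∀ i, (z : ι → ℝ) i - (p : ι → ℝ) i =
        ∑ j, (b.repr z j - b.repr p j) * (b j : ι → ℝ) i := by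
      intro i
      have h := congrArg (fun v : V => (v : ι → ℝ) i) (b.sum_repr (z - p))
      simp only [Submodule.coe_sum, Finset.sum_apply, Submodule.coe_smul, Pi.smul_apply,
        smul_eq_mul, map_sub, Finsupp.sub_apply, Submodule.coe_sub, Pi.sub_apply] at h
      exact h.symm
    calc _ ≤ ∑ i, ∑ j, 1 / (M : ℝ) * |(b j : ι → ℝ) i| := by
          refine Finset.sum_le_sum fun i _ => ?_
          rw [hd]
          refine (Finset.abs_sum_le_sum_abs _ _).trans (Finset.sum_le_sum fun j _ => ?_)
          rw [abs_mul]
          refine mul_le_mul_of_nonneg_right ?_ (abs_nonneg _)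
          have := Int.abs_sub_lt_one_of_floor_eq_floor (congrFun h j)
          rw [← sub_mul, abs_mul, abs_of_pos hM'] at this
          exact ((lt_div_iff₀ hM').2 this).le
      _ ≤ ∑ j : Fin (Module.finrank ℝ V), 1 / (M : ℝ) := by
          rw [Finset.sum_comm]
          refine Finset.sum_le_sum fun j _ => ?_
          rw [← Finset.mul_sum]
          exact mul_le_of_le_one_right (by positivity) (hb1 j)
      _ = _ := by simp [div_eq_mul_inv]
  -- One representative is taken from the sphere in each cell that meets it, so the net itself lies
  -- on the sphere.
  set C' := C.filter fun c => ∃ z : V, ∑ i, |(z : ι → ℝ) i| = 1 ∧ cell z = c with hC'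
  have hrep : ∀ c, ∃ z : V, c ∈ C' → ∑ i, |(z : ι → ℝ) i| = 1 ∧ cell z = c := by
    intro c
    by_cases hc : c ∈ C'
    · obtain ⟨z, hz⟩ := (Finset.mem_filter.1 hc).2
      exact ⟨z, fun _ => hz⟩
    · exact ⟨0, fun h => absurd h hc⟩
  choose rep hrep using hrep
  refine ⟨C'.image fun c => (rep c : ι → ℝ), ?_, fun p hp => ?_, fun z hz hz1 => ?_⟩
  · refine Finset.card_image_le.trans ((Finset.card_filter_le _ _).trans ?_)
    rw [hC, Fintype.card_piFinset_const, Int.card_Icc]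
    refine Nat.pow_le_pow_left ?_ _
    omega
  · obtain ⟨c, hc, rfl⟩ := Finset.mem_image.1 hp
    exact ⟨(rep c).2, (hrep c hc).1⟩
  · have hc : cell ⟨z, hz⟩ ∈ C' := Finset.mem_filter.2 ⟨hmem ⟨z, hz⟩ hz1, ⟨z, hz⟩, hz1, rfl⟩
    exact ⟨_, Finset.mem_image_of_mem _ hc, hclose ⟨z, hz⟩ _ (hrep _ hc).2.symm⟩

end Auerbach

/-! ### Contraction for a whole subspace -/

section Uniform

variable {I : Type*} [Fintype I] [DecidableEq I] {N o J H B : ℕ}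

theorem sketchLoss_nonneg (x : I → ℝ) (ξ : I × Bool → Option ((Fin (H + 1) × Fin B) × Bool)) :
    0 ≤ sketchLoss o J x ξ :=
  Finset.sum_nonneg fun _ _ => mul_nonneg (levelWeight_pos _ _ _).le (abs_nonneg _)

theorem sketchLoss_smul (c : ℝ) (x : I → ℝ)
    (ξ : I × Bool → Option ((Fin (H + 1) × Fin B) × Bool)) :
    sketchLoss o J (fun i => c * x i) ξ = |c| * sketchLoss o J x ξ := by
  unfold sketchLoss
  rw [Finset.mul_sum]
  refine Finset.sum_congr rfl fun k _ => ?_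
  rw [mul_left_comm |c|, ← abs_mul, Finset.mul_sum]
  congr 2
  exact Finset.sum_congr rfl fun j _ => by ring

theorem sketchLoss_le_add (x y : I → ℝ)
    (ξ : I × Bool → Option ((Fin (H + 1) × Fin B) × Bool)) :
    sketchLoss o J x ξ ≤ sketchLoss o J y ξ + sketchLoss o J (fun i => y i - x i) ξ := by
  unfold sketchLoss
  rw [← Finset.sum_add_distrib]
  refine Finset.sum_le_sum fun k _ => ?_
  rw [← mul_add]
  refine mul_le_mul_of_nonneg_left ?_ (levelWeight_pos _ _ _).le
  have : ∑ j : I × Bool, coef k (ξ j) * x j.1 = ∑ j : I × Bool, coef k (ξ j) * y j.1 -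
      ∑ j : I × Bool, coef k (ξ j) * (y j.1 - x j.1) := by
    rw [← Finset.sum_sub_distrib]
    exact Finset.sum_congr rfl fun j _ => by ring
  rw [this]
  exact abs_sub _ _

theorem levelWeight_le (o : ℕ) (k : Fin (H + 1)) : levelWeight o J k ≤ 2 ^ (o + H * J) := by
  rcases k with ⟨_ | h, hh⟩
  · exact one_le_pow₀ (by norm_num)
  · refine pow_le_pow_right₀ (by norm_num) (Nat.add_le_add_left (Nat.mul_le_mul_right J ?_) o)
    omega

/-- A crude Lipschitz bound from the largest weight and the two copies; the fineness of the net
absorbs it. -/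
theorem sketchLoss_le_mul (x : I → ℝ)
    (ξ : I × Bool → Option ((Fin (H + 1) × Fin B) × Bool)) :
    sketchLoss o J x ξ ≤ 2 ^ (o + H * J) * (2 * ∑ i, |x i|) := by
  unfold sketchLoss
  calc _ ≤ ∑ k : Fin (H + 1) × Fin B, 2 ^ (o + H * J) * ∑ j, |coef k (ξ j)| * |x j.1| := by
        refine Finset.sum_le_sum fun k _ => mul_le_mul (levelWeight_le o k.1) ?_ (abs_nonneg _)
          (by positivity)
        refine (Finset.abs_sum_le_sum_abs _ _).trans (le_of_eq ?_)
        exact Finset.sum_congr rfl fun j _ => abs_mul _ _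
    _ ≤ 2 ^ (o + H * J) * ∑ j : I × Bool, |x j.1| := by
        rw [← Finset.mul_sum, Finset.sum_comm]
        refine mul_le_mul_of_nonneg_left (Finset.sum_le_sum fun j _ => ?_) (by positivity)
        rw [← Finset.sum_mul]
        exact mul_le_of_le_one_left (abs_nonneg _) (sum_abs_coef_le_one _ _)
    _ = _ := by
        rw [Fintype.sum_prod_type]
        simp only [Fintype.sum_bool, ← two_mul, ← Finset.mul_sum]

open Classical in
/-- The sketch does not contract any vector of a subspace by much. -/
theorem pr_exists_sketchLoss_lt_le (hN : 0 < N) (ho : 1 ≤ o) (hJ : 1 ≤ J) (hB0 : N * 2 ^ o ≤ B)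
    (hBJ : N * 2 ^ J ≤ B) (V : Submodule ℝ (I → ℝ)) {γ a η : ℝ} (hγ : 0 < γ) (ha : 0 < a)
    (ha1 : a ≤ 1) (hNγ : 4 / (γ * a) ≤ N) (htiny : Fintype.card I * (γ / 2 ^ (H * J)) ≤ a)
    {M : ℕ} (hM : 0 < M) (hMa : Module.finrank ℝ V * 2 ^ (o + H * J + 1) ≤ a * M)
    {lev : I → ℝ} (hlev0 : ∀ i, 0 ≤ lev i)
    (hlev : ∀ z ∈ V, ∑ i, |z i| = 1 → ∀ i, |z i| ≤ lev i)
    (S : Finset I) (hS : ∀ i, γ < lev i → i ∈ S)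
    (hcoll : pr (placementW I N o J H B)
      (fun ξ => a < ∑ i ∈ S with ¬ Isolated S ξ i, lev i) ≤ η) :
    pr (placementW I N o J H B)
      (fun ξ => ∃ z ∈ V, sketchLoss o J z ξ < (1 - 5 * a) * ∑ i, |z i|) ≤
      (2 * M + 1) ^ Module.finrank ℝ V *
        (Real.exp (-(a ^ 2 / (16 * γ))) + (H + 1) * Real.exp (-(2 / γ))) + η := by
  have hπ : IsProb (placementW I N o J H B) := placementW_isProb hN ho hJ hB0 hBJ
  have hM' : (0 : ℝ) < M := by exact_mod_cast hM
  obtain ⟨F, hF, hFV, hnet⟩ := exists_net V hM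
  -- The total loss `5 * a` consists of `2 * a` from the fixed-vector bound and `a` each for tiny
  -- entries, collisions and the distance to the net.
  set bad : (I → ℝ) → (I × Bool → Option ((Fin (H + 1) × Fin B) × Bool)) → Prop := fun p ξ =>
    sketchLoss o J p ξ < 1 - 2 * a - Fintype.card I * (γ / 2 ^ (H * J)) -
      ∑ i with γ < |p i| ∧ ¬ Isolated S ξ i, |p i| with hbad
  have hsub : ∀ ξ, (∃ z ∈ V, sketchLoss o J z ξ < (1 - 5 * a) * ∑ i, |z i|) →
      (∃ p ∈ F, bad p ξ) ∨ a < ∑ i ∈ S with ¬ Isolated S ξ i, lev i := by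
    rintro ξ ⟨z, hzV, hz⟩
    by_contra hcon
    push Not at hcon
    obtain ⟨hgood, hc⟩ := hcon
    have hz0 : 0 < ∑ i, |z i| := by
      refine lt_of_le_of_ne (Finset.sum_nonneg fun _ _ => abs_nonneg _) fun h => ?_
      rw [← h, mul_zero] at hz
      exact absurd hz (not_lt.2 (sketchLoss_nonneg z ξ))
    set c := (∑ i, |z i|)⁻¹ with hc'
    have hc0 : 0 < c := inv_pos.2 hz0
    set y : I → ℝ := fun i => c * z i with hy
    have hyV : y ∈ V := V.smul_mem c hzV
    have hy1 : ∑ i, |y i| = 1 := by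
      simp only [hy, abs_mul, abs_of_pos hc0]
      rw [← Finset.mul_sum, hc', inv_mul_cancel₀ hz0.ne']
    have hyl : sketchLoss o J y ξ < 1 - 5 * a := by
      rw [hy, sketchLoss_smul, abs_of_pos hc0, hc', inv_mul_lt_iff₀ hz0, mul_comm]
      exact hz
    obtain ⟨p, hpF, hp⟩ := hnet y hyV hy1
    obtain ⟨hpV, hp1⟩ := hFV p hpF
    have h1 : sketchLoss o J p ξ ≤ sketchLoss o J y ξ + a := by
      refine (sketchLoss_le_add p y ξ).trans (add_le_add le_rfl ?_)
      refine (sketchLoss_le_mul _ ξ).trans ?_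
      calc (2 : ℝ) ^ (o + H * J) * (2 * ∑ i, |y i - p i|)
          ≤ 2 ^ (o + H * J) * (2 * (Module.finrank ℝ V / M)) := by gcongr
        _ = Module.finrank ℝ V * 2 ^ (o + H * J + 1) / M := by ring
        _ ≤ a := (div_le_iff₀ hM').2 hMa
    -- Measured by `lev`, the collisions do not depend on the point of the net, so their probability
    -- `η` enters once and not once for every point.
    have h2 : ∑ i with γ < |p i| ∧ ¬ Isolated S ξ i, |p i| ≤
        ∑ i ∈ S with ¬ Isolated S ξ i, lev i := by
      refine (Finset.sum_le_sum fun i _ => hlev p hpV hp1 i).trans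
        (Finset.sum_le_sum_of_subset_of_nonneg (fun i hi => ?_) fun i _ _ => hlev0 i)
      rw [Finset.mem_filter] at hi ⊢
      exact ⟨hS i (hi.2.1.trans_le (hlev p hpV hp1 i)), hi.2.2⟩
    have h3 := hgood p hpF
    simp only [hbad, not_lt] at h3
    linarith
  refine (hπ.pr_mono hsub).trans ((hπ.pr_or_le _ _).trans (add_le_add ?_ hcoll))
  refine (hπ.pr_exists_le F bad).trans ?_
  calc ∑ p ∈ F, pr (placementW I N o J H B) (bad p)
      ≤ ∑ p ∈ F, (Real.exp (-(a ^ 2 / (16 * γ))) + (H + 1) * Real.exp (-(2 / γ))) :=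
        Finset.sum_le_sum fun p hp => pr_sketchLoss_lt_le hN ho hJ hB0 hBJ (hFV p hp).2 hγ ha ha1
          hNγ S fun i hi => hS i (hi.trans_le (hlev p (hFV p hp).1 (hFV p hp).2 i))
    _ ≤ _ := by
        rw [Finset.sum_const, nsmul_eq_mul]
        refine mul_le_mul_of_nonneg_right ?_ (by positivity)
        exact_mod_cast hF

open Classical in
/-- Entries with large leverage are likely to be isolated. -/
theorem pr_sum_not_isolated_le (hN : 0 < N) (ho : 1 ≤ o) (hJ : 1 ≤ J) (hB0 : N * 2 ^ o ≤ B)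
    (hBJ : N * 2 ^ J ≤ B) {γ a D : ℝ} (hγ : 0 < γ) (ha : 0 < a) {lev : I → ℝ}
    (hlev0 : ∀ i, 0 ≤ lev i) (hlev : ∑ i, lev i ≤ D) :
    pr (placementW I N o J H B) (fun ξ => a < ∑ i ∈ Finset.univ.filter (fun i => γ < lev i) with
        ¬ Isolated (Finset.univ.filter fun i => γ < lev i) ξ i, lev i) ≤
      D ^ 2 / (γ * N * 2 ^ o * a) := by
  have hπ : IsProb (placementW I N o J H B) := placementW_isProb hN ho hJ hB0 hBJ
  have hN' : (0 : ℝ) < N := by exact_mod_cast hN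
  set S : Finset I := Finset.univ.filter fun i => γ < lev i with hS
  have hD : 0 ≤ D := (Finset.sum_nonneg fun i _ => hlev0 i).trans hlev
  have hSD : ∑ i ∈ S, lev i ≤ D :=
    (Finset.sum_le_sum_of_subset_of_nonneg (Finset.subset_univ S) fun i _ _ => hlev0 i).trans hlev
  -- Few indices can have leverage above `γ`, so each of them collides with probability at most `D /
  -- (γ * N * 2 ^ o)`.
  have hcard : (S.card : ℝ) ≤ D / γ := by
    rw [le_div_iff₀ hγ]
    calc (S.card : ℝ) * γ = ∑ i ∈ S, γ := by rw [Finset.sum_const, nsmul_eq_mul]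
      _ ≤ ∑ i ∈ S, lev i := Finset.sum_le_sum fun i hi => (Finset.mem_filter.1 hi).2.le
      _ ≤ D := hSD
  have h := hπ.pr_le_ex_div (t := a)
    (f := fun ξ => ∑ i ∈ S, lev i * if ¬ Isolated S ξ i then 1 else 0)
    (A := fun ξ => a < ∑ i ∈ S with ¬ Isolated S ξ i, lev i)
    (fun ξ => Finset.sum_nonneg fun i _ => mul_nonneg (hlev0 i) (by split_ifs <;> norm_num)) ha
    (fun ξ hξ => by
      rw [Finset.sum_filter] at hξ
      refine hξ.le.trans (le_of_eq (Finset.sum_congr rfl fun i _ => ?_))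
      split_ifs <;> simp)
  refine h.trans ?_
  rw [ex_sum, div_le_iff₀ ha]
  calc _ ≤ ∑ i ∈ S, lev i * (D / γ / (N * 2 ^ o)) := by
        refine Finset.sum_le_sum fun i _ => ?_
        rw [ex_const_mul]
        refine mul_le_mul_of_nonneg_left ?_ (hlev0 i)
        refine le_trans (le_of_eq ?_)
          ((pr_not_isolated_le (H := H) hN ho hJ hB0 hBJ S i).trans (by gcongr))
        unfold ex pr
        refine Finset.sum_congr rfl fun ξ _ => ?_
        by_cases hξ : Isolated S ξ i <;> simp [hξ]
    _ ≤ D * (D / γ / (N * 2 ^ o)) := by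
        rw [← Finset.sum_mul]
        gcongr
    _ = _ := by field_simp

end Uniform

/-! ### Sketches as streaming algorithms -/

section Streaming

variable {n r d : ℕ}

theorem foldl_addStep (u : StreamUpdate n d) (l : List (Fin r × ℝ)) (st : MachineState r d) :
    (l.foldl (MachineState.addStep u) st).steps = st.steps + l.length ∧
      ∀ k j, (l.foldl (MachineState.addStep u) st).mem k j = st.mem k j +
        if j = u.col then (l.map fun q => if k = q.1 then q.2 else 0).sum * u.val else 0 := by
  induction l generalizing st with
  | nil => simp
  | cons q l ih =>
    obtain ⟨h1, h2⟩ := ih (st.addStep u q)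
    rw [List.foldl_cons]
    refine ⟨?_, fun k j => ?_⟩
    · rw [h1, List.length_cons]
      simp only [MachineState.addStep]
      omega
    · rw [h2, List.map_cons, List.sum_cons]
      simp only [MachineState.addStep]
      by_cases hk : k = q.1 <;> by_cases hj : j = u.col <;> simp [hk, hj]
      ring

/-- Reading the columns of a sketching matrix off a tape. -/
theorem computableInOnePass_of_tape {S : Matrix (Fin r) (Fin n) ℝ} {τ : ℝ}
    (tape : Fin n → List (Fin r × ℝ))
    (hS : ∀ k i, S k i = ((tape i).map fun q => if k = q.1 then q.2 else 0).sum)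
    (hτ : ∀ i, ((tape i).length : ℝ) + 1 ≤ τ) : ComputableInOnePass S d τ := by
  have key : ∀ (σ : List (StreamUpdate n d)) (st : MachineState r d),
      (σ.foldl (MachineState.process tape) st).mem = st.mem + S * streamMatrix σ ∧
      ((σ.foldl (MachineState.process tape) st).steps : ℝ) ≤ st.steps + τ * σ.length := by
    intro σ
    induction σ with
    | nil => intro st; simp [streamMatrix]
    | cons u σ ih =>
      intro st
      obtain ⟨h1, h2⟩ := ih (st.process tape u)
      obtain ⟨h3, h4⟩ := foldl_addStep u (tape u.row) ⟨st.mem, st.steps + 1⟩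
      rw [List.foldl_cons]
      constructor
      · rw [h1]
        have : streamMatrix (u :: σ) = Matrix.single u.row u.col u.val + streamMatrix σ := by
          simp [streamMatrix]
        rw [this, Matrix.mul_add, ← add_assoc]
        congr 1
        ext k j
        rw [MachineState.process, h4, Matrix.add_apply, ← hS]
        congr 1
        by_cases hj : j = u.col
        · subst hj
          simp
        · rw [if_neg hj, Matrix.mul_single_apply_of_ne _ _ _ _ _ hj]
      · refine h2.trans ?_
        have h5 : ((st.process tape u).steps : ℝ) ≤ st.steps + τ := by
          rw [MachineState.process, h3]
          push_cast
          linarith [hτ u.row]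
        rw [List.length_cons]
        push_cast
        linarith
  refine ⟨tape, fun A σ hσ => ?_⟩
  obtain ⟨h1, h2⟩ := key σ ⟨0, 0⟩
  have h3 : ((runPass tape σ).steps : ℝ) ≤ τ * σ.length := by simpa [runPass] using h2
  exact ⟨by rw [← hσ]; simpa [runPass] using h1, h3, fun h => by rwa [← h]⟩

theorem ComputableInOnePass.mono {S : Matrix (Fin r) (Fin n) ℝ} {τ τ' : ℝ}
    (h : ComputableInOnePass S d τ) (hτ : τ ≤ τ') : ComputableInOnePass S d τ' := by
  obtain ⟨tape, ht⟩ := h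
  refine ⟨tape, fun A σ hσ => ?_⟩
  obtain ⟨h1, h2, h3⟩ := ht A σ hσ
  exact ⟨h1, h2.trans (by gcongr), fun h => (h3 h).trans (by gcongr)⟩

end Streaming

/-! ### Random sketches on finite probability spaces -/

section FiniteSketch

variable {n r : ℕ} {Ω : Type} [Fintype Ω] {μ : Ω → ℝ}

/-- The random sketch given by finitely many weighted draws. -/
noncomputable def finSketch (hμ : IsProb μ) (S : Ω → Matrix (Fin r) (Fin n) ℝ)
    (w : Ω → Fin r → ℝ) : RandomSketch r n where
  Ω := Ω
  mΩ := ⊤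
  ℙ := ∑ ω, ENNReal.ofReal (μ ω) • @Measure.dirac Ω ⊤ ω
  prob := by
    refine @IsProbabilityMeasure.mk Ω ⊤ _ ?_
    simp only [Measure.coe_finsetSum, Finset.sum_apply, Measure.smul_apply, smul_eq_mul]
    rw [← ENNReal.ofReal_one, ← hμ.sum_one, ENNReal.ofReal_sum_of_nonneg fun ω _ => hμ.nonneg ω]
    refine Finset.sum_congr rfl fun ω _ => ?_
    rw [@Measure.dirac_apply' Ω ⊤ _ _ MeasurableSet.univ]
    simp
  S := S
  w := w
  measurable_S := fun _ _ => @measurable_from_top Ω ℝ _ _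
  measurable_w := fun _ => @measurable_from_top Ω ℝ _ _

theorem finSketch_measure (hμ : IsProb μ) (S : Ω → Matrix (Fin r) (Fin n) ℝ)
    (w : Ω → Fin r → ℝ) (A : Ω → Prop) :
    (finSketch hμ S w).ℙ {ω : Ω | A ω} = ENNReal.ofReal (pr μ A) := by
  classical
  show (∑ ω, ENNReal.ofReal (μ ω) • @Measure.dirac Ω ⊤ ω : @Measure Ω ⊤) {ω | A ω} = _
  simp only [Measure.coe_finsetSum, Finset.sum_apply, Measure.smul_apply, smul_eq_mul]
  unfold pr ex
  rw [ENNReal.ofReal_sum_of_nonneg fun ω _ =>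
    mul_nonneg (hμ.nonneg ω) (by split_ifs <;> norm_num)]
  refine Finset.sum_congr rfl fun ω _ => ?_
  rw [@Measure.dirac_apply' Ω ⊤ _ _ MeasurableSpace.measurableSet_top]
  by_cases h : A ω <;> simp [h]

theorem finSketch_succeeds (hμ : IsProb μ) (S : Ω → Matrix (Fin r) (Fin n) ℝ)
    (w : Ω → Fin r → ℝ) {d : ℕ} {α ε P : ℝ}
    (h : ∀ (X : Matrix (Fin n) (Fin d) ℝ) (Y : Fin n → ℝ) (βs : Fin d → ℝ),
      IsMinOn (l1Loss (fun _ => 1) (augment X Y)) Set.univ βs →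
      pr μ (fun ω => ¬ IsWeakWeightedSketch Set.univ α ε (augment X Y) (fun _ => 1) βs
        (S ω * augment X Y) (w ω)) ≤ P) : (finSketch hμ S w).Succeeds d α ε P := by
  intro X Y βs hβ
  refine le_trans (le_of_eq ?_) (ENNReal.ofReal_le_ofReal (h X Y βs hβ))
  exact finSketch_measure hμ S w _

end FiniteSketch

theorem pr_eq_zero {Ω : Type*} [Fintype Ω] (μ : Ω → ℝ) {A : Ω → Prop} (h : ∀ ω, ¬ A ω) :
    pr μ A = 0 :=
  Finset.sum_eq_zero fun ω _ => by simp [h ω]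

theorem isProb_unit : IsProb fun _ : Unit => (1 : ℝ) := ⟨fun _ => zero_le_one, by simp⟩

theorem l1Loss_nonneg {m d : ℕ} {w : Fin m → ℝ} (hw : ∀ i, 0 ≤ w i)
    (B : Matrix (Fin m) (Fin d ⊕ Unit) ℝ) (β : Fin d → ℝ) : 0 ≤ l1Loss w B β :=
  Finset.sum_nonneg fun i _ => mul_nonneg (hw i) (abs_nonneg _)

/-- Keeping the data is a sketch. -/
theorem exists_identity_sketch (n : ℕ) {d : ℕ} {τ α ε P : ℝ} (hτ : 2 ≤ τ) (hα : 1 ≤ α)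
    (hε : 0 ≤ ε) (hP : 0 ≤ P) : ∃ D : RandomSketch n n,
      (∀ ω, ComputableInOnePass (D.S ω) d τ) ∧ D.Succeeds d α ε P := by
  refine ⟨finSketch isProb_unit (fun _ => 1) fun _ _ => 1, fun _ => ?_, ?_⟩
  · refine computableInOnePass_of_tape (fun i => [(i, 1)]) (fun k i => ?_) fun i => ?_
    · simp [finSketch, Matrix.one_apply]
    · norm_num
      linarith
  · refine finSketch_succeeds _ _ _ fun X Y βs _ => ?_
    have h0 := fun β => l1Loss_nonneg (fun _ => zero_le_one) (augment X Y) β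
    have : ∀ ω : Unit, IsWeakWeightedSketch Set.univ α ε (augment X Y) (fun _ => 1) βs
        ((1 : Matrix (Fin n) (Fin n) ℝ) * augment X Y) (fun _ => 1) := fun _ => by
      rw [Matrix.one_mul]
      exact ⟨fun _ => one_pos, fun β _ => by nlinarith [h0 β], by nlinarith [h0 βs],
        fun β hβ => absurd trivial hβ⟩
    exact (pr_eq_zero _ fun ω hω => hω (this ω)).le.trans hP

/-- If nothing is required of the contraction or of the success probability, then an empty sketch
will do. -/
theorem exists_empty_sketch (n : ℕ) {d : ℕ} {τ α ε P : ℝ} (hτ : 1 ≤ τ) (hα : 0 ≤ α)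
    (hP : 0 ≤ P) (h : 1 ≤ ε ∨ 1 ≤ P) : ∃ D : RandomSketch 0 n,
      (∀ ω, ComputableInOnePass (D.S ω) d τ) ∧ D.Succeeds d α ε P := by
  refine ⟨finSketch isProb_unit (fun _ => 0) fun _ _ => 1, fun _ => ?_, ?_⟩
  · exact computableInOnePass_of_tape (fun i => []) (fun k => k.elim0) fun i => by simpa using hτ
  · refine finSketch_succeeds _ _ _ fun X Y βs _ => ?_
    have h0 := fun β => l1Loss_nonneg (fun _ => zero_le_one) (augment X Y) β
    rcases h with h | h
    · have : ∀ ω : Unit, IsWeakWeightedSketch Set.univ α ε (augment X Y) (fun _ => 1) βs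
          ((0 : Matrix (Fin 0) (Fin n) ℝ) * augment X Y) (fun _ => 1) := fun _ => by
        refine ⟨fun k => k.elim0, fun β _ => ?_, ?_, fun β hβ => absurd trivial hβ⟩
        · have : l1Loss (fun _ => 1) ((0 : Matrix (Fin 0) (Fin n) ℝ) * augment X Y) β = 0 := by
            simp [l1Loss]
          rw [this]
          nlinarith [h0 β]
        · have : l1Loss (fun _ => 1) ((0 : Matrix (Fin 0) (Fin n) ℝ) * augment X Y) βs = 0 := by
            simp [l1Loss]
          rw [this]
          exact mul_nonneg hα (h0 βs)
      exact (pr_eq_zero _ fun ω hω => hω (this ω)).le.trans hP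
    · refine le_trans (isProb_unit.pr_mono (B := fun _ => True) fun _ _ => trivial) ?_
      simpa [pr, ex] using h

/-! ### The sketch with a random offset of the sampling rates -/

section Core

/-- Splitting every entry into `s` equal parts. -/
noncomputable def splitEntries (n s : ℕ) : (Fin n → ℝ) →ₗ[ℝ] (Fin n × Fin s → ℝ) where
  toFun z := fun i => z i.1 / s
  map_add' z z' := by ext i; simp [add_div]
  map_smul' c z := by ext i; simp [mul_div_assoc]

theorem sum_abs_splitEntries {n s : ℕ} (hs : 0 < s) (z : Fin n → ℝ) :
    ∑ i, |splitEntries n s z i| = ∑ i, |z i| := by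
  have hs' : (0 : ℝ) < s := by exact_mod_cast hs
  rw [Fintype.sum_prod_type]
  refine Finset.sum_congr rfl fun i _ => ?_
  simp only [splitEntries, LinearMap.coe_mk, AddHom.coe_mk, abs_div, abs_of_pos hs',
    Finset.sum_const, Finset.card_univ, Fintype.card_fin, nsmul_eq_mul]
  field_simp

variable {n s N J G H : ℕ}

/-- The distribution of a uniformly random offset together with a placement of the entries. -/
noncomputable def offsetW (n s N J G H : ℕ) : Fin J × ((Fin n × Fin s) × Bool →
    Option ((Fin (H + 1) × Fin (N * 2 ^ (G + J))) × Bool)) → ℝ := fun ω =>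
  1 / J * placementW (Fin n × Fin s) N (G + 1 + ω.1) J H (N * 2 ^ (G + J)) ω.2

theorem offset_bounds (N G : ℕ) {J : ℕ} (a : Fin J) : N * 2 ^ (G + 1 + a) ≤ N * 2 ^ (G + J) ∧
    N * 2 ^ J ≤ N * 2 ^ (G + J) :=
  ⟨Nat.mul_le_mul_left N (Nat.pow_le_pow_right two_pos (by omega)),
    Nat.mul_le_mul_left N (Nat.pow_le_pow_right two_pos (by omega))⟩

theorem placementW_offset_isProb (hN : 0 < N) (a : Fin J) :
    IsProb (placementW (Fin n × Fin s) N (G + 1 + a) J H (N * 2 ^ (G + J))) :=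
  placementW_isProb hN (by omega) (by have := a.2; omega) (offset_bounds N G a).1
    (offset_bounds N G a).2

theorem offsetW_isProb (hN : 0 < N) (hJ : 1 ≤ J) : IsProb (offsetW n s N J G H) where
  nonneg ω := mul_nonneg (by positivity) ((placementW_offset_isProb hN ω.1).nonneg ω.2)
  sum_one := by
    have hJ' : (0 : ℝ) < J := by exact_mod_cast hJ
    unfold offsetW
    rw [Fintype.sum_prod_type]
    simp only [← Finset.mul_sum, (placementW_offset_isProb hN _).sum_one]
    simp [hJ'.ne']

theorem pr_offsetW (A : Fin J × ((Fin n × Fin s) × Bool →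
    Option ((Fin (H + 1) × Fin (N * 2 ^ (G + J))) × Bool)) → Prop) :
    pr (offsetW n s N J G H) A = 1 / J * ∑ a : Fin J,
      pr (placementW (Fin n × Fin s) N (G + 1 + a) J H (N * 2 ^ (G + J))) fun ξ => A (a, ξ) := by
  unfold pr ex offsetW
  rw [Fintype.sum_prod_type, Finset.mul_sum]
  refine Finset.sum_congr rfl fun a _ => ?_
  rw [Finset.mul_sum]
  exact Finset.sum_congr rfl fun ξ _ => mul_assoc _ _ _

/-- The sketching matrix of a placement. -/
noncomputable def placementMatrix {H B : ℕ}
    (ξ : (Fin n × Fin s) × Bool → Option ((Fin (H + 1) × Fin B) × Bool)) :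
    Matrix (Fin ((H + 1) * B)) (Fin n) ℝ := fun k i =>
  ∑ p : Fin s × Bool, coef (finProdFinEquiv.symm k) (ξ ((i, p.1), p.2)) / s

theorem sum_map_filterMap {α β : Type*} (l : List α) (f : α → Option β) (g : β → ℝ) :
    ((l.filterMap f).map g).sum = (l.map fun x => (f x).elim 0 g).sum := by
  induction l with
  | nil => simp
  | cons x l ih =>
    rcases h : f x with _ | y
    · simp [h, ih]
    · simp [h, ih]

/-- Each of the two copies of the `s` parts of a row needs at most one fetch, and a dropped copy
none; the `+ 1` is the reading of the update. -/
theorem placementMatrix_computable {B d : ℕ} {τ : ℝ} (hτ : 2 * s + 1 ≤ τ)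
    (ξ : (Fin n × Fin s) × Bool → Option ((Fin (H + 1) × Fin B) × Bool)) :
    ComputableInOnePass (placementMatrix ξ) d τ := by
  refine computableInOnePass_of_tape (fun i =>
    (Finset.univ : Finset (Fin s × Bool)).toList.filterMap fun p =>
      (ξ ((i, p.1), p.2)).map fun q => (finProdFinEquiv q.1, (if q.2 then 1 else -1) / (s : ℝ)))
    (fun k i => ?_) fun i => ?_
  · rw [sum_map_filterMap, Finset.sum_map_toList]
    unfold placementMatrix
    refine Finset.sum_congr rfl fun p _ => ?_
    rcases ξ ((i, p.1), p.2) with _ | ⟨k', b⟩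
    · simp
    · simp only [coef_some, Option.map_some, Option.elim_some, Equiv.eq_symm_apply]
      by_cases h : finProdFinEquiv k' = k
      · simp [h]
      · simp [h, Ne.symm h]
  · refine le_trans ?_ hτ
    have h1 := List.length_filterMap_le (fun p : Fin s × Bool => (ξ ((i, p.1), p.2)).map
      fun q => (finProdFinEquiv q.1, (if q.2 then 1 else -1) / (s : ℝ)))
      (Finset.univ : Finset (Fin s × Bool)).toList
    have h2 : ((Finset.univ : Finset (Fin s × Bool)).toList.length : ℝ) = 2 * s := by
      rw [Finset.length_toList]
      simp [mul_comm]
    have h3 := (Nat.cast_le (α := ℝ)).2 h1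
    linarith

/-- The common factor `l` of the weights is free; choosing it below one trades permitted contraction
for less dilation. -/
theorem l1Loss_placementMatrix {B d o : ℕ} (ξ : (Fin n × Fin s) × Bool →
    Option ((Fin (H + 1) × Fin B) × Bool)) (l : ℝ) (A : Matrix (Fin n) (Fin d ⊕ Unit) ℝ)
    (β : Fin d → ℝ) :
    l1Loss (fun k => l * levelWeight o J (finProdFinEquiv.symm k).1) (placementMatrix ξ * A) β =
      l * sketchLoss o J (splitEntries n s (A.mulVec (Sum.elim β fun _ => -1))) ξ := by
  unfold l1Loss sketchLoss
  rw [Finset.mul_sum, ← Equiv.sum_comp finProdFinEquiv]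
  refine Finset.sum_congr rfl fun k _ => ?_
  simp only [Equiv.symm_apply_apply]
  rw [mul_assoc, ← Matrix.mulVec_mulVec]
  congr 3
  simp only [Matrix.mulVec, dotProduct, placementMatrix, splitEntries, LinearMap.coe_mk,
    AddHom.coe_mk, Equiv.symm_apply_apply]
  simp only [Fintype.sum_prod_type, Finset.sum_mul]
  refine Finset.sum_congr rfl fun i _ => Finset.sum_congr rfl fun t _ =>
    Finset.sum_congr rfl fun c _ => by ring

/-- The contraction bound for a fixed offset. -/
theorem pr_exists_contraction_le {d : ℕ} (hN : 0 < N) (hs : 0 < s) (o : Fin J) {γ a η : ℝ}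
    (hγ : 0 < γ) (ha : 0 < a) (ha1 : a ≤ 1) (hNγ : 4 / (γ * a) ≤ N)
    (htiny : n * s * (γ / 2 ^ (H * J)) ≤ a) (hη : 0 ≤ η)
    (hcoll : 1 ≤ s * γ ∨ ((d : ℝ) + 1) ^ 2 / (γ * N * 2 ^ G * a) ≤ η)
    (A : Matrix (Fin n) (Fin d ⊕ Unit) ℝ) :
    pr (placementW (Fin n × Fin s) N (G + 1 + o) J H (N * 2 ^ (G + J))) (fun ξ =>
      ∃ v, sketchLoss (G + 1 + o) J (splitEntries n s (A.mulVec v)) ξ <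
        (1 - 5 * a) * ∑ i, |A.mulVec v i|) ≤
      (10 * (d + 1) * 2 ^ (G + (H + 1) * J) / a) ^ (d + 1) *
        (Real.exp (-(a ^ 2 / (16 * γ))) + (H + 1) * Real.exp (-(2 / γ))) + η := by
  classical
  have hN' : (0 : ℝ) < N := by exact_mod_cast hN
  have hs' : (0 : ℝ) < s := by exact_mod_cast hs
  have hJ : 1 ≤ J := by have := o.2; omega
  obtain ⟨hB0, hBJ⟩ := offset_bounds N G o
  have hπ := placementW_offset_isProb (n := n) (s := s) (G := G) (H := H) hN o
  set V : Submodule ℝ (Fin n × Fin s → ℝ) :=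
    LinearMap.range (splitEntries n s ∘ₗ A.mulVecLin) with hV
  have hrank : Module.finrank ℝ V ≤ d + 1 := by
    refine (LinearMap.finrank_range_le _).trans ?_
    simp
  have hrank' : (Module.finrank ℝ V : ℝ) ≤ d + 1 := by exact_mod_cast hrank
  -- A mesh fine enough for the Lipschitz constant at every offset, since `G + 1 + o ≤ G + J`.
  set y : ℝ := (d + 1) * 2 ^ (G + (H + 1) * J + 1) / a with hy
  have hy1 : 1 ≤ y := by
    rw [hy, le_div_iff₀ ha, one_mul]
    refine ha1.trans ?_
    have h1 : (1 : ℝ) ≤ 2 ^ (G + (H + 1) * J + 1) := one_le_pow₀ (by norm_num)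
    have h2 : (0 : ℝ) ≤ d := Nat.cast_nonneg d
    nlinarith
  set M : ℕ := ⌈y⌉₊ with hM
  have hMy : y ≤ M := Nat.le_ceil y
  have hM0 : 0 < M := Nat.ceil_pos.2 (by linarith)
  have hMy' : 2 * (M : ℝ) + 1 ≤ 10 * (d + 1) * 2 ^ (G + (H + 1) * J) / a := by
    have h1 : (M : ℝ) < y + 1 := Nat.ceil_lt_add_one (by linarith)
    have h2 : 10 * ((d : ℝ) + 1) * 2 ^ (G + (H + 1) * J) / a = 5 * y := by
      rw [hy, pow_succ]; ring
    rw [h2]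
    linarith
  have hMa : Module.finrank ℝ V * 2 ^ (G + 1 + o + H * J + 1) ≤ a * (M : ℝ) := by
    have h1 : y * a = (d + 1) * 2 ^ (G + (H + 1) * J + 1) := div_mul_cancel₀ _ ha.ne'
    have h2 : (2 : ℝ) ^ (G + 1 + o + H * J + 1) ≤ 2 ^ (G + (H + 1) * J + 1) := by
      refine pow_le_pow_right₀ (by norm_num) ?_
      have := o.2
      rw [add_mul]
      omega
    calc Module.finrank ℝ V * (2 : ℝ) ^ (G + 1 + o + H * J + 1)
        ≤ (d + 1) * 2 ^ (G + (H + 1) * J + 1) := by gcongr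
      _ = y * a := h1.symm
      _ ≤ a * M := by nlinarith
  have hcard : ((Fintype.card (Fin n × Fin s) : ℕ) : ℝ) = n * s := by simp
  have hsub : ∀ ξ : (Fin n × Fin s) × Bool →
      Option ((Fin (H + 1) × Fin (N * 2 ^ (G + J))) × Bool), (∃ v, sketchLoss (G + 1 + o) J (splitEntries n s (A.mulVec v)) ξ <
      (1 - 5 * a) * ∑ i, |A.mulVec v i|) →
      ∃ z ∈ V, sketchLoss (G + 1 + o) J z ξ < (1 - 5 * a) * ∑ i, |z i| := by
    rintro ξ ⟨v, hv⟩
    refine ⟨splitEntries n s (A.mulVec v), ⟨v, rfl⟩, ?_⟩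
    rwa [sum_abs_splitEntries hs]
  have hfin : (2 * (M : ℝ) + 1) ^ Module.finrank ℝ V *
      (Real.exp (-(a ^ 2 / (16 * γ))) + (H + 1) * Real.exp (-(2 / γ))) + η ≤
      (10 * (d + 1) * 2 ^ (G + (H + 1) * J) / a) ^ (d + 1) *
        (Real.exp (-(a ^ 2 / (16 * γ))) + (H + 1) * Real.exp (-(2 / γ))) + η := by
    refine add_le_add (mul_le_mul_of_nonneg_right ?_ (by positivity)) le_rfl
    refine (pow_le_pow_right₀ ?_ hrank).trans (pow_le_pow_left₀ (by positivity) hMy' _)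
    linarith [(Nat.cast_nonneg M : (0 : ℝ) ≤ M)]
  refine (hπ.pr_mono hsub).trans (le_trans ?_ hfin)
  -- If `s * γ ≥ 1`, all parts of a unit vector are at most `γ`, so nothing is heavy: the constant
  -- leverage `γ` works with `S = ∅`.
  rcases hcoll with hsγ | hcoll
  · refine pr_exists_sketchLoss_lt_le hN (by omega) hJ hB0 hBJ V hγ ha ha1 hNγ
      (by rw [hcard]; exact htiny) hM0 hMa (lev := fun _ => γ) (fun _ => hγ.le) ?_ ∅
      (fun i hi => absurd hi (lt_irrefl _)) ?_
    · rintro _ ⟨v, rfl⟩ hz i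
      have h1 : ∑ i, |A.mulVec v i| = 1 := by
        rw [← sum_abs_splitEntries hs]; exact hz
      have h2 := abs_le_sum_abs (A.mulVec v) i.1
      show |A.mulVec v i.1 / s| ≤ γ
      rw [abs_div, abs_of_pos hs', div_le_iff₀ hs']
      linarith
    · refine le_trans (le_of_eq ?_) hη
      refine pr_eq_zero _ fun ξ => ?_
      simp [ha.le]
  · obtain ⟨lev, hlev0, hlevs, hlev⟩ := exists_leverage V
    refine pr_exists_sketchLoss_lt_le hN (by omega) hJ hB0 hBJ V hγ ha ha1 hNγ
      (by rw [hcard]; exact htiny) hM0 hMa hlev0 hlev (Finset.univ.filter fun i => γ < lev i)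
      (fun i hi => Finset.mem_filter.2 ⟨Finset.mem_univ i, hi⟩)
      (le_trans (pr_sum_not_isolated_le hN (by omega) hJ hB0 hBJ hγ ha hlev0
        (hlevs.trans hrank')) (le_trans ?_ hcoll))
    gcongr ((d : ℝ) + 1) ^ 2 / (γ * N * ?_ * a)
    exact pow_le_pow_right₀ (by norm_num) (by omega)

/-- The sketch with a random offset, under explicit conditions on its parameters. -/
theorem exists_offset_sketch {d : ℕ} (hN : 0 < N) (hs : 0 < s) (hJ : 1 ≤ J)
    {γ a η l T x α ε P τ : ℝ} (hγ : 0 < γ) (ha : 0 < a) (ha1 : a ≤ 1)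
    (hNγ : 4 / (γ * a) ≤ N) (htiny : n * s * (γ / 2 ^ (H * J)) ≤ a) (hη : 0 ≤ η)
    (hcoll : 1 ≤ s * γ ∨ ((d : ℝ) + 1) ^ 2 / (γ * N * 2 ^ G * a) ≤ η)
    (hγJ : γ * J ^ 2 ≤ 1) (hT : 1 ≤ T) (hx : 0 < x) (hl : 0 < l)
    (hcon : 1 - ε ≤ l * (1 - 5 * a)) (hdil : l * (1 + x) ≤ α) (hτ : 2 * s + 1 ≤ τ)
    (hP : (10 * (d + 1) * 2 ^ (G + (H + 1) * J) / a) ^ (d + 1) *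
        (Real.exp (-(a ^ 2 / (16 * γ))) + (H + 1) * Real.exp (-(2 / γ))) + η +
      (2 / T + Real.logb 2 (32 * T * (N * ((H + 1) * J))) / J / x) ≤ P) :
    ∃ D : RandomSketch ((H + 1) * (N * 2 ^ (G + J))) n,
      (∀ ω, ComputableInOnePass (D.S ω) d τ) ∧ D.Succeeds d α ε P := by
  have hJ' : (0 : ℝ) < J := by exact_mod_cast hJ
  have hs' : (0 : ℝ) < s := by exact_mod_cast hs
  have hN' : (0 : ℝ) < N := by exact_mod_cast hN
  have hμ := offsetW_isProb (n := n) (s := s) (G := G) (H := H) hN hJ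
  refine ⟨finSketch hμ (fun ω => placementMatrix ω.2)
    (fun ω k => l * levelWeight (G + 1 + ω.1) J (finProdFinEquiv.symm k).1),
    fun ω => placementMatrix_computable hτ _, finSketch_succeeds _ _ _ fun X Y βs _ => ?_⟩
  set A := augment X Y with hA
  have hloss : ∀ β, l1Loss (fun _ => 1) A β =
      ∑ i, |A.mulVec (Sum.elim β fun _ => -1) i| := fun β => by simp [l1Loss]
  set z := A.mulVec (Sum.elim βs fun _ => -1) with hz
  refine le_trans (hμ.pr_mono (B := fun ω =>
    (∃ v, sketchLoss (G + 1 + ω.1) J (splitEntries n s (A.mulVec v)) ω.2 <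
        (1 - 5 * a) * ∑ i, |A.mulVec v i|) ∨
    (1 + x) * ∑ i, |z i| < sketchLoss (G + 1 + ω.1) J (splitEntries n s z) ω.2) ?_) ?_
  · intro ω hω
    by_contra hcon'
    push Not at hcon'
    obtain ⟨h1, h2⟩ := hcon'
    refine hω ⟨fun k => mul_pos hl (levelWeight_pos _ _ _), fun β _ => ?_, ?_,
      fun β hβ => absurd trivial hβ⟩
    · rw [l1Loss_placementMatrix, hloss]
      set y := A.mulVec (Sum.elim β fun _ => -1)
      have hy0 : 0 ≤ ∑ i, |y i| := Finset.sum_nonneg fun _ _ => abs_nonneg _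
      calc (1 - ε) * ∑ i, |y i| ≤ l * (1 - 5 * a) * ∑ i, |y i| := by gcongr
        _ = l * ((1 - 5 * a) * ∑ i, |y i|) := mul_assoc _ _ _
        _ ≤ _ := mul_le_mul_of_nonneg_left (h1 _) hl.le
    · rw [l1Loss_placementMatrix, hloss]
      have hy0 : 0 ≤ ∑ i, |z i| := Finset.sum_nonneg fun _ _ => abs_nonneg _
      calc _ ≤ l * ((1 + x) * ∑ i, |z i|) := mul_le_mul_of_nonneg_left h2 hl.le
        _ = l * (1 + x) * ∑ i, |z i| := by ring
        _ ≤ _ := by gcongr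
  refine le_trans ((hμ.pr_or_le _ _).trans (add_le_add ?_ ?_)) hP
  · rw [pr_offsetW, one_div, inv_mul_le_iff₀ hJ']
    refine (Finset.sum_le_sum fun o _ => pr_exists_contraction_le hN hs o hγ ha ha1 hNγ htiny hη
      hcoll A).trans (le_of_eq ?_)
    rw [Finset.sum_const, Finset.card_univ, Fintype.card_fin, nsmul_eq_mul]
  · rw [pr_offsetW, one_div, inv_mul_le_iff₀ hJ']
    -- A zero residual cannot be normalized, but its sketch vanishes as well.
    rcases (Finset.sum_nonneg fun i _ => abs_nonneg (z i) :
      0 ≤ ∑ i, |z i|).eq_or_lt with hz0 | hz0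
    · refine le_trans (Finset.sum_nonpos fun o _ => ?_) (mul_nonneg hJ'.le ?_)
      · have h0 : ∀ ξ : (Fin n × Fin s) × Bool → Option ((Fin (H + 1) ×
            Fin (N * 2 ^ (G + J))) × Bool),
            sketchLoss (G + 1 + o) J (splitEntries n s z) ξ ≤ 0 := fun ξ => by
          refine (sketchLoss_le_mul _ ξ).trans ?_
          rw [sum_abs_splitEntries hs, ← hz0]
          simp
        refine (pr_eq_zero _ fun ξ => ?_).le
        rw [← hz0, mul_zero]
        exact not_lt.2 (h0 ξ)
      · have h1 : 0 ≤ Real.logb 2 (32 * T * (N * ((H + 1) * J))) := by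
          refine Real.logb_nonneg (by norm_num) ?_
          have hN1 : (1 : ℝ) ≤ N := by exact_mod_cast hN
          have hJ1 : (1 : ℝ) ≤ J := by exact_mod_cast hJ
          have hH1 : (1 : ℝ) ≤ H + 1 := by linarith [(Nat.cast_nonneg H : (0 : ℝ) ≤ H)]
          have h2 : (1 : ℝ) ≤ (H + 1) * J := one_le_mul_of_one_le_of_one_le hH1 hJ1
          exact one_le_mul_of_one_le_of_one_le (by linarith)
            (one_le_mul_of_one_le_of_one_le hN1 h2)
        positivity
    · set y : Fin n × Fin s → ℝ := fun i => (∑ i, |z i|)⁻¹ * splitEntries n s z i with hy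
      have hc0 : 0 < (∑ i, |z i|)⁻¹ := inv_pos.2 hz0
      have hy1 : ∑ i, |y i| = 1 := by
        simp only [hy, abs_mul, abs_of_pos hc0]
        rw [← Finset.mul_sum, sum_abs_splitEntries hs, inv_mul_cancel₀ hz0.ne']
      have hNγ' : 1 / (2 * γ) ≤ (N : ℝ) := by
        refine le_trans ?_ hNγ
        rw [div_le_div_iff₀ (by positivity) (by positivity)]
        nlinarith
      have h := sum_pr_lt_sketchLoss_le (G := G) (H := H) hN hJ le_rfl hy1 hγ hγJ hNγ' hT hx
      rw [Finset.sum_range] at h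
      calc _ = ∑ o : Fin J, pr (placementW (Fin n × Fin s) N (G + 1 + o) J H (N * 2 ^ (G + J)))
            (fun ξ => 1 + x < sketchLoss (G + 1 + o) J y ξ) := by
            refine Finset.sum_congr rfl fun o _ => ?_
            congr 1
            funext ξ
            rw [hy, sketchLoss_smul, abs_of_pos hc0, lt_inv_mul_iff₀ hz0, mul_comm (1 + x)]
        _ ≤ _ := h
        _ = _ := by field_simp

end Core

/-! ### Choice of the parameters -/

theorem two_pow_le_exp (k : ℕ) : (2 : ℝ) ^ k ≤ Real.exp k := by
  rw [← mul_one (k : ℝ), Real.exp_nat_mul]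
  exact pow_le_pow_left₀ (by norm_num) (by linarith [Real.add_one_le_exp (1 : ℝ)]) k

/-- The failure probabilities of all points of the net add up to little. -/
theorem net_failure_le {d H J G : ℕ} {a γ L : ℝ} (hd : 1 ≤ d) (hJ : 1 ≤ J) (hL : 1 ≤ L)
    (ha : 0 < a) (ha1 : a ≤ 1) (hγ : γ = a ^ 2 / (2 ^ 29 * (d * L)))
    (hHJ : ((H : ℝ) + 1) * J ≤ 18 * L) (hG : 10 * (d + 1) * 2 ^ G / a ≤ Real.exp (2 * L)) :
    (10 * (d + 1) * 2 ^ (G + (H + 1) * J) / a) ^ (d + 1) *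
      (Real.exp (-(a ^ 2 / (16 * γ))) + (H + 1) * Real.exp (-(2 / γ))) ≤ Real.exp (-(2 * L)) := by
  have hd' : (1 : ℝ) ≤ d := by exact_mod_cast hd
  have hJ' : (1 : ℝ) ≤ J := by exact_mod_cast hJ
  have hdL : 1 ≤ d * L := one_le_mul_of_one_le_of_one_le hd' hL
  have hH : (H : ℝ) + 1 ≤ 18 * L := by
    refine le_trans ?_ hHJ
    exact le_mul_of_one_le_right (by positivity) hJ'
  have h1 : 10 * ((d : ℝ) + 1) * 2 ^ (G + (H + 1) * J) / a ≤ Real.exp (20 * L) := by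
    calc 10 * ((d : ℝ) + 1) * 2 ^ (G + (H + 1) * J) / a
        = (10 * (d + 1) * 2 ^ G / a) * 2 ^ ((H + 1) * J) := by rw [pow_add]; ring
      _ ≤ Real.exp (2 * L) * Real.exp (18 * L) := by
          refine mul_le_mul hG ((two_pow_le_exp _).trans (Real.exp_le_exp.2 ?_)) (by positivity)
            (by positivity)
          push_cast
          exact hHJ
      _ = Real.exp (20 * L) := by rw [← Real.exp_add]; ring_nf
  have h2 : (10 * ((d : ℝ) + 1) * 2 ^ (G + (H + 1) * J) / a) ^ (d + 1) ≤
      Real.exp (40 * (d * L)) := by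
    refine (pow_le_pow_left₀ (by positivity) h1 _).trans ?_
    rw [← Real.exp_nat_mul]
    refine Real.exp_le_exp.2 ?_
    push_cast
    nlinarith
  -- The constant `2 ^ 29` in `γ` puts the tail far below the inverse of the bound `exp (40 * d *
  -- L)` for the size of the net.
  have h3 : Real.exp (-(a ^ 2 / (16 * γ))) ≤ Real.exp (-(2 ^ 25 * (d * L))) := by
    refine Real.exp_le_exp.2 (neg_le_neg (le_of_eq ?_))
    rw [hγ]
    field_simp
    norm_num
  have h4 : Real.exp (-(2 / γ)) ≤ Real.exp (-(2 ^ 25 * (d * L))) := by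
    refine Real.exp_le_exp.2 (neg_le_neg ?_)
    rw [hγ, div_div_eq_mul_div, le_div_iff₀ (by positivity)]
    have : a ^ 2 ≤ 1 := pow_le_one₀ ha.le ha1
    nlinarith
  have h5 : 1 + ((H : ℝ) + 1) ≤ Real.exp (19 * L) := by
    have := Real.add_one_le_exp (19 * L)
    linarith
  calc _ ≤ Real.exp (40 * (d * L)) * (Real.exp (-(2 ^ 25 * (d * L))) +
        (H + 1) * Real.exp (-(2 ^ 25 * (d * L)))) := by gcongr
    _ = Real.exp (40 * (d * L)) * Real.exp (-(2 ^ 25 * (d * L))) * (1 + (H + 1)) := by ring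
    _ ≤ Real.exp (40 * (d * L)) * Real.exp (-(2 ^ 25 * (d * L))) * Real.exp (19 * L) := by
        gcongr
    _ ≤ _ := by
        rw [← Real.exp_add, ← Real.exp_add]
        refine Real.exp_le_exp.2 ?_
        nlinarith

/-- Because `2 / 3 < log 2`. -/
theorem logb_two_le {x : ℝ} (hx : 1 ≤ x) : Real.logb 2 x ≤ 3 / 2 * Real.log x := by
  have h := Real.log_two_gt_d9
  rw [Real.logb, div_le_iff₀ (by linarith)]
  nlinarith [Real.log_nonneg hx]

/-- The number of levels that are needed. -/
theorem exists_level_count {n J : ℕ} (hn : 2 ≤ n) (hJ : 1 ≤ J) (hJL : (J : ℝ) ≤ 7 * Real.log n) :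
    ∃ H : ℕ, (n : ℝ) ^ 2 ≤ 2 ^ (H * J) ∧ ((H : ℝ) + 1) * J ≤ 18 * Real.log n := by
  have hJ' : (0 : ℝ) < J := by exact_mod_cast hJ
  have hn' : (1 : ℝ) ≤ n := by exact_mod_cast (by omega : 1 ≤ n)
  have hlog := logb_two_le hn'
  have h0 : 0 ≤ Real.logb 2 n := Real.logb_nonneg (by norm_num) hn'
  -- The scale `2 ^ (H * J)` reaches `n ^ 2`, so that entries too small for every level have
  -- negligible total.
  refine ⟨⌈2 * Real.logb 2 n / J⌉₊, ?_, ?_⟩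
  · have h1 : 2 * Real.logb 2 n ≤ (⌈2 * Real.logb 2 n / J⌉₊ * J : ℕ) := by
      push_cast
      rw [← div_le_iff₀ hJ']
      exact Nat.le_ceil _
    rw [← Real.rpow_natCast 2 (_ * J)]
    calc (n : ℝ) ^ 2 = 2 ^ (2 * Real.logb 2 n) := by
          rw [mul_comm, Real.rpow_mul (by norm_num), Real.rpow_logb (by norm_num) (by norm_num)
            (by linarith)]
          norm_num
      _ ≤ _ := Real.rpow_le_rpow_of_exponent_le (by norm_num) h1
  · have h1 : ((⌈2 * Real.logb 2 n / J⌉₊ : ℕ) : ℝ) < 2 * Real.logb 2 n / J + 1 :=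
      Nat.ceil_lt_add_one (by positivity)
    have h2 : 2 * Real.logb 2 n / J * J = 2 * Real.logb 2 n := div_mul_cancel₀ _ hJ'.ne'
    nlinarith

/-- The random-offset sketch after choosing the numbers of levels and of buckets. -/
theorem exists_sketch_of_logb_le {n d G J s : ℕ} {a γ η l T x α ε p P τ : ℝ} (hn : 2 ≤ n)
    (hd : 1 ≤ d) (hL : 1 ≤ Real.log n) (ha : 0 < a) (ha1 : a ≤ 1)
    (hγ : γ = a ^ 2 / (2 ^ 29 * (d * Real.log n))) (hJ : 1 ≤ J)
    (hJL : (J : ℝ) ≤ 7 * Real.log n) (hs : 0 < s) (hsγ : s * γ ≤ 2) (hna : 2 ≤ a * n)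
    (hG : 10 * (d + 1) * 2 ^ G / a ≤ Real.exp (2 * Real.log n)) (hη : 0 ≤ η)
    (hcoll : 1 ≤ s * γ ∨ ((d : ℝ) + 1) ^ 2 / (4 * 2 ^ G) ≤ η) (hγJ : γ * J ^ 2 ≤ 1)
    (hT : 1 ≤ T) (hx : 0 < x) (hl : 0 < l) (hcon : 1 - ε ≤ l * (1 - 5 * a))
    (hdil : l * (1 + x) ≤ α) (hτ : 2 * s + 1 ≤ τ)
    (hp : Real.logb 2 (32 * T * (8 / (γ * a) * (18 * Real.log n))) / J / x ≤ p)
    (hP : Real.exp (-(2 * Real.log n)) + η + (2 / T + p) ≤ P) :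
    ∃ r : ℕ, (r : ℝ) ≤ 18 * Real.log n * (8 / (γ * a) * 2 ^ (G + J)) ∧
      ∃ D : RandomSketch r n,
        (∀ ω, ComputableInOnePass (D.S ω) d τ) ∧ D.Succeeds d α ε P := by
  obtain ⟨H, hH1, hH2⟩ := exists_level_count hn hJ hJL
  have hd' : (1 : ℝ) ≤ d := by exact_mod_cast hd
  have hJ' : (1 : ℝ) ≤ J := by exact_mod_cast hJ
  have hn' : (2 : ℝ) ≤ n := by exact_mod_cast hn
  have hdL : 1 ≤ d * Real.log n := one_le_mul_of_one_le_of_one_le hd' hL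
  have hγ0 : 0 < γ := by rw [hγ]; positivity
  have hγ1 : γ ≤ 1 := by
    rw [hγ, div_le_one (by positivity)]
    have : a ^ 2 ≤ 1 := pow_le_one₀ ha.le ha1
    nlinarith
  have hγa : γ * a ≤ 1 := mul_le_one₀ hγ1 ha.le ha1
  set N : ℕ := ⌈4 / (γ * a)⌉₊ with hN
  have hN1 : 4 / (γ * a) ≤ N := Nat.le_ceil _
  have hN0 : 0 < N := Nat.ceil_pos.2 (by positivity)
  have hN2 : (N : ℝ) ≤ 8 / (γ * a) := by
    have h1 : (N : ℝ) < 4 / (γ * a) + 1 := Nat.ceil_lt_add_one (by positivity)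
    have h2 : 1 ≤ 4 / (γ * a) := by
      rw [le_div_iff₀ (by positivity)]; linarith
    have h3 : 8 / (γ * a) = 4 / (γ * a) + 4 / (γ * a) := by ring
    linarith
  have hH3 : (H : ℝ) + 1 ≤ 18 * Real.log n :=
    (le_mul_of_one_le_right (by positivity) hJ').trans hH2
  refine ⟨(H + 1) * (N * 2 ^ (G + J)), ?_, exists_offset_sketch (N := N) (H := H) hN0 hs hJ hγ0 ha
    ha1 hN1 ?_ hη ?_ hγJ hT hx hl hcon hdil hτ (le_trans ?_ hP)⟩
  · push_cast
    gcongr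
  · calc (n : ℝ) * s * (γ / 2 ^ (H * J)) = n * (s * γ) / 2 ^ (H * J) := by ring
      _ ≤ n * 2 / n ^ 2 := by gcongr
      _ = 2 / n := by field_simp
      _ ≤ a := by rwa [div_le_iff₀ (by linarith)]
  · refine hcoll.imp id fun h => le_trans ?_ h
    have h1 : 4 ≤ γ * N * a := by
      rw [div_le_iff₀ (by positivity)] at hN1
      linarith
    refine div_le_div_of_nonneg_left (by positivity) (by positivity) ?_
    nlinarith [pow_pos (two_pos : (0 : ℝ) < 2) G]
  · refine add_le_add (add_le_add (net_failure_le hd hJ hL ha ha1 hγ hH2 hG) le_rfl)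
      (add_le_add le_rfl (le_trans ?_ hp))
    refine div_le_div_of_nonneg_right (div_le_div_of_nonneg_right ?_ (by positivity)) hx.le
    refine Real.logb_le_logb_of_le (by norm_num) (by positivity) ?_
    gcongr

/-- `log z` is four times the logarithm of the fourth root of `z`, which is at most that root. -/
theorem log_sq_le_sqrt {z : ℝ} (hz : 1 ≤ z) : Real.log z ^ 2 ≤ 16 * √z := by
  have h1 : Real.log z = 4 * Real.log √√z := by
    rw [Real.log_sqrt (Real.sqrt_nonneg z), Real.log_sqrt (by linarith)]; ring
  have h2 : 1 ≤ √√z := Real.one_le_sqrt.2 (Real.one_le_sqrt.2 hz)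
  have h3 : Real.log √√z ≤ √√z := (Real.log_le_sub_one_of_pos (by linarith)).trans (by linarith)
  have h4 := Real.log_nonneg h2
  have h5 : √√z ^ 2 = √z := Real.sq_sqrt (Real.sqrt_nonneg z)
  have h6 : Real.log √√z ^ 2 ≤ √√z ^ 2 := pow_le_pow_left₀ h4 h3 2
  rw [h1]
  linarith

theorem half_le_log {n : ℕ} (hn : 2 ≤ n) : 1 / 2 ≤ Real.log n := by
  have h1 := Real.log_two_gt_d9
  have h2 : Real.log 2 ≤ Real.log n := Real.log_le_log two_pos (by exact_mod_cast hn)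
  linarith

theorem log_le_self_of_two_le {n : ℕ} (hn : 2 ≤ n) : Real.log n ≤ n := by
  have : (0 : ℝ) < n := by positivity
  linarith [Real.log_le_sub_one_of_pos this]

/-! ### Constant factor with update time `O(d log n)` -/

section LogFactorUpdateTime

variable {c ε : ℝ}

set_option maxHeartbeats 2000000 in
/-- Large data, `O(d log n)` update time. -/
theorem exists_constant_factor_sketch (hc : 0 < c) (hc1 : c ≤ 1) {a : ℝ} (ha : 0 < a)
    (ha1 : a ≤ 1 / 16) {n d : ℕ} (hn : 2 ≤ n) (hd : 1 ≤ d) (hnC : 2 ^ 44 / a ^ 4 ≤ (n : ℝ))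
    (hdn : d ≤ n) :
    ∃ r : ℕ, (r : ℝ) ≤ 2 ^ 38 / a ^ 3 * (2 ^ 44 / a ^ 4) *
        ((d : ℝ) ^ (1 + c) * Real.log n ^ (3 + 5 * c)) ∧
      ∃ D : RandomSketch r n,
        (∀ ω, ComputableInOnePass (D.S ω) d (2 ^ 32 / a ^ 2 * (d * Real.log n))) ∧
        D.Succeeds d (1 + 1 / c) (16 * a) (1 - 4 * a) := by
  have hd' : (1 : ℝ) ≤ d := by exact_mod_cast hd
  have hdn' : (d : ℝ) ≤ n := by exact_mod_cast hdn
  have hn0 : (0 : ℝ) < n := by positivity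
  set C : ℝ := 2 ^ 44 / a ^ 4 with hC
  have ha2 : a ^ 2 ≤ 1 := pow_le_one₀ ha.le (by linarith)
  have ha3 : a ^ 3 ≤ 1 := pow_le_one₀ ha.le (by linarith)
  have hCa : 2 ^ 44 / a ≤ C := by
    rw [hC]
    refine div_le_div_of_nonneg_left (by positivity) (by positivity) ?_
    calc a ^ 4 = a ^ 3 * a := by ring
      _ ≤ a := mul_le_of_le_one_left ha.le ha3
  have hC1 : 2 ^ 44 ≤ C := by
    refine le_trans ?_ hCa
    rw [le_div_iff₀ ha]
    linarith
  set L := Real.log n with hL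
  have hL1 : 1 ≤ L := by
    rw [hL, Real.le_log_iff_exp_le hn0]
    have := Real.exp_one_lt_three
    linarith
  have hLn : L ≤ n := log_le_self_of_two_le hn
  have hdL : 1 ≤ d * L := one_le_mul_of_one_le_of_one_le hd' hL1
  have hexp : Real.exp L = n := Real.exp_log hn0
  set γ : ℝ := a ^ 2 / (2 ^ 29 * (d * L)) with hγ
  have hγ0 : 0 < γ := by positivity
  have hγ1 : γ ≤ 1 := by
    rw [hγ, div_le_one (by positivity)]
    linarith
  -- With at least `1 / γ` parts no entry is heavy; the update time `O(d log n)` pays for this.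
  set s : ℕ := ⌈1 / γ⌉₊ with hs
  have hs1 : 1 / γ ≤ s := Nat.le_ceil _
  have hs0 : 0 < s := Nat.ceil_pos.2 (by positivity)
  have hs2 : (s : ℝ) ≤ 2 / γ := by
    have h1 : (s : ℝ) < 1 / γ + 1 := Nat.ceil_lt_add_one (by positivity)
    have h2 : 1 ≤ 1 / γ := by rw [le_div_iff₀ hγ0]; linarith
    have h3 : 2 / γ = 1 / γ + 1 / γ := by ring
    linarith
  -- An upper bound for the argument of the logarithm in the dilation estimate. Then `J = ⌈c * log₂
  -- y⌉` makes the logarithm over `J` at most `1 / c`, while `2 ^ J ≤ 2 * y ^ c`.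
  set y : ℝ := C * (d * L ^ 2) with hy
  have hCy : C ≤ y := by
    rw [hy]
    exact le_mul_of_one_le_right (by positivity)
      (one_le_mul_of_one_le_of_one_le hd' (one_le_pow₀ hL1))
  have hy1 : 1 < y := by linarith
  have hy0 : 0 < y := by linarith
  have hlogy : 0 < Real.logb 2 y := Real.logb_pos (by norm_num) hy1
  set J : ℕ := ⌈c * Real.logb 2 y⌉₊ with hJ
  have hJ1 : c * Real.logb 2 y ≤ J := Nat.le_ceil _
  have hJ0 : 1 ≤ J := Nat.ceil_pos.2 (by positivity)
  have hJ0' : (1 : ℝ) ≤ J := by exact_mod_cast hJ0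
  have hJ2 : (J : ℝ) ≤ c * Real.logb 2 y + 1 := (Nat.ceil_lt_add_one (by positivity)).le
  have hJ3 : (J : ℝ) ≤ Real.logb 2 y + 1 := by
    linarith [mul_le_of_le_one_left hlogy.le hc1]
  have hJL : (J : ℝ) ≤ 7 * L := by
    have h1 : Real.logb 2 y ≤ 3 / 2 * Real.log y := logb_two_le hy1.le
    have h2 : Real.log y ≤ 4 * L := by
      rw [hL, ← Real.log_rpow hn0]
      refine Real.log_le_log hy0 ?_
      calc y ≤ n * (n * n ^ 2) := by rw [hy]; gcongr
        _ = (n : ℝ) ^ (4 : ℝ) := by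
          rw [show (4 : ℝ) = ((4 : ℕ) : ℝ) by norm_num, Real.rpow_natCast]; ring
    linarith
  have hγJ : γ * J ^ 2 ≤ 1 := by
    have h1 : Real.logb 2 y + 1 = Real.logb 2 (2 * y) := by
      rw [Real.logb_mul (by norm_num) hy0.ne', Real.logb_self_eq_one (by norm_num)]; ring
    have h2 : (J : ℝ) ≤ 3 / 2 * Real.log (2 * y) := by
      rw [h1] at hJ3
      exact hJ3.trans (logb_two_le (by linarith))
    have h3 : Real.log (2 * y) ^ 2 ≤ 16 * √(2 * y) := log_sq_le_sqrt (by linarith)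
    have h4 : √(2 * y) ≤ 2 ^ 23 / a ^ 2 * (d * L) := by
      refine Real.sqrt_le_iff.2 ⟨by positivity, ?_⟩
      have : (d : ℝ) ≤ d ^ 2 := le_self_pow₀ hd' two_ne_zero
      calc 2 * y = 2 ^ 45 / a ^ 4 * (d * L ^ 2) := by rw [hy, hC]; ring
        _ ≤ 2 ^ 46 / a ^ 4 * (d ^ 2 * L ^ 2) := by gcongr <;> norm_num
        _ = _ := by field_simp
    have h5 : (J : ℝ) ^ 2 ≤ (3 / 2 * Real.log (2 * y)) ^ 2 :=
      pow_le_pow_left₀ (by positivity) h2 2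
    have h6 : (J : ℝ) ^ 2 ≤ 2 ^ 29 * (d * L) / a ^ 2 := by
      have : 2 ^ 29 * (d * L) / a ^ 2 = 64 * (2 ^ 23 / a ^ 2 * (d * L)) := by ring
      have h7 : 0 ≤ 2 ^ 23 / a ^ 2 * (d * L) := by positivity
      rw [mul_pow] at h5
      rw [this]
      linarith
    calc γ * J ^ 2 ≤ γ * (2 ^ 29 * (d * L) / a ^ 2) := by gcongr
      _ = 1 := by rw [hγ]; field_simp
  -- `l * (1 - 5 * a) ≥ 1 - 16 * a`, and `x` below solves `l * (1 + x) = 1 + 1 / c`. Markov's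
  -- inequality then gives at most `(1 / c) / x ≤ l`, which stays away from one.
  set l : ℝ := 1 - 8 * a with hl
  have hl0 : 0 < l := by rw [hl]; linarith
  set x : ℝ := (1 / c + 8 * a) / l with hx
  have hx0 : 0 < x := by positivity
  have hG : 10 * ((d : ℝ) + 1) * 2 ^ 0 / a ≤ Real.exp (2 * L) := by
    have h1 : Real.exp (2 * L) = n * n := by
      rw [two_mul, Real.exp_add, hexp]
    rw [h1, pow_zero, mul_one]
    calc 10 * ((d : ℝ) + 1) / a ≤ 10 * (d + d) / a := by gcongr
      _ = 20 / a * d := by ring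
      _ ≤ n * n := by
        refine mul_le_mul (le_trans ?_ (hCa.trans hnC)) hdn' (by positivity) hn0.le
        gcongr
        norm_num
  have hna : 2 ≤ a * n := by
    have := hCa.trans hnC
    rw [div_le_iff₀ ha] at this
    linarith
  have hp : Real.logb 2 (32 * (4 / a) * (8 / (γ * a) * (18 * L))) / J / x ≤ l := by
    have h1 : 32 * (4 / a) * (8 / (γ * a) * (18 * L)) ≤ y := by
      have : 32 * (4 / a) * (8 / (γ * a) * (18 * L)) = 18432 * 2 ^ 29 / a ^ 4 * (d * L ^ 2) := by
        rw [hγ]; field_simp; norm_num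
      rw [this, hy, hC]
      gcongr
      norm_num
    have h2 : Real.logb 2 (32 * (4 / a) * (8 / (γ * a) * (18 * L))) ≤ Real.logb 2 y :=
      Real.logb_le_logb_of_le (by norm_num) (by positivity) h1
    have h3 : Real.logb 2 (32 * (4 / a) * (8 / (γ * a) * (18 * L))) / J ≤ 1 / c := by
      rw [div_le_div_iff₀ (by linarith) hc]
      have := mul_le_mul_of_nonneg_right h2 hc.le
      linarith
    rw [div_le_iff₀ hx0]
    refine h3.trans ?_
    rw [hx, mul_div_cancel₀ _ hl0.ne']
    linarith
  have hP : Real.exp (-(2 * L)) + 0 + (2 / (4 / a) + l) ≤ 1 - 4 * a := by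
    have h1 : Real.exp (-(2 * L)) ≤ 1 / n := by
      rw [← hexp, one_div, ← Real.exp_neg]
      exact Real.exp_le_exp.2 (by linarith)
    have h2 : 1 / (n : ℝ) ≤ a / 2 := by
      rw [div_le_div_iff₀ hn0 two_pos]; linarith
    have h3 : 2 / (4 / a) = a / 2 := by field_simp; norm_num
    rw [h3, hl]
    linarith
  obtain ⟨r, hr, D, hD1, hD2⟩ := exists_sketch_of_logb_le (G := 0) (η := 0) (T := 4 / a) (x := x)
    (l := l) (α := 1 + 1 / c) (ε := 16 * a) (P := 1 - 4 * a)
    (τ := 2 ^ 32 / a ^ 2 * (d * L)) hn hd hL1 ha (by linarith) hγ hJ0 hJL hs0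
    (by
      have := mul_le_mul_of_nonneg_right hs2 hγ0.le
      rwa [div_mul_cancel₀ _ hγ0.ne'] at this) hna hG le_rfl
    (Or.inl (by rwa [div_le_iff₀ hγ0] at hs1)) hγJ
    (by rw [le_div_iff₀ ha]; linarith) hx0 hl0
    (by linarith [show l * (1 - 5 * a) = 1 - 13 * a + 40 * a ^ 2 by rw [hl]; ring, sq_nonneg a])
    (le_of_eq (by rw [mul_add, hx, mul_div_cancel₀ _ hl0.ne', hl]; ring))
    (by
      have h1 : 2 / γ = 2 ^ 30 / a ^ 2 * (d * L) := by rw [hγ]; field_simp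
      have h2 : 1 ≤ 2 ^ 30 / a ^ 2 * (d * L) := by
        refine one_le_mul_of_one_le_of_one_le ?_ hdL
        rw [le_div_iff₀ (by positivity)]
        linarith
      have h3 : 2 ^ 32 / a ^ 2 * (d * L) = 4 * (2 ^ 30 / a ^ 2 * (d * L)) := by ring
      linarith) hp hP
  refine ⟨r, hr.trans ?_, D, hD1, hD2⟩
  have hJpow : (2 : ℝ) ^ (0 + J) ≤ 2 * (C * (d ^ c * L ^ (2 * c))) := by
    rw [zero_add, ← Real.rpow_natCast]
    calc (2 : ℝ) ^ (J : ℝ) ≤ 2 ^ (Real.logb 2 y * c + 1) :=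
          Real.rpow_le_rpow_of_exponent_le (by norm_num) (by linarith)
      _ = 2 * y ^ c := by
          rw [Real.rpow_add_one (by norm_num), Real.rpow_mul (by norm_num),
            Real.rpow_logb (by norm_num) (by norm_num) hy0]
          ring
      _ = 2 * (C ^ c * (d ^ c * L ^ (2 * c))) := by
          rw [hy, Real.mul_rpow (by positivity) (by positivity),
            Real.mul_rpow (by positivity) (by positivity), ← Real.rpow_natCast L 2,
            ← Real.rpow_mul (by positivity)]
          norm_num
      _ ≤ 2 * (C * (d ^ c * L ^ (2 * c))) := by
          gcongr
          exact Real.rpow_le_self_of_one_le (by linarith) hc1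
  calc 18 * L * (8 / (γ * a) * 2 ^ (0 + J))
      ≤ 18 * L * (8 / (γ * a) * (2 * (C * (d ^ c * L ^ (2 * c))))) := by gcongr
    _ = 288 * 2 ^ 29 / a ^ 3 * C * ((d * d ^ c) * (L ^ 2 * L ^ (2 * c))) := by
        rw [hγ]; field_simp; norm_num
    _ = 288 * 2 ^ 29 / a ^ 3 * C * (d ^ (1 + c) * L ^ (2 + 2 * c)) := by
        rw [Real.rpow_add (by linarith), Real.rpow_add (by linarith), Real.rpow_one]
        norm_num
    _ ≤ 2 ^ 38 / a ^ 3 * C * (d ^ (1 + c) * L ^ (3 + 5 * c)) := by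
        gcongr <;> first | exact hL1 | norm_num

/-- Only large `n ≥ d` need the random sketch. For `n` below the constant `C` or below `d` the bound
on `r` admits the data themselves, and for `ε ≥ 1` the empty sketch will do. -/
theorem exists_log_update_time_sketch (hc : 0 < c) (hc1 : c ≤ 1) (hε : 0 < ε) :
    ∃ K P : ℝ, P < 1 ∧ ∀ n d : ℕ, 2 ≤ n → 1 ≤ d →
      ∃ r : ℕ, (r : ℝ) ≤ K * ((d : ℝ) ^ (1 + c) * Real.log n ^ (3 + 5 * c)) ∧
        ∃ D : RandomSketch r n,
          (∀ ω, ComputableInOnePass (D.S ω) d (K * (d * Real.log n))) ∧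
          D.Succeeds d (1 + 1 / c) ε P := by
  have hα : 1 ≤ 1 + 1 / c := by linarith [one_div_pos.2 hc]
  rcases le_or_gt 1 ε with hε1 | hε1
  · refine ⟨2, 0, one_pos, fun n d hn hd => ⟨0, ?_, ?_⟩⟩
    · have := half_le_log hn
      rw [Nat.cast_zero]
      have : 0 ≤ Real.log n := by linarith
      positivity
    · refine exists_empty_sketch n ?_ (by linarith) le_rfl (Or.inl hε1)
      have hd' : (1 : ℝ) ≤ d := by exact_mod_cast hd
      nlinarith [half_le_log hn]
  · obtain ⟨a, rfl⟩ : ∃ a, ε = 16 * a := ⟨ε / 16, by ring⟩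
    have ha : 0 < a := by linarith
    have ha1 : a ≤ 1 / 16 := by linarith
    have ha2 : a ^ 2 ≤ 1 := pow_le_one₀ ha.le (by linarith)
    have hinv : 1 ≤ 1 / a := by rw [le_div_iff₀ ha]; linarith
    set C : ℝ := 2 ^ 44 / a ^ 4 with hC
    have hC1 : 1 ≤ C := by
      rw [hC, le_div_iff₀ (by positivity)]
      linarith [pow_le_one₀ ha.le (by linarith : a ≤ 1) (n := 4)]
    set K : ℝ := 2 ^ 38 / a ^ 3 * C with hK
    have hK0 : 2 ^ 38 ≤ 2 ^ 38 / a ^ 3 := by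
      rw [le_div_iff₀ (by positivity)]
      linarith [pow_le_one₀ ha.le (by linarith : a ≤ 1) (n := 3)]
    have hKC : 2 ^ 38 * C ≤ K := mul_le_mul_of_nonneg_right hK0 (by linarith)
    have hKτ : 2 ^ 32 / a ^ 2 ≤ K := by
      have h1 : 2 ^ 32 / a ^ 2 ≤ 2 ^ 38 / a ^ 3 := by
        rw [div_le_div_iff₀ (by positivity) (by positivity)]
        nlinarith [pow_pos ha 2]
      exact h1.trans (le_mul_of_one_le_right (by positivity) hC1)
    refine ⟨K, 1 - 4 * a, by linarith, fun n d hn hd => ?_⟩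
    have hd' : (1 : ℝ) ≤ d := by exact_mod_cast hd
    have hlog := half_le_log hn
    have hτ : 2 ≤ K * (d * Real.log n) := by
      have h1 : (1 / 2 : ℝ) ≤ d * Real.log n := by nlinarith
      nlinarith
    have hident : (n : ℝ) ≤ K * ((d : ℝ) ^ (1 + c) * Real.log n ^ (3 + 5 * c)) →
        ∃ r : ℕ, (r : ℝ) ≤ K * ((d : ℝ) ^ (1 + c) * Real.log n ^ (3 + 5 * c)) ∧
        ∃ D : RandomSketch r n,
          (∀ ω, ComputableInOnePass (D.S ω) d (K * (d * Real.log n))) ∧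
          D.Succeeds d (1 + 1 / c) (16 * a) (1 - 4 * a) := fun h =>
      ⟨n, h, exists_identity_sketch n hτ hα (by linarith) (by linarith)⟩
    have hdc : (d : ℝ) ≤ d ^ (1 + c) := Real.self_le_rpow_of_one_le hd' (by linarith)
    rcases lt_or_ge (n : ℝ) C with hnC | hnC
    · refine hident ?_
      have h1 : (1 / 2 : ℝ) ^ (8 : ℝ) ≤ Real.log n ^ (3 + 5 * c) :=
        (Real.rpow_le_rpow_of_exponent_ge (by norm_num) (by norm_num) (by linarith)).trans
          (Real.rpow_le_rpow (by norm_num) hlog (by linarith))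
      have h2 : (1 / 2 : ℝ) ^ (8 : ℝ) = 1 / 256 := by
        rw [show (8 : ℝ) = ((8 : ℕ) : ℝ) by norm_num, Real.rpow_natCast]; norm_num
      rw [h2] at h1
      have h3 : (1 / 256 : ℝ) ≤ d ^ (1 + c) * Real.log n ^ (3 + 5 * c) := by nlinarith
      nlinarith
    · rcases lt_or_ge n d with hnd | hnd
      · refine hident ?_
        have hL1 : 1 ≤ Real.log n := by
          rw [Real.le_log_iff_exp_le (by linarith)]
          have h1 := Real.exp_one_lt_three
          have h2 : 2 ^ 44 ≤ C := by
            rw [hC, le_div_iff₀ (by positivity)]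
            linarith [pow_le_one₀ ha.le (by linarith : a ≤ 1) (n := 4)]
          linarith
        have h1 : 1 ≤ Real.log n ^ (3 + 5 * c) := Real.one_le_rpow hL1 (by linarith)
        have h2 : (n : ℝ) ≤ d := by exact_mod_cast hnd.le
        have h3 : (n : ℝ) ≤ d ^ (1 + c) * Real.log n ^ (3 + 5 * c) :=
          (h2.trans hdc).trans (le_mul_of_one_le_right (by positivity) h1)
        nlinarith
      · obtain ⟨r, hr, D, hD1, hD2⟩ :=
          exists_constant_factor_sketch hc hc1 ha ha1 hn hd hnC hnd
        exact ⟨r, hr, D, fun ω => (hD1 ω).mono (by gcongr), hD2⟩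

end LogFactorUpdateTime

/-! ### Factor `1 + a * ε` with constant update time -/

section ConstantUpdateTime

set_option maxHeartbeats 2000000 in
/-- Large data, `O(1)` update time. -/
theorem exists_one_add_eps_sketch {ε δ a : ℝ} (hε : 0 < ε) (hε1 : ε < 1) (hδ : 0 < δ)
    (hδ1 : δ ≤ 1) (ha : 1 < a) {n d : ℕ} (hn : 2 ≤ n) (hd : 1 ≤ d)
    (hL0 : 2 ^ 17 ≤ Real.log (Real.log n)) (hdδ : (d : ℝ) ^ 4 / δ ≤ n)
    (hnB : (64 * d * Real.log n ^ 5 / (ε ^ 6 * δ)) ^ (1 + ε⁻¹) ≤ n) :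
    ∃ r : ℕ, (r : ℝ) ≤ 32 * d * Real.log n ^ 3 / ε ^ 5 *
        (64 * d * Real.log n ^ 5 / (ε ^ 6 * δ)) ^ (1 + ε⁻¹) ∧
      ∃ D : RandomSketch r n,
        (∀ ω, ComputableInOnePass (D.S ω) d 3) ∧
        D.Succeeds d (1 + a * ε) ε (δ + 1 / a) := by
  have hd' : (1 : ℝ) ≤ d := by exact_mod_cast hd
  have hn0 : (0 : ℝ) < n := by positivity
  have hLn : Real.log n ≤ n := log_le_self_of_two_le hn
  have hLpos : 0 < Real.log n := by linarith [half_le_log hn]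
  have hexp : Real.exp (Real.log n) = n := Real.exp_log hn0
  set L := Real.log n with hL
  set m := Real.log L with hm
  have hmL : m ≤ L := by linarith [Real.log_le_sub_one_of_pos hLpos]
  have hm0 : 0 < m := by linarith
  have hL1 : 1 ≤ L := by linarith
  have hdL : 1 ≤ d * L := one_le_mul_of_one_le_of_one_le hd' hL1
  set B : ℝ := 64 * d * L ^ 5 / (ε ^ 6 * δ) with hB
  have hε6 : ε ^ 6 ≤ 1 := pow_le_one₀ hε.le hε1.le
  have hBL : L ^ 5 ≤ B := by
    rw [hB, le_div_iff₀ (by positivity)]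
    have h1 : ε ^ 6 * δ ≤ 1 := mul_le_one₀ hε6 hδ.le hδ1
    have h2 : 0 < L ^ 5 := by positivity
    calc L ^ 5 * (ε ^ 6 * δ) ≤ L ^ 5 * 1 := by gcongr
      _ ≤ 64 * 1 * L ^ 5 := by linarith
      _ ≤ 64 * d * L ^ 5 := by gcongr
  have hB1 : 1 < B := by
    have h1 : L ≤ L ^ 5 := le_self_pow₀ hL1 (by norm_num)
    linarith
  have hB0 : 0 < B := by linarith
  have hlogB0 : 0 < Real.log B := Real.log_pos hB1
  have hmB : 5 * m ≤ Real.log B := by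
    have := Real.log_le_log (by positivity) hBL
    rwa [Real.log_pow, Nat.cast_ofNat] at this
  have hBε : Real.log B ≤ ε * L := by
    have h1 := Real.log_le_log (by positivity) hnB
    rw [Real.log_rpow hB0] at h1
    have h2 : ε⁻¹ * Real.log B ≤ L := by linarith
    rwa [inv_mul_le_iff₀ hε] at h2
  -- The accuracy of the contraction. It is small enough for `B ^ (5 * e / ε) ≤ L`, while `1 / e ≤
  -- L` keeps the number of buckets polynomial in `log n`.
  set e : ℝ := m / (8 * L) with he
  have he0 : 0 < e := by positivity
  have heL : e * L = m / 8 := by rw [he]; field_simp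
  have he5 : 5 * e ≤ ε / 8 := by
    have : 5 * e * L ≤ ε / 8 * L := by linarith
    exact le_of_mul_le_mul_right this hLpos
  have he1 : e ≤ 1 := by linarith
  set γ : ℝ := e ^ 2 / (2 ^ 29 * (d * L)) with hγ
  have hγ0 : 0 < γ := by positivity
  have hγ1 : γ ≤ 1 := by
    rw [hγ, div_le_one (by positivity)]
    have := pow_le_one₀ (n := 2) he0.le he1
    linarith
  have hγe : 8 / (γ * e) = 2 ^ 41 * (d * L ^ 4) / m ^ 3 := by
    rw [hγ, he]; field_simp; norm_num
  -- All of the permitted contraction `ε` goes into the scaling, except for the `5 * e` lost by the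
  -- sketch.
  set l : ℝ := 1 - ε + 5 * e with hl
  have hl0 : 0 < l := by linarith
  have hl1 : l ≤ 1 := by linarith
  -- `2 ^ G` exceeds `4 * d ^ 2 / δ ≥ (d + 1) ^ 2 / δ`, so that the collisions of heavy entries cost
  -- probability at most `δ / 4`.
  obtain ⟨G', hG1, hG2⟩ := exists_nat_pow_near (x := 4 * (d : ℝ) ^ 2 / δ) (y := 2)
    (by rw [le_div_iff₀ hδ]; linarith [one_le_pow₀ hd' (n := 2)]) one_lt_two
  set G := G' + 1 with hG
  have hG3 : (2 : ℝ) ^ G ≤ 8 * d ^ 2 / δ := by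
    have : 8 * (d : ℝ) ^ 2 / δ = 2 * (4 * d ^ 2 / δ) := by ring
    rw [this, hG, pow_succ]
    linarith
  have hlogB : 0 < Real.logb 2 B := Real.logb_pos (by norm_num) hB1
  -- Chosen so that the logarithm in the dilation estimate, divided by `J`, is at most `ε / l`.
  set J : ℕ := ⌈l * Real.logb 2 B / ε⌉₊ with hJ
  have hJ1 : l * Real.logb 2 B / ε ≤ J := Nat.le_ceil _
  have hJ0 : 1 ≤ J := Nat.ceil_pos.2 (by positivity)
  have hJ0' : (1 : ℝ) ≤ J := by exact_mod_cast hJ0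
  have hJ2 : (J : ℝ) ≤ l * Real.logb 2 B / ε + 1 := (Nat.ceil_lt_add_one (by positivity)).le
  have hJL' : (J : ℝ) ≤ 5 / 2 * L := by
    have h1 : Real.logb 2 B ≤ 3 / 2 * Real.log B := logb_two_le hB1.le
    have h2 : l * Real.logb 2 B / ε ≤ 3 / 2 * L := by
      rw [div_le_iff₀ hε]
      calc l * Real.logb 2 B ≤ 1 * Real.logb 2 B := by gcongr
        _ ≤ _ := by linarith
    linarith
  have hγJ : γ * J ^ 2 ≤ 1 := by
    have h1 : m ^ 2 ≤ 16 * √L := log_sq_le_sqrt hL1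
    have h2 : √L ≤ L := Real.sqrt_le_iff.2 ⟨hLpos.le, le_self_pow₀ hL1 two_ne_zero⟩
    have h3 : (J : ℝ) ^ 2 ≤ (5 / 2 * L) ^ 2 := pow_le_pow_left₀ (by positivity) hJL' 2
    calc γ * J ^ 2 ≤ γ * (5 / 2 * L) ^ 2 := by gcongr
      _ = (25 / 256) * m ^ 2 / (2 ^ 29 * (d * L)) := by rw [hγ, he]; field_simp; norm_num
      _ ≤ 1 := by
        rw [div_le_one (by positivity)]
        linarith [le_mul_of_one_le_left hLpos.le hd']
  -- Solves `l * (1 + x) = 1 + a * ε`; Markov's inequality gives `ε / (l * x) = ε / (a * ε + ε - 5 *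
  -- e) ≤ 1 / a`.
  set x : ℝ := (a * ε + ε - 5 * e) / l with hx
  have haε : ε < a * ε := lt_mul_of_one_lt_left hε ha
  have hx0 : 0 < x := div_pos (by linarith) hl0
  have hδn : 1 / δ ≤ n := by
    refine le_trans ?_ hdδ
    gcongr
    exact one_le_pow₀ hd'
  have hn4 : (4 : ℝ) ≤ n := by linarith
  have hGexp : 10 * ((d : ℝ) + 1) * 2 ^ G / e ≤ Real.exp (2 * L) := by
    have h1 : Real.exp (2 * L) = n * n := by
      rw [two_mul, Real.exp_add, hexp]
    rw [h1]
    calc 10 * ((d : ℝ) + 1) * 2 ^ G / e ≤ 10 * (d + d) * (8 * d ^ 2 / δ) / e := by gcongr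
      _ = 1280 / m * (d ^ 3 / δ) * L := by rw [he]; field_simp; norm_num
      _ ≤ 1 * (d ^ 4 / δ) * L := by
        gcongr
        · rw [div_le_one hm0]; linarith
        · norm_num
      _ ≤ n * n := by
        rw [one_mul]
        exact mul_le_mul hdδ hLn hLpos.le hn0.le
  have hna : 2 ≤ e * n := by
    have : e * L ≤ e * n := by gcongr
    linarith
  have hp : Real.logb 2 (32 * (16 / δ) * (8 / (γ * e) * (18 * L))) / J / x ≤ 1 / a := by
    have h1 : 32 * (16 / δ) * (8 / (γ * e) * (18 * L)) ≤ B := by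
      have h2 : 32 * (16 / δ) * (8 / (γ * e) * (18 * L)) =
          9216 * 2 ^ 41 / m ^ 3 * (d * L ^ 5 / δ) := by
        rw [hγe]; field_simp; norm_num
      -- The factor `m ^ 3` comes from `1 / e ^ 3`; for `m ≥ 2 ^ 17` it absorbs the numerical
      -- constants.
      have h3 : 9216 * 2 ^ 41 / m ^ 3 ≤ 64 := by
        rw [div_le_iff₀ (by positivity)]
        have : (2 ^ 17 : ℝ) ^ 3 ≤ m ^ 3 := pow_le_pow_left₀ (by positivity) hL0 3
        linarith
      calc _ ≤ 64 * (d * L ^ 5 / δ) := by rw [h2]; gcongr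
        _ = 64 * d * L ^ 5 / (1 * δ) := by ring
        _ ≤ B := by rw [hB]; gcongr
    have h2 : Real.logb 2 (32 * (16 / δ) * (8 / (γ * e) * (18 * L))) ≤ Real.logb 2 B :=
      Real.logb_le_logb_of_le (by norm_num) (by positivity) h1
    have h3 : Real.logb 2 (32 * (16 / δ) * (8 / (γ * e) * (18 * L))) / J ≤ ε / l := by
      rw [div_le_div_iff₀ (by linarith) hl0]
      rw [div_le_iff₀ hε] at hJ1
      have := mul_le_mul_of_nonneg_right h2 hl0.le
      linarith
    rw [div_le_iff₀ hx0]
    refine h3.trans ?_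
    rw [hx, one_div, ← mul_div_assoc]
    gcongr
    rw [le_inv_mul_iff₀ (by linarith)]
    linarith
  have hP : Real.exp (-(2 * L)) + δ / 4 + (2 / (16 / δ) + 1 / a) ≤ δ + 1 / a := by
    have h1 : Real.exp (-(2 * L)) = 1 / n * (1 / n) := by
      rw [show -(2 * L) = -L + -L by ring, Real.exp_add, Real.exp_neg, hexp, one_div]
    have h2 : 1 / (n : ℝ) ≤ 1 / 4 := by gcongr
    have h3 : 1 / (n : ℝ) ≤ δ := by
      rw [div_le_iff₀ hn0]
      rwa [div_le_iff₀ hδ, mul_comm] at hδn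
    have h4 : 1 / (n : ℝ) * (1 / n) ≤ 1 / 4 * δ := mul_le_mul h2 h3 (by positivity) (by norm_num)
    have h5 : 2 / (16 / δ) = δ / 8 := by field_simp; norm_num
    rw [h1, h5]
    linarith
  obtain ⟨r, hr, D, hD⟩ := exists_sketch_of_logb_le (G := G) (η := δ / 4) (T := 16 / δ) (x := x)
    (l := l) (s := 1) (α := 1 + a * ε) (ε := ε) (P := δ + 1 / a) (τ := 3) hn hd hL1 he0 he1 hγ
    hJ0 (by linarith) one_pos (by push_cast; linarith) hna hGexp (by positivity)
    (Or.inr (by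
      rw [div_le_div_iff₀ (by positivity) (by norm_num)]
      rw [div_lt_iff₀ hδ] at hG2
      have hd2 : ((d : ℝ) + 1) ^ 2 ≤ (d + d) ^ 2 := by gcongr
      linarith [show ((d : ℝ) + d) ^ 2 = 4 * d ^ 2 by ring])) hγJ
    (by rw [le_div_iff₀ hδ]; linarith) hx0 hl0
    (by
      have h1 : 0 ≤ 5 * e * (ε - 5 * e) := mul_nonneg (by linarith) (by linarith)
      linarith [show l * (1 - 5 * e) = 1 - ε + 5 * e * (ε - 5 * e) by rw [hl]; ring])
    (le_of_eq (by rw [mul_add, hx, mul_div_cancel₀ _ hl0.ne', hl]; ring))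
    (by norm_num) hp hP
  refine ⟨r, hr.trans ?_, D, hD⟩
  -- The scaling saves a factor `B`: the exponent is `l / ε = 1 / ε - 1 + 5 * e / ε`, and its last
  -- term costs at most `L` because `log B ≤ ε * L`.
  have hJpow : (2 : ℝ) ^ J ≤ 2 * (B ^ (1 + ε⁻¹) / B ^ 2 * L) := by
    rw [← Real.rpow_natCast]
    calc (2 : ℝ) ^ (J : ℝ) ≤ 2 ^ (Real.logb 2 B * (l / ε) + 1) :=
          Real.rpow_le_rpow_of_exponent_le (by norm_num) (by
            refine hJ2.trans (le_of_eq ?_); ring)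
      _ = 2 * B ^ (l / ε) := by
          rw [Real.rpow_add_one (by norm_num), Real.rpow_mul (by norm_num),
            Real.rpow_logb (by norm_num) (by norm_num) hB0]
          ring
      _ = 2 * (B ^ (1 + ε⁻¹) / B ^ 2 * B ^ (5 * e / ε)) := by
          rw [show l / ε = (1 + ε⁻¹) - (2 : ℕ) + 5 * e / ε by
            rw [hl]; field_simp; push_cast; ring, Real.rpow_add hB0, Real.rpow_sub hB0,
            Real.rpow_natCast]
      _ ≤ _ := by
          gcongr
          rw [← Real.exp_log hLpos, Real.rpow_def_of_pos hB0]
          refine Real.exp_le_exp.2 ?_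
          calc Real.log B * (5 * e / ε) ≤ ε * L * (5 * e / ε) := by gcongr
            _ = 5 * (e * L) := by field_simp
            _ ≤ Real.log L := by rw [heL]; linarith
  have hBsq : B ^ 2 = 2 ^ 12 * (d ^ 2 * L ^ 10) / (ε ^ 12 * δ ^ 2) := by
    rw [hB, div_pow]; ring
  have hL7 : 2 ^ 40 ≤ L ^ 7 := by
    calc (2 : ℝ) ^ 40 ≤ (2 ^ 17) ^ 7 := by norm_num
      _ ≤ L ^ 7 := pow_le_pow_left₀ (by norm_num) (by linarith) 7
  have hpow0 : 0 ≤ B ^ (1 + ε⁻¹) := by positivity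
  calc 18 * L * (8 / (γ * e) * 2 ^ (G + J))
      ≤ 18 * L * (2 ^ 41 * (d * L ^ 4) / 1 * (8 * d ^ 2 / δ *
        (2 * (B ^ (1 + ε⁻¹) / B ^ 2 * L)))) := by
        rw [hγe, pow_add 2 G J]
        gcongr
        exact one_le_pow₀ (by linarith)
    _ = 288 * 2 ^ 29 * (ε ^ 12 * δ) * (d / L ^ 4) * B ^ (1 + ε⁻¹) := by
        rw [hBsq]; field_simp; norm_num
    _ ≤ 32 * L ^ 7 / ε ^ 5 * (d / L ^ 4) * B ^ (1 + ε⁻¹) := by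
        gcongr
        rw [le_div_iff₀ (by positivity)]
        have h1 : ε ^ 12 * δ * ε ^ 5 ≤ 1 :=
          mul_le_one₀ (mul_le_one₀ (pow_le_one₀ hε.le hε1.le) hδ.le hδ1) (by positivity)
            (pow_le_one₀ hε.le hε1.le)
        linarith
    _ = _ := by field_simp

/-- If `n` is within the bound on `r`, the data themselves are kept. Otherwise the doubly
exponential `E` in the constant forces `log log n ≥ 2 ^ 17`, and the second summand of the bound
gives `B ^ (1 + 1 / ε) ≤ n`, as the asymptotic choice of parameters requires. -/
theorem exists_constant_update_time_sketch :
    ∃ K : ℝ, ∀ ε δ a : ℝ, 0 < ε → 0 < δ → 1 < a →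
      ∀ n d : ℕ, 2 ≤ n → 1 ≤ d →
        ∃ r : ℕ, (r : ℝ) ≤ K * ((d : ℝ) ^ 4 * Real.log n ^ 5 / (δ * ε ^ 7)) +
            32 * d * Real.log n ^ 3 / ε ^ 5 *
              (64 * d * Real.log n ^ 5 / (ε ^ 6 * δ)) ^ (1 + ε⁻¹) ∧
          ∃ D : RandomSketch r n,
            (∀ ω, ComputableInOnePass (D.S ω) d K) ∧
            D.Succeeds d (1 + a * ε) ε (δ + 1 / a) := by
  set E : ℝ := Real.exp (Real.exp (2 ^ 17)) with hE
  have hE1 : 1 ≤ E := Real.one_le_exp (Real.exp_pos _).le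
  refine ⟨32 * E, fun ε δ a hε hδ ha n d hn hd => ?_⟩
  have hd' : (1 : ℝ) ≤ d := by exact_mod_cast hd
  have hn0 : (0 : ℝ) < n := by positivity
  have hlog := half_le_log hn
  set L := Real.log n with hL
  have hL0 : 0 < L := by linarith
  have haε : 0 < a * ε := mul_pos (by linarith) hε
  have ha1 : 0 < 1 / a := one_div_pos.2 (by linarith)
  set R₁ : ℝ := 32 * E * ((d : ℝ) ^ 4 * L ^ 5 / (δ * ε ^ 7)) with hR₁
  set R₂ : ℝ := 32 * d * L ^ 3 / ε ^ 5 * (64 * d * L ^ 5 / (ε ^ 6 * δ)) ^ (1 + ε⁻¹) with hR₂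
  have hR₁0 : 0 < R₁ := by positivity
  have hR₂0 : 0 < R₂ := by positivity
  by_cases hempty : 1 ≤ ε ∨ 1 ≤ δ + 1 / a
  · exact ⟨0, by rw [Nat.cast_zero]; linarith,
      exists_empty_sketch n (by linarith) (by linarith) (by linarith) hempty⟩
  push Not at hempty
  obtain ⟨hε1, hδa⟩ := hempty
  rcases le_or_gt (n : ℝ) (R₁ + R₂) with hnR | hnR
  · exact ⟨n, hnR, exists_identity_sketch n (by linarith) (by linarith) hε.le (by linarith)⟩
  have hδ1 : δ ≤ 1 := by linarith
  have hε7 : ε ^ 7 ≤ 1 := pow_le_one₀ hε.le hε1.le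
  have hL5 : 1 / 32 ≤ L ^ 5 := by
    calc (1 / 32 : ℝ) = (1 / 2) ^ 5 := by norm_num
      _ ≤ L ^ 5 := pow_le_pow_left₀ (by norm_num) hlog 5
  have hR₁' : E * ((d : ℝ) ^ 4 / δ) ≤ R₁ := by
    calc E * ((d : ℝ) ^ 4 / δ) = 32 * E * (d ^ 4 * (1 / 32) / (δ * 1)) := by field_simp
      _ ≤ R₁ := by rw [hR₁]; gcongr
  have hdδ0 : 1 ≤ (d : ℝ) ^ 4 / δ := by
    rw [le_div_iff₀ hδ, one_mul]
    exact hδ1.trans (one_le_pow₀ hd')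
  have hdδ : (d : ℝ) ^ 4 / δ ≤ n := by nlinarith
  have hLE : Real.exp (2 ^ 17) ≤ L := by
    rw [hL, Real.le_log_iff_exp_le hn0]
    change E ≤ n
    nlinarith
  have hLL : 2 ^ 17 ≤ Real.log L := by rwa [Real.le_log_iff_exp_le hL0]
  have hL1 : 1 ≤ L := (Real.one_le_exp (by norm_num)).trans hLE
  have hnB : (64 * d * L ^ 5 / (ε ^ 6 * δ)) ^ (1 + ε⁻¹) ≤ n := by
    have h1 : 1 ≤ 32 * d * L ^ 3 / ε ^ 5 := by
      rw [le_div_iff₀ (by positivity), one_mul]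
      have h2 : ε ^ 5 ≤ 1 := pow_le_one₀ hε.le hε1.le
      have h3 : 1 ≤ d * L ^ 3 := one_le_mul_of_one_le_of_one_le hd' (one_le_pow₀ hL1)
      nlinarith
    have h2 : (64 * d * L ^ 5 / (ε ^ 6 * δ)) ^ (1 + ε⁻¹) ≤ R₂ :=
      le_mul_of_one_le_left (by positivity) h1
    linarith
  obtain ⟨r, hr, D, hD1, hD2⟩ :=
    exists_one_add_eps_sketch hε hε1 hδ hδ1 ha hn hd hLL hdδ hnB
  exact ⟨r, hr.trans (by linarith), D, fun ω => (hD1 ω).mono (by linarith), hD2⟩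

end ConstantUpdateTime

theorem theorem1 :
    (∀ c ε : ℝ, 0 < c → c ≤ 1 → 0 < ε →
      ∃ K P : ℝ, P < 1 ∧ ∀ n d : ℕ, 2 ≤ n → 1 ≤ d →
        ∃ r : ℕ, (r : ℝ) ≤ K * ((d : ℝ) ^ (1 + c) * Real.log n ^ (3 + 5 * c)) ∧
          ∃ D : RandomSketch r n,
            (∀ ω, ComputableInOnePass (D.S ω) d (K * (d * Real.log n))) ∧
            D.Succeeds d (1 + 1 / c) ε P) ∧
    (∃ K : ℝ, ∀ ε δ a : ℝ, 0 < ε → 0 < δ → 1 < a →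
      ∀ n d : ℕ, 2 ≤ n → 1 ≤ d →
        ∃ r : ℕ, (r : ℝ) ≤ K * ((d : ℝ) ^ 4 * Real.log n ^ 5 / (δ * ε ^ 7)) +
            32 * d * Real.log n ^ 3 / ε ^ 5 *
              (64 * d * Real.log n ^ 5 / (ε ^ 6 * δ)) ^ (1 + ε⁻¹) ∧
          ∃ D : RandomSketch r n,
            (∀ ω, ComputableInOnePass (D.S ω) d K) ∧
            D.Succeeds d (1 + a * ε) ε (δ + 1 / a)) := by
  exact ⟨fun _ _ hc hc1 hε => exists_log_update_time_sketch hc hc1 hε,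
    exists_constant_update_time_sketch⟩
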